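/- Let $n\ge 1$ and $k\ge 2$. A de Bruijn sequence of order $n$ over an alphabet is a circular sequence in which every word of length $n$ over the alphabet occurs exactly once. Given a de Bruijn sequence $v=(v_i)_{i\in\mathbb Z/k^n}$ of order $n$ over a $k$-symbol alphabet $A$, let $e_i$ be the word $v_i\cdots v_{i+n-1}$, viewed as an edge of the de Bruijn graph whose vertices are the words of length $n-1$; its head is $v_{i+1}\cdots v_{i+n-1}$. For $0\le j<k^{n-1}$, section $j$ consists of the heads of $e_{jk},\dots,e_{jk+k-1}$. The flow network of $v$ has as vertices a source, a sink, the $k^{n-1}$ words of length $n-1$ and the $k^{n-1}$ sections. It has one edge from the source to each word, one edge from each section to the sink, and, for each $j$ and each $0\le r<k$, one edge from the head of $e_{jk+r}$ to section $j$ (parallel edges are allowed). All capacities are $1$. This network has $|V|=2k^{n-1}+2$ vertices and $|E|=(k+2)k^{n-1}$ edges. There is a single algorithm on a unit-cost random access machine, with words that hold numbers up to $k^{O(n)}$, which, given $k$, $n$ and a de Bruijn sequence $v$ as above, does the following. 1. It builds the flow network of $v$. 2. It runs the Edmonds–Karp method on this network from the zero flow (each round augments along a shortest path of the residual network, until there is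 none), in $O(|V|^2|E|)$ operations. 3. It outputs a circular sequence $w$ over $A\cup\{s\}$, where $s\notin A$ is a new symbol, obtained from $v$ by inserting, for each edge (head of $e_{jk+r}$, section $j$) that carries flow $1$, a petal for that head directly after the symbol $v_{jk+r+n-1}$, and inserting nothing elsewhere. Here a petal for a word $u$ of length $n-1$ over $A$ is a non-empty closed walk from $u$ to $u$ in the de Bruijn graph over $A\cup\{s\}$ all of whose edges, as words of length $n$, contain $s$, which meets no word of length $n-1$ over $A$ strictly between its start and its end, and whose set of edges is closed under rotation of words. The sequence $w$ is a de Bruijn sequence of order $n$ over $A\cup\{s\}$, it has $v$ as a circular subsequence, and among any $n+2k-1$ consecutive symbols of $w$ there is at least one $s$. Steps 1 and 3 together also take $O(|V|^2|E|)$ operations, and the whole algorithm takes $O(k^{3n-2})$ operations. The constants in all these bounds depend on nothing, in particular neither on $k$ nor on $n$. -/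

import Mathlib

/-! ### Circular sequences and de Bruijn sequences

A circular sequence of length `N` is a function on `ZMod N`; the alphabet with `k` symbols is `Fin k`.
The enlarged alphabet is `Fin (k + 1)`; an old symbol `a` becomes `a.castSucc` and the new symbol
is `Fin.last k`. -/

/-- Every word of length `n` occurs exactly once in the circular sequence `v` of length `k ^ n`. -/
def IsDeBruijn (k n : ℕ) (v : ZMod (k ^ n) → Fin k) : Prop :=
  ∀ u : Fin n → Fin k, ∃! i : ZMod (k ^ n), ∀ t : Fin n, v (i + ((t : ℕ) : ZMod (k ^ n))) = u t

/-- The list of the `N` symbols of the circular sequence `w`, read from the position `b` on. -/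
def readFrom {α : Type} {N : ℕ} (w : ZMod N → α) (b : ZMod N) : List α :=
  (List.range N).map fun i => w (b + (i : ZMod N))

/-- The circular sequence `v` is a subsequence of the circular sequence `w` over the enlarged
alphabet, for suitable starting positions. -/
def IsCircularSubseq {k N M : ℕ} (v : ZMod N → Fin k) (w : ZMod M → Fin (k + 1)) : Prop :=
  ∃ a b, ((readFrom v a).map Fin.castSucc).Sublist (readFrom w b)

/-- Among any `L` consecutive symbols of `w` there is an occurrence of the new symbol. -/
def NewSymbolWithin {k M : ℕ} (w : ZMod M → Fin (k + 1)) (L : ℕ) : Prop :=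
  ∀ i : ZMod M, ∃ j < L, w (i + (j : ZMod M)) = Fin.last k

/-! ### Flow networks and the Edmonds–Karp method -/

/-- A flow network, possibly with parallel edges, and with integer capacities. -/
structure FlowNetwork (V E : Type) where
  tail : E → V
  head : E → V
  cap : E → ℕ
  source : V
  sink : V

namespace FlowNetwork

variable {V E : Type} (N : FlowNetwork V E)

/-- The residual arcs are `(e, true)`, along `e`, and `(e, false)`, against `e`. -/
def arcTail (a : E × Bool) : V := if a.2 then N.tail a.1 else N.head a.1

def arcHead (a : E × Bool) : V := if a.2 then N.head a.1 else N.tail a.1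

/-- The residual capacity of an arc with respect to the flow `f`. -/
def residual (f : E → ℕ) (a : E × Bool) : ℕ := if a.2 then N.cap a.1 - f a.1 else f a.1

def IsWalk : V → List (E × Bool) → V → Prop
  | x, [], y => x = y
  | x, a :: p, y => N.arcTail a = x ∧ IsWalk (N.arcHead a) p y

/-- A path from the source to the sink in the residual network of `f`. -/
def IsAugmenting (f : E → ℕ) (p : List (E × Bool)) : Prop :=
  N.IsWalk N.source p N.sink ∧ ∀ a ∈ p, 0 < N.residual f a

/-- An augmenting path with the least possible number of arcs. -/
def IsShortestAugmenting (f : E → ℕ) (p : List (E × Bool)) : Prop :=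
  N.IsAugmenting f p ∧ ∀ q, N.IsAugmenting f q → p.length ≤ q.length

/-- The smallest residual capacity on the path `p`. -/
noncomputable def bottleneck (f : E → ℕ) (p : List (E × Bool)) : ℕ :=
  sInf {c | ∃ a ∈ p, c = N.residual f a}

open Classical in
/-- The flow that results from `f` by pushing the bottleneck amount along the path `p`. -/
noncomputable def augment (f : E → ℕ) (p : List (E × Bool)) : E → ℕ := fun e =>
  if (e, true) ∈ p then f e + N.bottleneck f p
  else if (e, false) ∈ p then f e - N.bottleneck f p
  else f e

/-- One round of Edmonds–Karp: augment along a shortest augmenting path, or find that there is no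
augmenting path and leave the flow as it is. -/
def EKRound (f f' : E → ℕ) : Prop :=
  (∃ p, N.IsShortestAugmenting f p ∧ f' = N.augment f p) ∨
    ((∀ p, ¬ N.IsAugmenting f p) ∧ f' = f)

end FlowNetwork

/-! ### The distribution graph and its flow network

The circular sequence `v` determines the pointed Eulerian cycle of the de Bruijn graph of the words
of length `n - 1` whose `i`-th edge is the word `v i, …, v (i + n - 1)`; it carries the label
`v (i + n - 1)`. -/

/-- The head of the `i`-th edge of the Eulerian cycle, a word of length `n - 1`. -/
def headVertex (k n : ℕ) (v : ZMod (k ^ n) → Fin k) (i : ℕ) : Fin (n - 1) → Fin k :=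
  fun t => v ((i + 1 + t : ℕ) : ZMod (k ^ n))

/-- The vertices of the flow network: a source, a sink, the words of length `n - 1`, and the
sections of the Eulerian cycle. -/
inductive NetVertex (k n : ℕ) : Type where
  | source : NetVertex k n
  | sink : NetVertex k n
  | word (u : Fin (n - 1) → Fin k) : NetVertex k n
  | sect (j : Fin (k ^ (n - 1))) : NetVertex k n

/-- The edges of the flow network. The edge `occ j r` stands for the `r`-th vertex of section `j`,
that is, for the head of the edge number `j * k + r` of the Eulerian cycle. -/
inductive NetEdge (k n : ℕ) : Type where
  | fromSource (u : Fin (n - 1) → Fin k) : NetEdge k n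
  | occ (j : Fin (k ^ (n - 1))) (r : Fin k) : NetEdge k n
  | toSink (j : Fin (k ^ (n - 1))) : NetEdge k n

/-- The distribution graph of `v`, with the source, the sink, and all capacities equal to `1`. -/
def distNetwork (k n : ℕ) (v : ZMod (k ^ n) → Fin k) :
    FlowNetwork (NetVertex k n) (NetEdge k n) where
  tail
    | .fromSource _ => .source
    | .occ j r => .word (headVertex k n v (j * k + r))
    | .toSink j => .sect j
  head
    | .fromSource u => .word u
    | .occ j _ => .sect j
    | .toSink _ => .sink
  cap _ := 1
  source := .source
  sink := .sink

/-! ### Insertion of petals -/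

/-- The list `p` of edge labels over the enlarged alphabet, read from the vertex `u`, is a petal for
`u`: it is a closed walk whose edges all contain the new symbol, that visits no other word
without the new symbol on its way, and whose edges make up full circular words of length `n`. -/
def IsPetal (k n : ℕ) (u : Fin (n - 1) → Fin k) (p : List (Fin (k + 1))) : Prop :=
  let start : List (Fin (k + 1)) := List.ofFn fun t => (u t).castSucc
  let vertex : ℕ → List (Fin (k + 1)) := fun j => ((start ++ p).drop j).take (n - 1)
  let edge : ℕ → List (Fin (k + 1)) := fun j => ((start ++ p).drop j).take n
  p ≠ [] ∧ vertex p.length = start ∧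
    (∀ j, 0 < j → j < p.length → Fin.last k ∈ vertex j) ∧
    (∀ j, j < p.length → Fin.last k ∈ edge j) ∧
    (∀ j, j < p.length → ∀ r : ℕ, ∃ j', j' < p.length ∧ edge j' = (edge j).rotate r)

/-- The circular sequence `w` results from the Eulerian cycle of `v` by the insertion of one petal at
each occurrence of a vertex in a section that the flow `f` chooses, and nowhere else. -/
def IsPetalExtension (k n : ℕ) (v : ZMod (k ^ n) → Fin k) (f : NetEdge k n → ℕ)
    (w : ZMod ((k + 1) ^ n) → Fin (k + 1)) : Prop :=
  ∃ (p : ℕ → List (Fin (k + 1))) (b : ZMod ((k + 1) ^ n)),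
    (∀ (j : Fin (k ^ (n - 1))) (r : Fin k),
      (f (.occ j r) = 1 → IsPetal k n (headVertex k n v (j * k + r)) (p (j * k + r))) ∧
      (f (.occ j r) ≠ 1 → p (j * k + r) = [])) ∧
    readFrom w b = (List.range (k ^ n)).flatMap fun i =>
      (v ((i + (n - 1) : ℕ) : ZMod (k ^ n))).castSucc :: p i

/-! ### The machine model: a random access machine on bounded words

A state consists of registers and arrays, which hold natural numbers. Every operation, test and
memory access costs one step, and a computation may only produce numbers up to a bound `B`. -/

structure MState where
  var : ℕ → ℕ
  arr : ℕ → ℕ → ℕ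

inductive BinOp : Type where
  | add | sub | mul | div | mod | lt | eq

def BinOp.eval : BinOp → ℕ → ℕ → ℕ
  | .add, a, b => a + b
  | .sub, a, b => a - b
  | .mul, a, b => a * b
  | .div, a, b => a / b
  | .mod, a, b => a % b
  | .lt, a, b => if a < b then 1 else 0
  | .eq, a, b => if a = b then 1 else 0

inductive Expr : Type where
  | lit (c : ℕ) : Expr
  | var (x : ℕ) : Expr
  | get (a : ℕ) (i : Expr) : Expr
  | op (o : BinOp) (e₁ e₂ : Expr) : Expr

namespace Expr

def eval (s : MState) : Expr → ℕ
  | lit c => c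
  | var x => s.var x
  | get a i => s.arr a (i.eval s)
  | op o e₁ e₂ => o.eval (e₁.eval s) (e₂.eval s)

/-- The number of operations that the evaluation takes. -/
def cost : Expr → ℕ
  | lit _ => 1
  | var _ => 1
  | get _ i => i.cost + 1
  | op _ e₁ e₂ => e₁.cost + e₂.cost + 1

/-- All numbers that occur in the evaluation are at most `B`. -/
def Fits (B : ℕ) (s : MState) : Expr → Prop
  | lit c => c ≤ B
  | var x => s.var x ≤ B
  | get a i => i.Fits B s ∧ s.arr a (i.eval s) ≤ B
  | op o e₁ e₂ => e₁.Fits B s ∧ e₂.Fits B s ∧ o.eval (e₁.eval s) (e₂.eval s) ≤ B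

end Expr

inductive Prog : Type where
  | skip : Prog
  | assign (x : ℕ) (e : Expr) : Prog
  | store (a : ℕ) (i e : Expr) : Prog
  | seq (P Q : Prog) : Prog
  | ite (e : Expr) (P Q : Prog) : Prog
  | loop (e : Expr) (P : Prog) : Prog

/-- `Exec B P s s' t`: on a machine whose words hold the numbers up to `B`, the program `P`, started
in `s`, halts in `s'` after `t` operations. In tests, `0` means false. -/
inductive Exec (B : ℕ) : Prog → MState → MState → ℕ → Prop where
  | skip (s : MState) : Exec B .skip s s 1
  | assign (s : MState) (x : ℕ) (e : Expr) (he : e.Fits B s) :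
      Exec B (.assign x e) s ⟨Function.update s.var x (e.eval s), s.arr⟩ (e.cost + 1)
  | store (s : MState) (a : ℕ) (i e : Expr) (hi : i.Fits B s) (he : e.Fits B s) :
      Exec B (.store a i e) s
        ⟨s.var, Function.update s.arr a (Function.update (s.arr a) (i.eval s) (e.eval s))⟩
        (i.cost + e.cost + 1)
  | seq {P Q : Prog} {s s' s'' : MState} {t t' : ℕ}
      (hP : Exec B P s s' t) (hQ : Exec B Q s' s'' t') : Exec B (.seq P Q) s s'' (t + t')
  | iteTrue {e : Expr} {P Q : Prog} {s s' : MState} {t : ℕ} (he : e.Fits B s)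
      (h : e.eval s ≠ 0) (hP : Exec B P s s' t) : Exec B (.ite e P Q) s s' (e.cost + 1 + t)
  | iteFalse {e : Expr} {P Q : Prog} {s s' : MState} {t : ℕ} (he : e.Fits B s)
      (h : e.eval s = 0) (hQ : Exec B Q s s' t) : Exec B (.ite e P Q) s s' (e.cost + 1 + t)
  | loopDone {e : Expr} {P : Prog} {s : MState} (he : e.Fits B s)
      (h : e.eval s = 0) : Exec B (.loop e P) s s (e.cost + 1)
  | loopNext {e : Expr} {P : Prog} {s s' s'' : MState} {t t' : ℕ} (he : e.Fits B s)
      (h : e.eval s ≠ 0) (hP : Exec B P s s' t) (hL : Exec B (.loop e P) s' s'' t') :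
      Exec B (.loop e P) s s'' (e.cost + 1 + t + t')

/-! ### Data in memory

Registers: `0` holds `k`, `1` holds `n`, `2` and `3` hold the numbers of vertices and of edges of the
network, `4` controls the Edmonds–Karp loop. Arrays: `0` holds the given sequence, `1`, `2` and `3`
hold the tails, the heads and the capacities of the edges, `4` holds the flow, and `5` holds the
resulting sequence. -/

/-- The initial state: `k`, `n` and the sequence `v` are given, and all else is `0`. -/
def inputState (k n : ℕ) (v : ZMod (k ^ n) → Fin k) : MState where
  var x := if x = 0 then k else if x = 1 then n else 0
  arr a i := if a = 0 ∧ i < k ^ n then (v (i : ZMod (k ^ n)) : ℕ) else 0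

/-- The number with the base-`k` digits `u 0, u 1, …`, the most significant first. -/
def wordNum {k m : ℕ} (u : Fin m → Fin k) : ℕ := ∑ t : Fin m, (u t : ℕ) * k ^ (t.rev : ℕ)

/-- The numbering of the vertices of the network. -/
def NetVertex.num {k n : ℕ} : NetVertex k n → ℕ
  | source => 0
  | sink => 1
  | word u => 2 + wordNum u
  | sect j => 2 + k ^ (n - 1) + j

/-- The numbering of the edges of the network. -/
def NetEdge.num {k n : ℕ} : NetEdge k n → ℕ
  | fromSource u => wordNum u
  | occ j r => k ^ (n - 1) + (j * k + r)
  | toSink j => k ^ (n - 1) + k ^ n + j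

/-- The network `N` is stored in memory as a list of edges. -/
def HoldsNetwork {k n : ℕ} (N : FlowNetwork (NetVertex k n) (NetEdge k n)) (s : MState) : Prop :=
  s.var 2 = Nat.card (NetVertex k n) ∧ s.var 3 = Nat.card (NetEdge k n) ∧
    ∀ e : NetEdge k n, s.arr 1 e.num = (N.tail e).num ∧ s.arr 2 e.num = (N.head e).num ∧
      s.arr 3 e.num = N.cap e

/-- The flow `f` is stored in memory. -/
def HoldsFlow {k n : ℕ} (f : NetEdge k n → ℕ) (s : MState) : Prop :=
  ∀ e : NetEdge k n, s.arr 4 e.num = f e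

/-- The circular sequence `w` is stored in memory as the result. -/
def HoldsResult {k M : ℕ} (w : ZMod M → Fin (k + 1)) (s : MState) : Prop :=
  ∀ i < M, s.arr 5 i = (w (i : ZMod M) : ℕ)

/-- The loop that repeats `P` as long as register `4` is not `0`. -/
def ekLoop (P : Prog) : Prog := .loop (.var 4) P

/-- `EKExec B N P s f s' f' t`: the program `ekLoop P`, started in the state `s` that holds the flow
`f`, carries out the Edmonds–Karp method on `N` from `f` on, one round in each execution of `P`,
and halts after `t` operations in the state `s'` that holds the flow `f'`, for which there is no
augmenting path. -/
inductive EKExec (B : ℕ) {k n : ℕ} (N : FlowNetwork (NetVertex k n) (NetEdge k n)) (P : Prog) :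
    MState → (NetEdge k n → ℕ) → MState → (NetEdge k n → ℕ) → ℕ → Prop where
  | done {s : MState} {f : NetEdge k n → ℕ} (hs : HoldsFlow f s)
      (he : (Expr.var 4).Fits B s) (h : (Expr.var 4).eval s = 0)
      (hf : ∀ p, ¬ N.IsAugmenting f p) : EKExec B N P s f s f ((Expr.var 4).cost + 1)
  | next {s s' s'' : MState} {f f' f'' : NetEdge k n → ℕ} {t t' : ℕ} (hs : HoldsFlow f s)
      (he : (Expr.var 4).Fits B s) (h : (Expr.var 4).eval s ≠ 0)
      (hP : Exec B P s s' t) (hf : N.EKRound f f') (hL : EKExec B N P s' f' s'' f'' t') :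
      EKExec B N P s f s'' f'' ((Expr.var 4).cost + 1 + t + t')

/-! The sequence `v` is an Eulerian cycle of the de Bruijn graph over the `k` old symbols. The words
of length `n` that contain the new symbol `s` are partitioned into closed walks, the petals, one for
each word `u` of length `n - 1` over the old symbols, and each petal is spliced in at one visit of
the cycle to its `u`. Every word over the large alphabet is then traversed exactly once
(`Extension.mem_edges`, `Extension.nodup_edges`), so the labels spell a de Bruijn sequence that
contains `v`.

Petals: rotation splits the words with `s` into cycles of the de Bruijn graph. A class with at least
two `s` is represented by its largest member `s y` and is hung onto the class of `0 y`, which has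
one `s` fewer, by exchanging the successors of `s y` and `0 y`. This makes the classes a forest
whose roots are the classes with a single `s`, one for each `u`, and each tree becomes one closed
walk with first edge `u s` and last edge `s u`. `Petal.reach_rotate` says that a walk that enters a
subtree comes back from it; it yields that a petal is closed under rotation
(`Petal.exists_word_eq_rotate`) and that the petals exhaust the words with `s`
(`Petal.exists_word_eq`). Injectivity of the successor makes them disjoint (`Petal.word_injOn`).

Distribution: every word is the head of `k` edges and every section has `k` heads, so words and
sections form a `k`-regular bipartite multigraph. Hall's counting argument, applied to the part of
the residual network that is reachable from the source, shows that a maximum flow is a perfect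
matching (`fromSource_eq_one`, `selects_of_max`). So each section receives one petal, and `2 * k`
consecutive edges without `s` cannot exist: they would be consecutive in `v`, and the first `2 * k -
1` of them would contain a whole section (`Extension.newSymbolWithin_sequence`).

Time: capacities are `1`, so each augmentation raises the value of the flow by one, and the value is
at most `k ^ (n - 1)`. With a search in `O(|V| |E|)` operations this gives `O(|V|^2 |E|)`, without
any study of how distances grow. The successor of an edge is computed in `O(n)` operations, hence
the output in `O(n (k + 1)^n)`, which `mul_succ_pow_le` absorbs into `k ^ (3 * n - 2)`, the order of
`|V|^2 |E|`. -/

/-! ### A program logic with time bounds for the random access machine -/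

/-- All numbers in memory are at most `m`. -/
def MState.Le (s : MState) (m : ℕ) : Prop := (∀ x, s.var x ≤ m) ∧ ∀ a i, s.arr a i ≤ m

/-- A number `c` such that the evaluation stays below `m ^ c` if the memory stays below `m`. -/
def Expr.size : Expr → ℕ
  | .lit c => c + 1
  | .var _ => 1
  | .get _ i => i.size + 1
  | .op _ e₁ e₂ => e₁.size + e₂.size + 1

/-- Multiplication adds the exponents; the extra `1` pays for the factor `2` of a sum of two
numbers. -/
theorem BinOp.eval_le (o : BinOp) {m a b c d : ℕ} (hm : 2 ≤ m) (ha : a ≤ m ^ c) (hb : b ≤ m ^ d)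
    : o.eval a b ≤ m ^ (c + d + 1) := by
  have hc : 1 ≤ m ^ c := Nat.one_le_pow _ _ (by omega)
  have hd : 1 ≤ m ^ d := Nat.one_le_pow _ _ (by omega)
  have h0 : m ^ (c + d + 1) = m ^ c * m ^ d * m := by ring
  have h1 : m ^ c * m ^ d * 2 ≤ m ^ c * m ^ d * m := Nat.mul_le_mul_left _ hm
  have h2 : m ^ c ≤ m ^ c * m ^ d := Nat.le_mul_of_pos_right _ hd
  have h3 : m ^ d ≤ m ^ c * m ^ d := Nat.le_mul_of_pos_left _ hc
  rw [h0]
  cases o <;> simp only [BinOp.eval]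
  · omega
  · omega
  · have := Nat.mul_le_mul ha hb
    omega
  · have := Nat.div_le_self a b
    omega
  · have := Nat.mod_le a b
    omega
  · split_ifs <;> omega
  · split_ifs <;> omega

theorem Expr.eval_le {m : ℕ} (hm : 2 ≤ m) {s : MState} (hs : s.Le m) (e : Expr) :
    e.eval s ≤ m ^ e.size := by
  have h1 : m ≤ m ^ 1 := by simp
  induction e with
  | lit c =>
    have : c < m ^ c := Nat.lt_pow_self (by omega)
    exact this.le.trans (Nat.pow_le_pow_right (by omega) (by simp [Expr.size]))
  | var x => simpa [Expr.size, Expr.eval] using hs.1 x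
  | get a i =>
    exact (hs.2 a _).trans (h1.trans (Nat.pow_le_pow_right (by omega) (by simp [Expr.size])))
  | op o a b iha ihb => exact o.eval_le hm iha ihb

theorem Expr.fits {m B : ℕ} (hm : 2 ≤ m) {s : MState} (hs : s.Le m) (e : Expr)
    (hB : m ^ e.size ≤ B) : e.Fits B s := by
  have key := e.eval_le hm hs
  induction e with
  | lit c => exact key.trans hB
  | var x => exact key.trans hB
  | get a i ih =>
    refine ⟨ih ((Nat.pow_le_pow_right (by omega) ?_).trans hB) (i.eval_le hm hs), key.trans hB⟩
    simp [Expr.size]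
  | op o a b iha ihb =>
    refine ⟨iha ((Nat.pow_le_pow_right (by omega) ?_).trans hB) (a.eval_le hm hs),
      ihb ((Nat.pow_le_pow_right (by omega) ?_).trans hB) (b.eval_le hm hs), key.trans hB⟩ <;>
    simp only [Expr.size] <;> omega

theorem Expr.Fits.mono {B B' : ℕ} (h : B ≤ B') {s : MState} {e : Expr} (he : e.Fits B s) :
    e.Fits B' s := by
  induction e with
  | lit c => exact le_trans he h
  | var x => exact le_trans he h
  | get a i ih => exact ⟨ih he.1, he.2.trans h⟩
  | op o a b iha ihb => exact ⟨iha he.1, ihb he.2.1, he.2.2.trans h⟩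

theorem Exec.mono {B B' : ℕ} (h : B ≤ B') {P : Prog} {s s' : MState} {t : ℕ}
    (hP : Exec B P s s' t) : Exec B' P s s' t := by
  induction hP with
  | skip s => exact .skip s
  | assign s x e he => exact .assign s x e (he.mono h)
  | store s a i e hi he => exact .store s a i e (hi.mono h) (he.mono h)
  | seq _ _ h₁ h₂ => exact .seq h₁ h₂
  | iteTrue he h' _ h₁ => exact .iteTrue (he.mono h) h' h₁
  | iteFalse he h' _ h₁ => exact .iteFalse (he.mono h) h' h₁
  | loopDone he h' => exact .loopDone (he.mono h) h'
  | loopNext he h' _ _ h₁ h₂ => exact .loopNext (he.mono h) h' h₁ h₂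

/-- The program may write to the register `y`. -/
def Prog.writesVar : Prog → ℕ → Bool
  | .skip, _ => false
  | .assign x _, y => x == y
  | .store _ _ _, _ => false
  | .seq P Q, y => P.writesVar y || Q.writesVar y
  | .ite _ P Q, y => P.writesVar y || Q.writesVar y
  | .loop _ P, y => P.writesVar y

/-- The program may write to the array `b`. -/
def Prog.writesArr : Prog → ℕ → Bool
  | .skip, _ => false
  | .assign _ _, _ => false
  | .store a _ _, b => a == b
  | .seq P Q, b => P.writesArr b || Q.writesArr b
  | .ite _ P Q, b => P.writesArr b || Q.writesArr b
  | .loop _ P, b => P.writesArr b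

/-- The states `s` and `s'` agree except where `P` may write. -/
def Frame (P : Prog) (s s' : MState) : Prop :=
  (∀ x, P.writesVar x = false → s'.var x = s.var x) ∧
    ∀ a, P.writesArr a = false → s'.arr a = s.arr a

theorem Frame.refl (P : Prog) (s : MState) : Frame P s s := ⟨fun _ _ => rfl, fun _ _ => rfl⟩

theorem Frame.trans {P : Prog} {s s' s'' : MState} (h : Frame P s s') (h' : Frame P s' s'') :
    Frame P s s'' :=
  ⟨fun x hx => (h'.1 x hx).trans (h.1 x hx), fun a ha => (h'.2 a ha).trans (h.2 a ha)⟩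

/-- Thanks to this, invariants mention only what a program changes: that it spares a given register
or array is decided by computation. -/
theorem Exec.frame {B : ℕ} {P : Prog} {s s' : MState} {t : ℕ} (h : Exec B P s s' t) :
    Frame P s s' := by
  induction h with
  | skip s => exact Frame.refl _ _
  | assign s x e he =>
    refine ⟨fun y hy => ?_, fun _ _ => rfl⟩
    have : y ≠ x := by rintro rfl; simp [Prog.writesVar] at hy
    simp [Function.update_of_ne this]
  | store s a i e hi he =>
    refine ⟨fun _ _ => rfl, fun b hb => ?_⟩
    have : b ≠ a := by rintro rfl; simp [Prog.writesArr] at hb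
    simp [Function.update_of_ne this]
  | seq _ _ h₁ h₂ =>
    refine ⟨fun y hy => ?_, fun b hb => ?_⟩
    · simp only [Prog.writesVar, Bool.or_eq_false_iff] at hy
      rw [h₂.1 y hy.2, h₁.1 y hy.1]
    · simp only [Prog.writesArr, Bool.or_eq_false_iff] at hb
      rw [h₂.2 b hb.2, h₁.2 b hb.1]
  | iteTrue _ _ _ h₁ =>
    refine ⟨fun y hy => ?_, fun b hb => ?_⟩
    · simp only [Prog.writesVar, Bool.or_eq_false_iff] at hy
      rw [h₁.1 y hy.1]
    · simp only [Prog.writesArr, Bool.or_eq_false_iff] at hb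
      rw [h₁.2 b hb.1]
  | iteFalse _ _ _ h₁ =>
    refine ⟨fun y hy => ?_, fun b hb => ?_⟩
    · simp only [Prog.writesVar, Bool.or_eq_false_iff] at hy
      rw [h₁.1 y hy.2]
    · simp only [Prog.writesArr, Bool.or_eq_false_iff] at hb
      rw [h₁.2 b hb.2]
  | loopDone _ _ => exact Frame.refl _ _
  | loopNext _ _ _ _ h₁ h₂ => exact Frame.trans (P := .loop _ _) h₁ h₂

/-- Started in `s` with all numbers at most `m`, the program halts after at most `T` operations in a
state that satisfies `Q`, and keeps all numbers in memory at most `m`. -/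
def Runs (m : ℕ) (P : Prog) (s : MState) (T : ℕ) (Q : MState → Prop) : Prop :=
  s.Le m → ∃ s' t, Exec (m ^ 20) P s s' t ∧ t ≤ T ∧ s'.Le m ∧ Q s'

theorem Runs.mono {m : ℕ} {P : Prog} {s : MState} {T T' : ℕ} {Q Q' : MState → Prop}
    (h : Runs m P s T Q) (hT : T ≤ T') (hQ : ∀ s', s'.Le m → Frame P s s' → Q s' → Q' s') :
    Runs m P s T' Q' := by
  intro hs
  obtain ⟨s', t, h1, h2, h3, h4⟩ := h hs
  exact ⟨s', t, h1, h2.trans hT, h3, hQ s' h3 h1.frame h4⟩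

theorem Runs.seq {m : ℕ} {P P' : Prog} {s : MState} {T T' : ℕ} {Q Q' : MState → Prop}
    (h : Runs m P s T Q) (h' : ∀ s', s'.Le m → Frame P s s' → Q s' → Runs m P' s' T' Q') :
    Runs m (.seq P P') s (T + T') Q' := by
  intro hs
  obtain ⟨s', t, h1, h2, h3, h4⟩ := h hs
  obtain ⟨s'', t', h1', h2', h3', h4'⟩ := h' s' h3 h1.frame h4 h3
  exact ⟨s'', t + t', .seq h1 h1', by omega, h3', h4'⟩

/-- Total correctness for a loop whose number `N` of rounds is known beforehand: `Inv j` holds after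
`j` rounds, and `c j` bounds the cost of round `j`. The induction is on the number of rounds that
remain. -/
theorem Runs.loop {m : ℕ} (hm : 2 ≤ m) {e : Expr} (hsz : e.size ≤ 20) {P : Prog} {s : MState}
    (N : ℕ) (c : ℕ → ℕ) {Q : MState → Prop} (Inv : ℕ → MState → Prop)
    (h0 : Inv 0 s)
    (hstep : ∀ j < N, ∀ s', s'.Le m → Frame P s s' → Inv j s' →
      e.eval s' ≠ 0 ∧ Runs m P s' (c j) (Inv (j + 1)))
    (hend : ∀ s', s'.Le m → Frame P s s' → Inv N s' → e.eval s' = 0 ∧ Q s') :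
    Runs m (.loop e P) s ((∑ j ∈ Finset.range N, (c j + e.cost + 1)) + e.cost + 1) Q := by
  have fit : ∀ s' : MState, s'.Le m → e.Fits (m ^ 20) s' := fun s' h =>
    e.fits hm h (Nat.pow_le_pow_right (by omega) hsz)
  have key : ∀ d j, j + d = N → ∀ s', s'.Le m → Frame P s s' → Inv j s' →
      Runs m (.loop e P) s' ((∑ i ∈ Finset.Ico j N, (c i + e.cost + 1)) + e.cost + 1) Q := by
    intro d
    induction d with
    | zero =>
      intro j hj s' hs' hF hI _
      obtain rfl : j = N := by omega
      obtain ⟨h1, h2⟩ := hend s' hs' hF hI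
      exact ⟨s', _, .loopDone (fit s' hs') h1, by simp, hs', h2⟩
    | succ d ih =>
      intro j hj s' hs' hF hI _
      obtain ⟨h1, h2⟩ := hstep j (by omega) s' hs' hF hI
      obtain ⟨s₁, t, hE, ht, hs₁, hI₁⟩ := h2 hs'
      obtain ⟨s₂, t', hE', ht', hs₂, hQ⟩ :=
        ih (j + 1) (by omega) s₁ hs₁ (hF.trans hE.frame) hI₁ hs₁
      refine ⟨s₂, _, .loopNext (fit s' hs') h1 hE hE', ?_, hs₂, hQ⟩
      rw [Finset.sum_eq_sum_Ico_succ_bot (by omega : j < N)]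
      omega
  intro hs
  have := key N 0 (by omega) s hs (Frame.refl _ _) h0 hs
  rwa [← Finset.range_eq_Ico] at this

/-- The program has no loops, and its expressions are small. -/
def Prog.simple : Prog → Bool
  | .skip => true
  | .assign _ e => e.size ≤ 20
  | .store _ i e => i.size ≤ 20 && e.size ≤ 20
  | .seq P Q => P.simple && Q.simple
  | .ite e P Q => e.size ≤ 20 && P.simple && Q.simple
  | .loop _ _ => false

/-- The effect of a program without loops. -/
def Prog.run : Prog → MState → MState
  | .skip, s => s
  | .assign x e, s => ⟨Function.update s.var x (e.eval s), s.arr⟩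
  | .store a i e, s =>
    ⟨s.var, Function.update s.arr a (Function.update (s.arr a) (i.eval s) (e.eval s))⟩
  | .seq P Q, s => Q.run (P.run s)
  | .ite e P Q, s => if e.eval s ≠ 0 then P.run s else Q.run s
  | .loop _ _, s => s

/-- The numbers that a program without loops writes are at most `m`. -/
def Prog.Safe (m : ℕ) : Prog → MState → Prop
  | .skip, _ => True
  | .assign _ e, s => e.eval s ≤ m
  | .store _ _ e, s => e.eval s ≤ m
  | .seq P Q, s => P.Safe m s ∧ Q.Safe m (P.run s)
  | .ite e P Q, s => (e.eval s ≠ 0 → P.Safe m s) ∧ (e.eval s = 0 → Q.Safe m s)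
  | .loop _ _, _ => True

/-- A bound for the running time of a program without loops. -/
def Prog.time : Prog → ℕ
  | .skip => 1
  | .assign _ e => e.cost + 1
  | .store _ i e => i.cost + e.cost + 1
  | .seq P Q => P.time + Q.time
  | .ite e P Q => e.cost + 1 + (P.time + Q.time)
  | .loop _ _ => 0

/-- Programs without loops need no reasoning about executions: `run` gives their effect, `time`
their cost, and only the size of the stored values remains to be checked. Intermediate values may
exceed `m`, but not `m ^ 20`. -/
theorem Runs.simple {m : ℕ} (hm : 2 ≤ m) {P : Prog} (hP : P.simple = true) {s : MState}
    (hs : s.Le m → P.Safe m s) : Runs m P s P.time (fun s' => s' = P.run s) := by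
  intro hle
  replace hs := hs hle
  induction P generalizing s with
  | skip => exact ⟨s, 1, .skip s, le_rfl, hle, rfl⟩
  | assign x e =>
    simp only [Prog.simple, decide_eq_true_eq] at hP
    refine ⟨_, _, .assign s x e (e.fits hm hle (Nat.pow_le_pow_right (by omega) hP)), le_rfl,
      ⟨fun y => ?_, hle.2⟩, rfl⟩
    by_cases h : y = x
    · subst h; simpa [Prog.Safe] using hs
    · simpa [Function.update_of_ne h] using hle.1 y
  | store a i e =>
    simp only [Prog.simple, Bool.and_eq_true, decide_eq_true_eq] at hP
    refine ⟨_, _, .store s a i e (i.fits hm hle (Nat.pow_le_pow_right (by omega) hP.1))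
      (e.fits hm hle (Nat.pow_le_pow_right (by omega) hP.2)), le_rfl, ⟨hle.1, fun b j => ?_⟩, rfl⟩
    by_cases h : b = a
    · subst h
      by_cases h' : j = i.eval s
      · subst h'; simpa [Prog.Safe] using hs
      · simpa [Function.update_of_ne h'] using hle.2 b j
    · simpa [Function.update_of_ne h] using hle.2 b j
  | seq P Q ihP ihQ =>
    simp only [Prog.simple, Bool.and_eq_true] at hP
    obtain ⟨s', t, h1, h2, h3, rfl⟩ := ihP hP.1 hle hs.1
    obtain ⟨s'', t', h1', h2', h3', rfl⟩ := ihQ hP.2 h3 hs.2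
    exact ⟨_, _, .seq h1 h1', by simp only [Prog.time]; omega, h3', rfl⟩
  | ite e P Q ihP ihQ =>
    simp only [Prog.simple, Bool.and_eq_true, decide_eq_true_eq] at hP
    have hfit := e.fits hm hle (Nat.pow_le_pow_right (by omega) hP.1.1)
    by_cases h : e.eval s = 0
    · obtain ⟨s', t, h1, h2, h3, rfl⟩ := ihQ hP.2 hle (hs.2 h)
      exact ⟨_, _, .iteFalse hfit h h1, by simp only [Prog.time]; omega, h3, by simp [Prog.run, h]⟩
    · obtain ⟨s', t, h1, h2, h3, rfl⟩ := ihP hP.1.2 hle (hs.1 h)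
      exact ⟨_, _, .iteTrue hfit h h1, by simp only [Prog.time]; omega, h3, by simp [Prog.run, h]⟩
  | loop e P => simp [Prog.simple] at hP

theorem Runs.ite {m : ℕ} (hm : 2 ≤ m) {e : Expr} (hsz : e.size ≤ 20) {P P' : Prog} {s : MState}
    {T T' : ℕ} {Q : MState → Prop} (h : e.eval s ≠ 0 → Runs m P s T Q)
    (h' : e.eval s = 0 → Runs m P' s T' Q) : Runs m (.ite e P P') s (e.cost + 1 + (T + T')) Q := by
  intro hs
  have fit : e.Fits (m ^ 20) s := e.fits hm hs (Nat.pow_le_pow_right (by omega) hsz)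
  by_cases h0 : e.eval s = 0
  · obtain ⟨s', t, h1, h2, h3, h4⟩ := h' h0 hs
    exact ⟨s', _, .iteFalse fit h0 h1, by omega, h3, h4⟩
  · obtain ⟨s', t, h1, h2, h3, h4⟩ := h h0 hs
    exact ⟨s', _, .iteTrue fit h0 h1, by omega, h3, h4⟩

/-- `for i := 0, …, N - 1 do P`, where the register `i` is the counter. -/
def Prog.for (i : ℕ) (N : Expr) (P : Prog) : Prog :=
  .seq (.assign i (.lit 0))
    (.loop (.op .lt (.var i) N) (.seq P (.assign i (.op .add (.var i) (.lit 1)))))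

def MState.set (s : MState) (x v : ℕ) : MState := ⟨Function.update s.var x v, s.arr⟩

@[simp] theorem MState.set_arr (s : MState) (x v : ℕ) : (s.set x v).arr = s.arr := rfl

theorem MState.set_var (s : MState) (x v y : ℕ) :
    (s.set x v).var y = if y = x then v else s.var y := by
  simp [MState.set, Function.update_apply]

/-- A round adds `e.cost + 3` for the test and `4` for the increment to the cost of the body. The
other `e.cost + 5` is the initialisation and the last, failing test. -/
theorem Runs.for {m : ℕ} (hm : 2 ≤ m) {i : ℕ} {e : Expr} {P : Prog} {s : MState} (N T : ℕ)
    (c : ℕ → ℕ) (hsz : e.size ≤ 17) (hi : P.writesVar i = false) (hN : N ≤ m)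
    {Q : MState → Prop} (Inv : ℕ → MState → Prop) (h0 : Inv 0 (s.set i 0))
    (he : ∀ j ≤ N, ∀ s', Frame (.for i e P) s s' → Inv j s' → e.eval s' = N)
    (hstep : ∀ j < N, ∀ s', s'.Le m → Frame (.for i e P) s s' → Inv j s' → s'.var i = j →
      Runs m P s' (c j) (fun s'' => Inv (j + 1) (s''.set i (j + 1))))
    (hend : ∀ s', s'.Le m → Frame (.for i e P) s s' → Inv N s' → Q s')
    (hT : (∑ j ∈ Finset.range N, (c j + (e.cost + 7))) + (e.cost + 5) ≤ T) :
    Runs m (.for i e P) s T Q := by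
  have hF : ∀ s' : MState, Frame (.seq P (.assign i (.op .add (.var i) (.lit 1)))) (s.set i 0) s' →
      Frame (.for i e P) s s' := by
    intro s' h
    refine ⟨fun x hx => ?_, fun a ha => ?_⟩
    · have hx' : (x = i) = False := by
        simp only [eq_iff_iff, iff_false]; rintro rfl; simp [Prog.for, Prog.writesVar] at hx
      rw [h.1 x (by simp only [Prog.for, Prog.writesVar] at hx ⊢; grind)]
      simp [MState.set_var, hx']
    · rw [h.2 a (by simp only [Prog.for, Prog.writesArr] at ha ⊢; grind)]
      rfl
  refine Runs.mono (Runs.seq (Runs.simple hm rfl (fun _ => Nat.zero_le _))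
    (T' := (∑ j ∈ Finset.range N, (c j + 4 + (e.cost + 2) + 1)) + (e.cost + 2) + 1)
    (Q' := Q) ?_) ?_ (fun _ _ _ h => h)
  · rintro s' hs' - rfl
    have : (Expr.op .lt (.var i) e).cost = e.cost + 2 := by simp only [Expr.cost]; omega
    rw [← this]
    refine Runs.loop hm (by simp only [Expr.size]; omega) N (fun j => c j + 4)
      (fun j s' => Inv j s' ∧ s'.var i = j) ⟨h0, by simp [Prog.run, Expr.eval]⟩ ?_ ?_
    · rintro j hj s' hs' hFr ⟨hI, hij⟩
      have he' := he j hj.le s' (hF s' hFr) hI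
      refine ⟨by simp [Expr.eval, BinOp.eval, he', hij, hj], ?_⟩
      refine Runs.seq (hstep j hj s' hs' (hF s' hFr) hI hij) ?_
      intro s'' hs'' hFr' hI'
      have hij' : s''.var i = j := (hFr'.1 i hi).trans hij
      refine Runs.mono (Runs.simple hm rfl (fun _ => ?_)) le_rfl ?_
      · simp [Prog.Safe, Expr.eval, BinOp.eval, hij']; omega
      · rintro _ _ _ rfl
        simp only [Prog.run, Expr.eval, BinOp.eval, hij']
        exact ⟨hI', by simp⟩
    · rintro s' hs' hFr ⟨hI, hij⟩
      have he' := he N le_rfl s' (hF s' hFr) hI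
      exact ⟨by simp [Expr.eval, BinOp.eval, he', hij], hend s' hs' (hF s' hFr) hI⟩
  · refine le_trans ?_ hT
    simp only [Prog.time, Expr.cost]
    have : ∀ j, c j + 4 + (e.cost + 2) + 1 = c j + (e.cost + 7) := by intro j; omega
    simp only [this]
    omega

/-! ### Petals: joining the circular words that contain the new symbol -/

namespace Petal

variable {k : ℕ}

/-- The number with the base-`k + 1` digits `x`, the most significant first. -/
def val (x : List (Fin (k + 1))) : ℕ := x.foldl (fun a d => a * (k + 1) + d) 0

@[simp] theorem val_nil : val ([] : List (Fin (k + 1))) = 0 := rfl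

theorem val_concat (x : List (Fin (k + 1))) (a : Fin (k + 1)) :
    val (x ++ [a]) = val x * (k + 1) + a := by simp [val]

theorem val_cons (a : Fin (k + 1)) (x : List (Fin (k + 1))) :
    val (a :: x) = a * (k + 1) ^ x.length + val x := by
  induction x using List.reverseRecOn with
  | nil => simp [val]
  | append_singleton x b ih =>
    rw [← List.cons_append, val_concat, val_concat, ih]
    simp only [List.length_append, List.length_singleton, pow_succ]
    ring

theorem val_lt (x : List (Fin (k + 1))) : val x < (k + 1) ^ x.length := by
  induction x with
  | nil => simp
  | cons a x ih =>
    rw [val_cons, List.length_cons, pow_succ]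
    have h : (a : ℕ) + 1 ≤ k + 1 := a.2
    have := Nat.mul_le_mul_right ((k + 1) ^ x.length) h
    nlinarith

theorem val_cons_lt {a b : Fin (k + 1)} (h : a < b) {x y : List (Fin (k + 1))}
    (hl : x.length = y.length) : val (a :: x) < val (b :: y) := by
  rw [val_cons, val_cons, hl]
  have h1 := val_lt x
  rw [hl] at h1
  have h2 : (a : ℕ) + 1 ≤ b := h
  have := Nat.mul_le_mul_right ((k + 1) ^ y.length) h2
  nlinarith

theorem val_inj {x y : List (Fin (k + 1))} (hl : x.length = y.length) (h : val x = val y) :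
    x = y := by
  induction x generalizing y with
  | nil => exact (List.length_eq_zero_iff.1 hl.symm).symm
  | cons a x ih =>
    cases y with
    | nil => simp at hl
    | cons b y =>
      have hl' : x.length = y.length := by simpa using hl
      rcases lt_trichotomy a b with hab | rfl | hab
      · exact absurd h (val_cons_lt hab hl').ne
      · rw [val_cons, val_cons, hl'] at h
        rw [ih hl' (by omega)]
      · exact absurd h (val_cons_lt hab hl'.symm).ne'

/-- The word `s y` is the largest among its rotations, where `s` is the new symbol. -/
def IsTop (y : List (Fin (k + 1))) : Prop :=
  ∀ r, val ((Fin.last k :: y).rotate r) ≤ val (Fin.last k :: y)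

theorem exists_rotate_eq_cons {a : Fin (k + 1)} {x : List (Fin (k + 1))} (h : a ∈ x) :
    ∃ r y, x.rotate r = a :: y := by
  obtain ⟨l₁, l₂, rfl⟩ := List.append_of_mem h
  exact ⟨l₁.length, l₂ ++ l₁, by rw [List.rotate_append_length_eq]; rfl⟩

theorem length_of_rotate_eq_cons {a : Fin (k + 1)} {x y : List (Fin (k + 1))} {r : ℕ}
    (h : x.rotate r = a :: y) : x.length = y.length + 1 := by
  simpa using congrArg List.length h

/-- A proper rotation of `s y` starts with an old symbol, and the new symbol is the largest digit.
-/
theorem isTop_of_not_mem {y : List (Fin (k + 1))} (h : Fin.last k ∉ y) : IsTop y := by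
  intro r
  rw [← List.rotate_mod]
  have hlt : r % (Fin.last k :: y).length < (Fin.last k :: y).length :=
    Nat.mod_lt _ (by simp)
  generalize r % (Fin.last k :: y).length = r at hlt
  cases r with
  | zero => simp
  | succ r =>
    rw [List.rotate_eq_drop_append_take hlt.le]
    simp only [List.drop_succ_cons, List.take_succ_cons]
    simp only [List.length_cons, Nat.add_lt_add_iff_right] at hlt
    rw [List.drop_eq_getElem_cons hlt, List.cons_append]
    refine (val_cons_lt (Fin.lt_last_iff_ne_last.2 ?_) ?_).le
    · intro h'
      exact h (h' ▸ List.getElem_mem hlt)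
    · simp; omega

/-- A rotation of largest value starts with the new symbol, because some rotation does. -/
theorem exists_isTop {x : List (Fin (k + 1))} (h : Fin.last k ∈ x) :
    ∃ r y, x.rotate r = Fin.last k :: y ∧ IsTop y := by
  have hpos : 0 < x.length := List.length_pos_of_mem h
  obtain ⟨r, -, hr⟩ := Finset.exists_max_image (Finset.range x.length)
    (fun r => val (x.rotate r)) ⟨0, by simpa using hpos⟩
  have hmax : ∀ r', val (x.rotate r') ≤ val (x.rotate r) := by
    intro r'
    rw [← List.rotate_mod x r']
    exact hr _ (Finset.mem_range.2 (Nat.mod_lt _ hpos))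
  obtain ⟨r₀, z, hz⟩ := exists_rotate_eq_cons h
  cases hx : x.rotate r with
  | nil =>
    have := congrArg List.length hx
    simp at this
    simp [this] at hpos
  | cons a y =>
    have h1 := hmax r₀
    rw [hx, hz] at h1
    have hl : y.length = z.length := by
      have := length_of_rotate_eq_cons hx
      have := length_of_rotate_eq_cons hz
      omega
    have ha : a = Fin.last k := by
      by_contra ha
      exact absurd (val_cons_lt (Fin.lt_last_iff_ne_last.2 ha) hl) (not_lt.2 h1)
    subst ha
    refine ⟨r, y, hx, fun r' => ?_⟩
    rw [← hx, List.rotate_rotate]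
    exact hmax _

open Classical in
/-- The label of the edge that follows the edge `a y` in its petal. -/
noncomputable def next (y : List (Fin (k + 1))) (a : Fin (k + 1)) : Fin (k + 1) :=
  if Fin.last k ∈ y ∧ IsTop y then Equiv.swap 0 (Fin.last k) a else a

theorem next_injective (y : List (Fin (k + 1))) : Function.Injective (next y) := by
  intro a b h
  unfold next at h
  split_ifs at h
  · exact (Equiv.swap _ _).injective h
  · exact h

/-- The edge that follows an edge in its petal. -/
noncomputable def succ : List (Fin (k + 1)) → List (Fin (k + 1))
  | [] => []
  | a :: y => y ++ [next y a]

/-- Injectivity allows walks to be traced backwards; the disjointness of the petals rests on it. -/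
theorem succ_injective : Function.Injective (succ (k := k)) := by
  intro x x' h
  cases x with
  | nil => cases x' <;> simp [succ] at h ⊢
  | cons a y =>
    cases x' with
    | nil => simp [succ] at h
    | cons b z =>
      simp only [succ] at h
      obtain ⟨rfl, h⟩ := List.append_inj' h rfl
      rw [next_injective y (List.singleton_injective h)]

@[simp] theorem length_succ (x : List (Fin (k + 1))) : (succ x).length = x.length := by
  cases x <;> simp [succ]

@[simp] theorem length_iterate_succ (i : ℕ) (x : List (Fin (k + 1))) :
    (succ^[i] x).length = x.length := by
  induction i with
  | zero => rfl
  | succ i ih => rw [Function.iterate_succ_apply', length_succ, ih]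

/-- Only the symbol that moves to the end can be altered, and only if another new symbol remains in
the word. -/
theorem mem_succ {x : List (Fin (k + 1))} (h : Fin.last k ∈ x) : Fin.last k ∈ succ x := by
  cases x with
  | nil => simp at h
  | cons a y =>
    by_cases hy : Fin.last k ∈ y
    · simp [succ, hy]
    · have ha : Fin.last k = a := by simpa [hy] using h
      simp [succ, next, hy, ← ha]

theorem succ_of_not_mem {y : List (Fin (k + 1))} (h : Fin.last k ∉ y) (a : Fin (k + 1)) :
    succ (a :: y) = y ++ [a] := by simp [succ, next, h]

/-- A word at whose end a petal ends. -/
def Final (x : List (Fin (k + 1))) : Prop := ∃ y, Fin.last k ∉ y ∧ x = Fin.last k :: y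

/-- The walk along the petals leads from `x` to `x'`, and does not pass the end of a petal. -/
def Reach (x x' : List (Fin (k + 1))) : Prop :=
  ∃ N, succ^[N] x = x' ∧ ∀ i < N, ¬ Final (succ^[i] x)

theorem Reach.refl (x : List (Fin (k + 1))) : Reach x x := ⟨0, rfl, by simp⟩

theorem Reach.trans {x y z : List (Fin (k + 1))} (h : Reach x y) (h' : Reach y z) :
    Reach x z := by
  obtain ⟨N, rfl, hN⟩ := h
  obtain ⟨M, rfl, hM⟩ := h'
  refine ⟨M + N, Function.iterate_add_apply _ _ _ _, fun i hi => ?_⟩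
  by_cases h : i < N
  · exact hN i h
  · have := hM (i - N) (by omega)
    rwa [← Function.iterate_add_apply, Nat.sub_add_cancel (by omega)] at this

theorem Reach.single {x : List (Fin (k + 1))} (h : ¬ Final x) : Reach x (succ x) :=
  ⟨1, rfl, fun i hi => by obtain rfl : i = 0 := by omega
                          exact h⟩

/-- Both words have the largest value in the same rotation class, and values determine words. -/
theorem eq_of_isTop_of_rotate {y z : List (Fin (k + 1))} {r : ℕ}
    (h : (Fin.last k :: y).rotate r = Fin.last k :: z) (hy : IsTop y) (hz : IsTop z) : z = y := by
  have h1 := hy r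
  rw [h] at h1
  -- Rotating by a multiple of the length minus `r` undoes the rotation by `r`.
  have h2 := hz ((Fin.last k :: y).length * (r + 1) - r)
  rw [← h, List.rotate_rotate] at h2
  have h3 : r + ((Fin.last k :: y).length * (r + 1) - r) = (Fin.last k :: y).length * (r + 1) := by
    have : r + 1 ≤ (Fin.last k :: y).length * (r + 1) := Nat.le_mul_of_pos_left _ (by simp)
    omega
  rw [h3, List.rotate_length_mul, h] at h2
  have hl := congrArg List.length h
  exact List.cons_injective (val_inj (by simpa using hl.symm) (le_antisymm h1 h2))

/-- From the edge `y s` the walk leads to the edge `s y` if it leads along the rotations of the words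
that are not the largest among their rotations. -/
theorem reach_of_isTop {y : List (Fin (k + 1))} (hy : IsTop y)
    (h : ∀ x r, x = (y ++ [Fin.last k]).rotate r → (∀ z, x = Fin.last k :: z → ¬ IsTop z) →
      Reach x (x.rotate 1)) : Reach (y ++ [Fin.last k]) (Fin.last k :: y) := by
  have h1 : y ++ [Fin.last k] = (Fin.last k :: y).rotate 1 := by simp
  -- The walk follows the rotations until it meets the largest one; as that word is unique in its
  -- class, it is `s y`.
  have key : ∀ i, Reach (y ++ [Fin.last k]) (Fin.last k :: y) ∨
      Reach (y ++ [Fin.last k]) ((y ++ [Fin.last k]).rotate i) := by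
    intro i
    induction i with
    | zero => right; simpa using Reach.refl _
    | succ i ih =>
      rcases ih with ih | ih
      · exact .inl ih
      · by_cases hx : ∀ z, (y ++ [Fin.last k]).rotate i = Fin.last k :: z → ¬ IsTop z
        · right
          have := ih.trans (h _ i rfl hx)
          rwa [List.rotate_rotate] at this
        · push Not at hx
          obtain ⟨z, hz, hz'⟩ := hx
          left
          have hr : (Fin.last k :: y).rotate (1 + i) = Fin.last k :: z := by
            rw [← List.rotate_rotate, ← h1, hz]
          rwa [hz, eq_of_isTop_of_rotate hr hy hz'] at ih
  rcases key y.length with h' | h'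
  · exact h'
  · rwa [List.rotate_append_length_eq] at h'

/-- Wherever `succ` is not a rotation, the walk makes a detour and comes back to the rotated word.
The detour leads through a class with one more new symbol, so the induction is on the number of old
symbols. The excluded words are those at which the walk leaves a class for its parent or ends a
petal. -/
theorem reach_rotate : ∀ (d : ℕ) (x : List (Fin (k + 1))),
    x.length - x.count (Fin.last k) ≤ d → Fin.last k ∈ x →
    (∀ y, x = Fin.last k :: y → ¬ IsTop y) → Reach x (x.rotate 1) := by
  intro d
  induction d using Nat.strong_induction_on with
  | _ d ih =>
    intro x hd hs hx
    have hfin : ¬ Final x := by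
      rintro ⟨y, hy, rfl⟩
      exact hx y rfl (isTop_of_not_mem hy)
    cases x with
    | nil => simp at hs
    | cons a y =>
      rw [List.rotate_cons_succ, List.rotate_zero]
      by_cases hP : Fin.last k ∈ y ∧ IsTop y
      · have ha : a ≠ Fin.last k := by
          rintro rfl
          exact hx y rfl hP.2
        by_cases ha0 : a = 0
        · subst ha0
          have h1 := Reach.single hfin
          have e1 : succ (0 :: y) = y ++ [Fin.last k] := by simp [succ, next, hP]
          have e2 : succ (Fin.last k :: y) = y ++ [0] := by simp [succ, next, hP]
          rw [e1] at h1
          have hfin' : ¬ Final (Fin.last k :: y) := by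
            rintro ⟨z, hz, hz'⟩
            exact hz (List.cons_injective hz' ▸ hP.1)
          have h3 := Reach.single hfin'
          rw [e2] at h3
          -- The detour: from `0 y` to `y s`, around the class of `s y` up to `s y`, and from there
          -- to `y 0`, the rotation of `0 y`.
          refine (h1.trans (reach_of_isTop hP.2 ?_)).trans h3
          intro x r hxr hx'
          have hc : (y ++ [Fin.last k]).count (Fin.last k) = y.count (Fin.last k) + 1 := by simp
          have hc' : x.count (Fin.last k) = y.count (Fin.last k) + 1 := by
            rw [hxr, (List.rotate_perm _ _).count_eq, hc]
          have hl : x.length = y.length + 1 := by rw [hxr]; simp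
          have hlt : ((0 : Fin (k + 1)) :: y).count (Fin.last k) = y.count (Fin.last k) := by
            rw [List.count_cons_of_ne ha]
          have := List.count_le_length (a := Fin.last k) (l := y)
          refine ih (d - 1) ?_ x ?_ ?_ hx'
          · rw [hlt] at hd
            simp only [List.length_cons] at hd
            omega
          · rw [hlt] at hd
            simp only [List.length_cons] at hd
            omega
          · rw [hxr]; simp
        · have : succ (a :: y) = y ++ [a] := by
            simp [succ, next, hP, Equiv.swap_apply_of_ne_of_ne ha0 ha]
          exact this ▸ Reach.single hfin
      · have : succ (a :: y) = y ++ [a] := by simp [succ, next, hP]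
        exact this ▸ Reach.single hfin

theorem reach_top {y : List (Fin (k + 1))} (hy : IsTop y) :
    Reach (y ++ [Fin.last k]) (Fin.last k :: y) :=
  reach_of_isTop hy fun x r hxr hx => reach_rotate _ x le_rfl (by rw [hxr]; simp) hx

open Classical in
/-- The number of edges of the petal of `u`, minus `1`. -/
noncomputable def len (u : List (Fin (k + 1))) : ℕ :=
  if h : Reach (u ++ [Fin.last k]) (Fin.last k :: u) then h.choose else 0

/-- The `i`-th edge of the petal of `u`. -/
noncomputable def word (u : List (Fin (k + 1))) (i : ℕ) : List (Fin (k + 1)) :=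
  succ^[i] (u ++ [Fin.last k])

@[simp] theorem word_zero (u : List (Fin (k + 1))) : word u 0 = u ++ [Fin.last k] := rfl

theorem word_succ (u : List (Fin (k + 1))) (i : ℕ) : word u (i + 1) = succ (word u i) :=
  Function.iterate_succ_apply' _ _ _

theorem word_add (u : List (Fin (k + 1))) (i j : ℕ) : word u (i + j) = succ^[j] (word u i) := by
  rw [word, word, ← Function.iterate_add_apply, add_comm i j]

@[simp] theorem length_word (u : List (Fin (k + 1))) (i : ℕ) :
    (word u i).length = u.length + 1 := by simp [word]

theorem last_mem_word (u : List (Fin (k + 1))) (i : ℕ) : Fin.last k ∈ word u i := by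
  induction i with
  | zero => simp
  | succ i ih => rw [word_succ]; exact mem_succ ih

variable {u : List (Fin (k + 1))} (hu : Fin.last k ∉ u)
include hu

theorem word_len : word u (len u) = Fin.last k :: u := by
  have h := reach_top (isTop_of_not_mem hu)
  rw [len, dif_pos h]
  exact h.choose_spec.1

theorem not_final_word {i : ℕ} (hi : i < len u) : ¬ Final (word u i) := by
  have h := reach_top (isTop_of_not_mem hu)
  rw [len, dif_pos h] at hi
  exact h.choose_spec.2 i hi

/-- No edge before the last one of a petal is followed by the first edge of a petal. -/
theorem succ_word_ne {i : ℕ} (hi : i < len u) {u' : List (Fin (k + 1))} (hu' : Fin.last k ∉ u') :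
    succ (word u i) ≠ u' ++ [Fin.last k] := by
  intro h
  rw [← succ_of_not_mem hu'] at h
  exact not_final_word hu hi ⟨u', hu', succ_injective h⟩

/-- Going back `i` steps on both sides turns a common edge into a first edge `u' s` at position `j -
i` of the petal of `u`, and first edges occur only at position `0`. -/
theorem word_injOn {i j : ℕ} (hij : i ≤ j) (hj : j ≤ len u) {u' : List (Fin (k + 1))}
    (hu' : Fin.last k ∉ u') (h : word u' i = word u j) : u' = u ∧ i = j := by
  have h1 : word u' 0 = word u (j - i) := by
    refine succ_injective.iterate i ?_
    rw [← word_add, ← word_add, zero_add, Nat.sub_add_cancel hij, h]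
  by_cases hji : j - i = 0
  · rw [hji] at h1
    exact ⟨(List.append_inj' h1 rfl).1, by omega⟩
  · obtain ⟨d, hd⟩ := Nat.exists_eq_succ_of_ne_zero hji
    rw [hd, Nat.succ_eq_add_one, word_succ] at h1
    exact absurd h1.symm (succ_word_ne hu (by omega) hu')

/-- The edges of a petal are closed under rotation. -/
theorem exists_word_eq_rotate_one {i : ℕ} (hi : i ≤ len u) :
    ∃ j ≤ len u, word u j = (word u i).rotate 1 := by
  by_cases h : ∀ y, word u i = Fin.last k :: y → ¬ IsTop y
  · obtain ⟨N, h1, h2⟩ := reach_rotate _ _ le_rfl (last_mem_word u i) h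
    refine ⟨i + N, ?_, by rw [word_add, h1]⟩
    -- The walk to the rotated word passes no final edge, so it cannot go beyond the last edge `s u`
    -- of the petal.
    by_contra hlt
    refine h2 (len u - i) (by omega) ?_
    rw [← word_add, Nat.add_sub_cancel' hi, word_len hu]
    exact ⟨u, hu, rfl⟩
  · push Not at h
    obtain ⟨y, hy, hy'⟩ := h
    rw [hy, List.rotate_cons_succ, List.rotate_zero]
    by_cases hys : Fin.last k ∈ y
    · obtain ⟨N, h1, h2⟩ := reach_top hy'
      by_cases hN : N ≤ i
      · refine ⟨i - N, by omega, ?_⟩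
        refine succ_injective.iterate N ?_
        rw [← word_add, Nat.sub_add_cancel hN, h1, hy]
      -- If the petal started inside this walk, its first edge `u s` would be preceded there by `s
      -- u`, which is final.
      · exfalso
        have h3 : word u 0 = succ^[N - i] (y ++ [Fin.last k]) := by
          refine succ_injective.iterate i ?_
          rw [← word_add, zero_add, ← Function.iterate_add_apply, Nat.add_sub_cancel' (by omega),
            h1, hy]
        obtain ⟨d, hd⟩ := Nat.exists_eq_succ_of_ne_zero (by omega : N - i ≠ 0)
        rw [hd, Function.iterate_succ_apply', word_zero, ← succ_of_not_mem hu] at h3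
        exact h2 d (by omega) ⟨u, hu, (succ_injective h3).symm⟩
    · refine ⟨0, by omega, ?_⟩
      by_cases hlt : i < len u
      · exact absurd ⟨y, hys, hy⟩ (not_final_word hu hlt)
      · obtain rfl : i = len u := by omega
        rw [word_len hu] at hy
        rw [List.cons_injective hy, word_zero]

theorem exists_word_eq_rotate {i : ℕ} (hi : i ≤ len u) (r : ℕ) :
    ∃ j ≤ len u, word u j = (word u i).rotate r := by
  induction r with
  | zero => exact ⟨i, hi, by simp⟩
  | succ r ih =>
    obtain ⟨j, hj, hj'⟩ := ih
    obtain ⟨l, hl, hl'⟩ := exists_word_eq_rotate_one hu hj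
    exact ⟨l, hl, by rw [hl', hj', List.rotate_rotate]⟩

omit hu in
/-- Every word with the new symbol is an edge of a petal. -/
theorem exists_word_eq (hk : 1 ≤ k) {n : ℕ} : ∀ (d : ℕ) (x : List (Fin (k + 1))),
    x.count (Fin.last k) ≤ d →
    x.length = n + 1 → Fin.last k ∈ x →
    ∃ u, Fin.last k ∉ u ∧ u.length = n ∧ ∃ i ≤ len u, word u i = x := by
  intro d
  induction d with
  | zero =>
    intro x hd _ hs
    exact absurd (List.count_pos_iff.2 hs) (by omega)
  | succ d ih =>
    intro x hd hl hs
    obtain ⟨r, y, hr, hy⟩ := exists_isTop hs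
    have hly := length_of_rotate_eq_cons hr
    have hback : ∀ z i, z = (Fin.last k :: y).rotate i → ∃ r', z.rotate r' = x := by
      intro z i hz
      refine ⟨x.length * (r + i) - (r + i), ?_⟩
      have : r + i ≤ x.length * (r + i) := Nat.le_mul_of_pos_left _ (by omega)
      rw [hz, ← hr, List.rotate_rotate, List.rotate_rotate, ← add_assoc, Nat.add_sub_cancel' this,
        List.rotate_length_mul]
    by_cases hys : Fin.last k ∈ y
    · have hc : (Fin.last k :: y).count (Fin.last k) ≤ d + 1 := by
        rw [← hr, (List.rotate_perm _ _).count_eq]; exact hd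
      have h0 : (0 : Fin (k + 1)) ≠ Fin.last k := by
        intro h
        have := congrArg Fin.val h
        simp at this
        omega
      rw [List.count_cons_self] at hc
      -- The word `0 y` has one new symbol fewer, so it lies in a petal. There it is followed by `y
      -- s`, a rotation of `x`, and petals are closed under rotation.
      obtain ⟨u, hu, hul, i, hi, hiw⟩ := ih (0 :: y) (by rw [List.count_cons_of_ne h0]; omega)
        (by simp; omega) (by simp [hys])
      have hlt : i < len u := by
        by_contra hge
        obtain rfl : i = len u := by omega
        rw [word_len hu] at hiw
        exact h0 (List.cons_eq_cons.1 hiw).1.symm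
      obtain ⟨r', hr'⟩ := hback (word u (i + 1)) 1 (by
        rw [word_succ, hiw]; simp [succ, next, hys, hy])
      obtain ⟨j, hj, hj'⟩ := exists_word_eq_rotate hu (i := i + 1) (by omega) r'
      exact ⟨u, hu, hul, j, hj, hj'.trans hr'⟩
    · obtain ⟨r', hr'⟩ := hback (Fin.last k :: y) 0 (by simp)
      obtain ⟨j, hj, hj'⟩ := exists_word_eq_rotate hys (i := len y) le_rfl r'
      rw [word_len hys] at hj'
      exact ⟨y, hys, by omega, j, hj, hj'.trans hr'⟩

end Petal

/-! ### Petals as strings of edge labels. -/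

namespace Petal

/-- The last symbol of a word. -/
def label {k : ℕ} (x : List (Fin (k + 1))) : Fin (k + 1) := x.getLastD 0

@[simp] theorem label_concat {k : ℕ} (x : List (Fin (k + 1))) (a : Fin (k + 1)) :
    label (x ++ [a]) = a := by simp [label]

theorem succ_eq_tail_append {k : ℕ} {x : List (Fin (k + 1))} (h : x ≠ []) :
    succ x = x.tail ++ [label (succ x)] := by
  cases x with
  | nil => exact absurd rfl h
  | cons a y => simp [succ]

theorem word_succ_eq {k : ℕ} (u : List (Fin (k + 1))) (i : ℕ) :
    word u (i + 1) = (word u i).tail ++ [label (word u (i + 1))] := by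
  rw [word_succ]
  refine succ_eq_tail_append ?_
  rw [← List.length_pos_iff]
  simp

/-- The edges of the petal of `u`. -/
noncomputable def words {k : ℕ} (u : List (Fin (k + 1))) : List (List (Fin (k + 1))) :=
  (List.range (len u + 1)).map (word u)

/-- The labels of the edges of the petal of `u`. -/
noncomputable def labels {k : ℕ} (u : List (Fin (k + 1))) : List (Fin (k + 1)) :=
  (words u).map label

section Walk

variable {α : Type} {u : List α} {x : ℕ → List α} {c : ℕ → α}
  (h0 : x 0 = u ++ [c 0]) (h : ∀ i, x (i + 1) = (x i).tail ++ [c (i + 1)])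
include h0 h

theorem walk_eq_drop_append (N : ℕ) :
    x N = (u ++ (List.range N).map c).drop N ++ [c N] := by
  induction N with
  | zero => simpa using h0
  | succ N ih =>
    rw [h, ih, List.range_succ, List.map_append, ← List.append_assoc, List.map_singleton,
      ← List.tail_drop, List.drop_append_of_le_length (l₁ := u ++ (List.range N).map c) (by simp)]

theorem walk_eq_drop (N : ℕ) : x N = (u ++ (List.range (N + 1)).map c).drop N := by
  rw [walk_eq_drop_append h0 h, List.range_succ, List.map_append, ← List.append_assoc,
    List.map_singleton, List.drop_append_of_le_length (l₂ := [c N]) (by simp)]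

/-- An edge is a window of the string spelled by the start vertex and the labels; later labels do
not affect it. This translates between walks and the strings of `IsPetal`. -/
theorem walk_eq_take_drop {N j : ℕ} (hj : j < N) :
    ((u ++ (List.range N).map c).drop j).take (u.length + 1) = x j := by
  obtain ⟨d, rfl⟩ := Nat.exists_eq_add_of_lt hj
  have : (List.range (j + d + 1)).map c =
      (List.range (j + 1)).map c ++ (List.range d).map (fun i => c (j + 1 + i)) := by
    rw [show j + d + 1 = (j + 1) + d by omega, List.range_add]
    simp [Function.comp_def]
  rw [this, ← List.append_assoc, List.drop_append_of_le_length (by simp; omega),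
    ← walk_eq_drop h0 h, List.take_left']
  rw [walk_eq_drop h0 h]
  simp; omega

end Walk

theorem isPetal_labels {k n : ℕ} (hn : 1 ≤ n) (u : Fin (n - 1) → Fin k) :
    IsPetal k n u (labels (List.ofFn fun t => (u t).castSucc)) := by
  set U : List (Fin (k + 1)) := List.ofFn fun t => (u t).castSucc with hU
  have hmem : Fin.last k ∉ U := by
    simp [hU, List.mem_ofFn]
  have hlen : U.length = n - 1 := by simp [hU]
  have hp : labels U = (List.range (len U + 1)).map fun i => label (word U i) := by
    simp [labels, words]
  have h0 : word U 0 = U ++ [label (word U 0)] := by simp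
  have hs := word_succ_eq U
  have hpl : (labels U).length = len U + 1 := by simp [hp]
  have hedge : ∀ j < len U + 1, ((U ++ labels U).drop j).take n = word U j := by
    intro j hj
    rw [hp, ← walk_eq_take_drop (c := fun i => label (word U i)) h0 hs hj, hlen,
      Nat.sub_add_cancel hn]
  have hend : (U ++ labels U).drop (len U + 1) = U := by
    have := walk_eq_drop (c := fun i => label (word U i)) h0 hs (len U)
    rw [← hp, word_len hmem] at this
    rw [← List.tail_drop, ← this, List.tail_cons]
  have hmid : ∀ j, j < len U + 1 → 0 < j → Fin.last k ∈ ((U ++ labels U).drop j).take (n - 1) := by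
    intro j hj hj0
    obtain ⟨i, rfl⟩ := Nat.exists_eq_succ_of_ne_zero hj0.ne'
    have h1 : ((U ++ labels U).drop (i + 1)).take (n - 1) = (word U (i + 1)).take (n - 1) := by
      rw [← hedge _ hj, List.take_take, min_eq_left (by omega)]
    rw [Nat.succ_eq_add_one, h1, hs, List.take_left' (by simp; omega)]
    -- If the new symbol is absent from this vertex, it was only the first symbol of the preceding
    -- edge, which is then final and ends the petal.
    by_contra hnot
    have hm := last_mem_word U i
    have hf := not_final_word hmem (i := i) (by omega)
    cases hw : word U i with
    | nil => simp [hw] at hm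
    | cons a y =>
      rw [hw] at hm hnot hf
      simp only [List.tail_cons] at hnot
      have : Fin.last k = a := by simpa [hnot] using hm
      exact hf ⟨y, hnot, by rw [this]⟩
  refine ⟨?_, ?_, ?_, ?_, ?_⟩
  · rw [← List.length_pos_iff, hpl]; omega
  · change ((U ++ labels U).drop (labels U).length).take (n - 1) = U
    rw [hpl, hend, ← hlen, List.take_length]
  · intro j h1 h2
    exact hmid j (hpl ▸ h2) h1
  · intro j h
    change Fin.last k ∈ ((U ++ labels U).drop j).take n
    rw [hedge j (hpl ▸ h)]
    exact last_mem_word U j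
  · intro j h r
    obtain ⟨j', h1, h2⟩ := exists_word_eq_rotate hmem (i := j) (by omega) r
    refine ⟨j', by omega, ?_⟩
    change ((U ++ labels U).drop j').take n = (((U ++ labels U).drop j).take n).rotate r
    rw [hedge j (hpl ▸ h), hedge j' (by omega), h2]

theorem nodup_words {k : ℕ} {u : List (Fin (k + 1))} (hu : Fin.last k ∉ u) : (words u).Nodup := by
  refine List.Nodup.map_on ?_ List.nodup_range
  intro i hi j hj h
  simp only [List.mem_range] at hi hj
  rcases le_total i j with hij | hij
  · exact (word_injOn hu hij (by omega) hu h).2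
  · exact (word_injOn hu hij (by omega) hu h.symm).2.symm

theorem eq_of_mem_words {k : ℕ} {u u' x : List (Fin (k + 1))} (hu : Fin.last k ∉ u)
    (hu' : Fin.last k ∉ u') (h : x ∈ words u) (h' : x ∈ words u') : u = u' := by
  simp only [words, List.mem_map, List.mem_range] at h h'
  obtain ⟨i, hi, rfl⟩ := h
  obtain ⟨j, hj, h⟩ := h'
  rcases le_total i j with hij | hij
  · exact (word_injOn hu' hij (by omega) hu h.symm).1
  · exact (word_injOn hu hij (by omega) hu' h).1.symm

theorem last_mem_of_mem_words {k : ℕ} {u x : List (Fin (k + 1))} (h : x ∈ words u) :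
    Fin.last k ∈ x := by
  simp only [words, List.mem_map] at h
  obtain ⟨i, -, rfl⟩ := h
  exact last_mem_word u i

theorem length_of_mem_words {k : ℕ} {u x : List (Fin (k + 1))} (h : x ∈ words u) :
    x.length = u.length + 1 := by
  simp only [words, List.mem_map] at h
  obtain ⟨i, -, rfl⟩ := h
  exact length_word u i

end Petal

/-! ### The extended sequence -/

namespace Extension

open Petal

/-- The `i`-th edge of the Eulerian cycle, as a word over the enlarged alphabet. -/
def edge (k n : ℕ) (v : ZMod (k ^ n) → Fin k) (i : ℕ) : List (Fin (k + 1)) :=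
  (List.range n).map fun t => (v ((i + t : ℕ) : ZMod (k ^ n))).castSucc

/-- The head of the `i`-th edge of the Eulerian cycle, as a word over the enlarged alphabet. -/
def head (k n : ℕ) (v : ZMod (k ^ n) → Fin k) (i : ℕ) : List (Fin (k + 1)) :=
  List.ofFn fun t => (headVertex k n v i t).castSucc

theorem head_eq (k n : ℕ) (v : ZMod (k ^ n) → Fin k) (i : ℕ) :
    head k n v i = (List.range (n - 1)).map fun t => (v ((i + 1 + t : ℕ) : ZMod (k ^ n))).castSucc := by
  apply List.ext_getElem
  · simp [head]
  · intro t h1 h2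
    simp [head, headVertex]

variable (k n : ℕ) (v : ZMod (k ^ n) → Fin k) (chosen : ℕ → Prop)

theorem last_not_mem_head (i : ℕ) : Fin.last k ∉ head k n v i := by
  simp [head, List.mem_ofFn]

theorem last_not_mem_edge (i : ℕ) : Fin.last k ∉ edge k n v i := by
  simp [edge]

@[simp] theorem length_edge (i : ℕ) : (edge k n v i).length = n := by simp [edge]

@[simp] theorem length_head (i : ℕ) : (head k n v i).length = n - 1 := by simp [head]

theorem edge_mod (i : ℕ) : edge k n v (i % k ^ n) = edge k n v i := by
  simp only [edge, Nat.cast_add, ZMod.natCast_mod]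

theorem edge_tail (hn : 1 ≤ n) (i : ℕ) : (edge k n v i).tail = head k n v i := by
  obtain ⟨m, rfl⟩ := Nat.exists_eq_add_of_le' hn
  rw [head_eq, edge, List.range_succ_eq_map]
  simp only [List.map_cons, List.tail_cons, List.map_map, Nat.add_sub_cancel]
  refine List.map_congr_left fun t _ => ?_
  simp only [Function.comp, Nat.succ_eq_add_one]
  congr 3
  ring

theorem edge_succ (hn : 1 ≤ n) (i : ℕ) : edge k n v (i + 1) =
    head k n v i ++ [(v ((i + 1 + (n - 1) : ℕ) : ZMod (k ^ n))).castSucc] := by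
  obtain ⟨m, rfl⟩ := Nat.exists_eq_add_of_le' hn
  rw [head_eq, edge, List.range_succ]
  simp

theorem label_edge (hn : 1 ≤ n) (i : ℕ) :
    label (edge k n v i) = (v ((i + (n - 1) : ℕ) : ZMod (k ^ n))).castSucc := by
  obtain ⟨m, rfl⟩ := Nat.exists_eq_add_of_le' hn
  rw [edge, List.range_succ, List.map_append]
  simp

open Classical in
/-- The edges of the petal that is inserted after the `i`-th edge. -/
noncomputable def inserted (i : ℕ) : List (List (Fin (k + 1))) :=
  if chosen i then words (head k n v i) else []

/-- The edges of the extended cycle, from the edge number `0` to the edge number `m`. -/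
noncomputable def edges (m : ℕ) : List (List (Fin (k + 1))) :=
  (List.range m).flatMap fun i => edge k n v i :: inserted k n v chosen i

theorem edges_succ (m : ℕ) : edges k n v chosen (m + 1) =
    edges k n v chosen m ++ edge k n v m :: inserted k n v chosen m := by
  simp [edges, List.range_succ]

/-- The edge `x'` may follow the edge `x` in a walk. -/
def Follows {k : ℕ} (x x' : List (Fin (k + 1))) : Prop := x' = x.tail ++ [label x']

/-- The last edge `s u` of the petal ends at the same vertex `u` as the edge number `i`, so the edge
number `i + 1` may follow either of them. -/
theorem isChain_block (hn : 1 ≤ n) (i : ℕ) :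
    (edge k n v i :: inserted k n v chosen i ++ [edge k n v (i + 1)]).IsChain Follows := by
  have h1 : Follows (Fin.last k :: head k n v i) (edge k n v (i + 1)) := by
    simp [Follows, edge_succ k n v hn]
  by_cases hc : chosen i
  · have hne : words (head k n v i) ≠ [] := by simp [words]
    simp only [inserted, hc, if_true, List.cons_append]
    refine List.isChain_cons.2 ⟨?_, ?_⟩
    · intro y hy
      simp only [words, List.range_succ_eq_map, List.map_cons, List.cons_append, List.head?_cons,
        Option.mem_def, Option.some.injEq] at hy
      subst hy
      simp [Follows, edge_tail k n v hn]
    · refine List.IsChain.append ?_ (List.isChain_singleton _) ?_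
      · rw [words, List.isChain_map, List.isChain_range_succ]
        intro i _
        exact word_succ_eq _ _
      · intro x hx y hy
        simp only [words, List.range_succ, List.map_append, List.map_singleton,
          List.getLast?_append_of_ne_nil _ (List.cons_ne_nil _ _), List.getLast?_singleton,
          Option.mem_def, Option.some.injEq, List.head?_cons] at hx hy
        subst hx hy
        rw [word_len (last_not_mem_head k n v i)]
        exact h1
  · simp only [inserted, hc, if_false, List.cons_append, List.nil_append]
    refine List.isChain_cons_cons.2 ⟨?_, List.isChain_singleton _⟩
    simp [Follows, edge_succ k n v hn, edge_tail k n v hn]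

theorem isChain_edges (hn : 1 ≤ n) (m : ℕ) :
    (edges k n v chosen m ++ [edge k n v m]).IsChain Follows := by
  induction m with
  | zero => simp [edges]
  | succ m ih =>
    have := ih.append_overlap (l₃ := inserted k n v chosen m ++ [edge k n v (m + 1)])
      (isChain_block k n v chosen hn m) (by simp)
    rw [edges_succ]
    simpa using this

/-- Used to read off the successor in the closed cycle: the entry appended at the end is the edge
number `k ^ n`, which is the edge number `0` again. -/
theorem exists_edges_append (i : ℕ) : ∀ m, i < m → ∃ l,
    edges k n v chosen m ++ [edge k n v m] =
      edges k n v chosen (i + 1) ++ edge k n v (i + 1) :: l := by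
  intro m hm
  induction m, hm using Nat.le_induction with
  | base => exact ⟨[], rfl⟩
  | succ m hm ih =>
    obtain ⟨l, hl⟩ := ih
    refine ⟨l ++ (inserted k n v chosen m ++ [edge k n v (m + 1)]), ?_⟩
    rw [edges_succ]
    have := congrArg (· ++ (inserted k n v chosen m ++ [edge k n v (m + 1)])) hl
    simpa using this

/-- Every vertex is chosen exactly once. -/
structure Selects : Prop where
  exists_chosen : ∀ u : Fin (n - 1) → Fin k, ∃ i < k ^ n, chosen i ∧ headVertex k n v i = u
  unique : ∀ i < k ^ n, ∀ j < k ^ n, chosen i → chosen j →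
    headVertex k n v i = headVertex k n v j → i = j

variable {k n v chosen}

theorem head_injective {i j : ℕ} (h : head k n v i = head k n v j) :
    headVertex k n v i = headVertex k n v j := by
  have := List.ofFn_injective h
  funext t
  exact Fin.castSucc_injective _ (congrFun this t)

theorem exists_castSucc {m : ℕ} {x : List (Fin (k + 1))} (h : Fin.last k ∉ x)
    (hl : x.length = m) : ∃ u : Fin m → Fin k, x = List.ofFn fun t => (u t).castSucc := by
  subst hl
  have h' : ∀ t : Fin x.length, ∃ a : Fin k, a.castSucc = x[t] := fun t =>
    Fin.exists_castSucc_eq.2 fun h' => h (h' ▸ List.getElem_mem t.2)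
  choose u hu using h'
  refine ⟨u, List.ext_getElem (by simp) fun t h1 h2 => ?_⟩
  simp [hu]

theorem eq_of_edge_eq (hv : IsDeBruijn k n v) {i j : ℕ} (hi : i < k ^ n) (hj : j < k ^ n)
    (h : edge k n v i = edge k n v j) : i = j := by
  obtain ⟨z, -, hz⟩ := hv fun t => v ((i : ZMod (k ^ n)) + ((t : ℕ) : ZMod (k ^ n)))
  have h1 := hz i fun t => rfl
  have h2 := hz j fun t => by
    have := List.map_inj_left.1 h t (by simp)
    simpa using (Fin.castSucc_injective _ this).symm
  have h3 : (i : ZMod (k ^ n)) = j := h1.trans h2.symm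
  rw [ZMod.natCast_eq_natCast_iff'] at h3
  rwa [Nat.mod_eq_of_lt hi, Nat.mod_eq_of_lt hj] at h3

theorem exists_edge_eq (hk : 1 ≤ k) (hv : IsDeBruijn k n v) {x : List (Fin (k + 1))}
    (hl : x.length = n) (h : Fin.last k ∉ x) : ∃ i < k ^ n, edge k n v i = x := by
  obtain ⟨u, hu⟩ := exists_castSucc h hl
  obtain ⟨z, hz, -⟩ := hv u
  have : NeZero (k ^ n) := ⟨(pow_pos hk _).ne'⟩
  refine ⟨z.val, ZMod.val_lt z, ?_⟩
  rw [hu]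
  refine List.ext_getElem (by simp) fun t h1 h2 => ?_
  simp only [length_edge] at h1
  have := hz ⟨t, h1⟩
  simp [edge, this]

/-- Words without the new symbol are edges of `v`; a word with it lies in the petal of some `u`, and
`u` is chosen somewhere. -/
theorem mem_edges (hk : 1 ≤ k) (hn : 1 ≤ n) (hv : IsDeBruijn k n v) (hc : Selects k n v chosen)
    (x : List (Fin (k + 1))) : x ∈ edges k n v chosen (k ^ n) ↔ x.length = n := by
  constructor
  · intro h
    simp only [edges, List.mem_flatMap, List.mem_range, List.mem_cons] at h
    obtain ⟨i, hi, rfl | h⟩ := h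
    · simp
    · simp only [inserted] at h
      split_ifs at h
      · rw [length_of_mem_words h, length_head, Nat.sub_add_cancel hn]
      · simp at h
  · intro hl
    simp only [edges, List.mem_flatMap, List.mem_range, List.mem_cons]
    by_cases hx : Fin.last k ∈ x
    · obtain ⟨u, hu, hul, j, hj, hjx⟩ := exists_word_eq hk (n := n - 1) _ x le_rfl (by omega) hx
      obtain ⟨u', hu'⟩ := exists_castSucc hu hul
      obtain ⟨i, hi, hi1, hi2⟩ := hc.exists_chosen u'
      refine ⟨i, hi, .inr ?_⟩
      have : head k n v i = u := by rw [hu', head, hi2]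
      simp only [inserted, hi1, if_true, this, words, List.mem_map, List.mem_range]
      exact ⟨j, by omega, hjx⟩
    · obtain ⟨i, hi, h⟩ := exists_edge_eq hk hv hl hx
      exact ⟨i, hi, .inl h.symm⟩

/-- Within a petal edges are distinct, different petals are disjoint, and no vertex is chosen twice.
-/
theorem nodup_edges (hv : IsDeBruijn k n v) (hc : Selects k n v chosen) :
    (edges k n v chosen (k ^ n)).Nodup := by
  have hins : ∀ i x, x ∈ inserted k n v chosen i → chosen i ∧ x ∈ words (head k n v i) := by
    intro i x hx
    simp only [inserted] at hx
    split_ifs at hx with h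
    · exact ⟨h, hx⟩
    · simp at hx
  rw [edges, List.nodup_flatMap]
  constructor
  · intro i _
    rw [List.nodup_cons]
    constructor
    · intro h
      exact last_not_mem_edge k n v i (last_mem_of_mem_words (hins _ _ h).2)
    · simp only [inserted]
      split_ifs
      · exact nodup_words (last_not_mem_head k n v i)
      · simp
  · refine List.Pairwise.imp_of_mem ?_ List.nodup_range
    intro i j hi hj hij
    simp only [List.mem_range] at hi hj
    refine List.disjoint_left.2 fun x hx hx' => hij ?_
    rw [List.mem_cons] at hx hx'
    rcases hx with rfl | hx <;> rcases hx' with hx' | hx'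
    · exact eq_of_edge_eq hv hi hj hx'
    · exact absurd (last_mem_of_mem_words (hins _ _ hx').2) (last_not_mem_edge k n v i)
    · exact absurd (hx' ▸ last_mem_of_mem_words (hins _ _ hx).2) (last_not_mem_edge k n v j)
    · obtain ⟨h1, h2⟩ := hins _ _ hx
      obtain ⟨h3, h4⟩ := hins _ _ hx'
      exact hc.unique i hi j hj h1 h3 (head_injective (eq_of_mem_words
        (last_not_mem_head k n v i) (last_not_mem_head k n v j) h2 h4))

theorem length_edges (hk : 1 ≤ k) (hn : 1 ≤ n) (hv : IsDeBruijn k n v)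
    (hc : Selects k n v chosen) : (edges k n v chosen (k ^ n)).length = (k + 1) ^ n := by
  classical
  rw [← List.toFinset_card_of_nodup (nodup_edges hv hc)]
  have : (edges k n v chosen (k ^ n)).toFinset =
      Finset.univ.image (List.ofFn : (Fin n → Fin (k + 1)) → List (Fin (k + 1))) := by
    ext x
    rw [List.mem_toFinset, mem_edges hk hn hv hc]
    simp only [Finset.mem_image, Finset.mem_univ, true_and]
    constructor
    · rintro rfl
      exact ⟨x.get, List.ofFn_get x⟩
    · rintro ⟨u, rfl⟩
      simp
  rw [this, Finset.card_image_of_injective _ List.ofFn_injective]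
  simp

end Extension

/-! ### The circular sequence spelled by the extended cycle. -/

namespace Extension

open Petal

theorem readFrom_eq {α : Type} {N : ℕ} (w : ZMod N → α) (b : ZMod N) :
    readFrom w b = (List.range N).map fun i : ℕ => w (b + (i : ZMod N)) := by
  simp [readFrom, List.map_eq_flatMap, List.flatMap_assoc]

/-- The entry of the list at the position `z`, read cyclically. -/
def cyc {k : ℕ} (l : List (List (Fin (k + 1)))) {N : ℕ} (z : ZMod N) : List (Fin (k + 1)) :=
  l.getD z.val []

section Cyclic

variable {k N : ℕ} {l : List (List (Fin (k + 1)))} (hl : l.length = N)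

theorem cyc_natCast {i : ℕ} (hi : i < N) : cyc l (i : ZMod N) = l.getD i [] := by
  rw [cyc, ZMod.val_natCast, Nat.mod_eq_of_lt hi]

include hl

/-- Repeating the first entry at the end turns cyclic adjacency into adjacency in a list; the
repeated entry has index `N`, which is `0` in `ZMod N`. -/
theorem cyc_natCast_of_append {a x : List (Fin (k + 1))} {l₁ l₂ : List (List (Fin (k + 1)))}
    (h0 : a = l.getD 0 []) (hN : 0 < N) (h : l ++ [a] = l₁ ++ x :: l₂) :
    cyc l (l₁.length : ZMod N) = x := by
  have hlen := congrArg List.length h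
  simp only [List.length_append, List.length_cons, List.length_nil] at hlen
  by_cases hlt : l₁.length < N
  · rw [cyc_natCast hlt]
    have : (l ++ [a]).getD l₁.length [] = x := by rw [h]; simp
    rw [← this, List.getD_append _ _ _ _ (by omega)]
  · have h2 : l₂ = [] := List.length_eq_zero_iff.1 (by omega)
    subst h2
    have h1 : l₁.length = N := by simp at hlen; omega
    have h3 := (List.append_inj' h rfl).2
    simp only [List.cons.injEq, and_true] at h3
    rw [h1, ZMod.natCast_self, ← h3, h0, ← cyc_natCast (N := N) hN]
    simp

theorem cyc_add_one (hN : 0 < N) (hc : (l ++ [l.getD 0 []]).IsChain Follows) (z : ZMod N) :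
    cyc l (z + 1) = (cyc l z).tail ++ [label (cyc l (z + 1))] := by
  have : NeZero N := ⟨hN.ne'⟩
  obtain ⟨i, hi, rfl⟩ : ∃ i < N, (i : ZMod N) = z := ⟨z.val, ZMod.val_lt z, by simp⟩
  have hlen : (l ++ [l.getD 0 []]).length = N + 1 := by simp [hl]
  have hget : ∀ j (hj : j < N + 1), cyc l (j : ZMod N) = (l ++ [l.getD 0 []])[j]'(by omega) := by
    intro j hj
    have := cyc_natCast_of_append hl rfl hN
      (l₁ := (l ++ [l.getD 0 []]).take j) (x := (l ++ [l.getD 0 []])[j]'(by omega))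
      (l₂ := (l ++ [l.getD 0 []]).drop (j + 1)) (by simp)
    rwa [List.length_take_of_le (by omega)] at this
  have := List.isChain_iff_getElem.1 hc i (by omega)
  rw [Follows, ← hget i (by omega), ← hget (i + 1) (by omega), Nat.cast_succ] at this
  exact this

/-- Each step of the walk shifts the word and appends a label, so after `n` steps an edge consists
of labels only. This holds around the whole circle, because the walk is closed. -/
theorem cyc_add (hN : 0 < N) (hc : (l ++ [l.getD 0 []]).IsChain Follows) {n : ℕ} (hn : 1 ≤ n)
    (hlen : ∀ x ∈ l, x.length = n) (z : ZMod N) :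
    cyc l (z + ((n - 1 : ℕ) : ZMod N)) =
      (List.range n).map fun t : ℕ => label (cyc l (z + (t : ZMod N))) := by
  have : NeZero N := ⟨hN.ne'⟩
  have hlen' : ∀ z : ZMod N, (cyc l z).length = n := by
    intro z
    have := ZMod.val_lt z
    rw [cyc, List.getD_eq_getElem _ _ (by omega)]
    exact hlen _ (List.getElem_mem _)
  -- The last `j + 1` symbols of the edge at `z + j` are the labels at `z, …, z + j`.
  have key : ∀ j ≤ n - 1, (cyc l (z + (j : ZMod N))).drop (n - 1 - j) =
      (List.range (j + 1)).map fun t : ℕ => label (cyc l (z + (t : ZMod N))) := by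
    intro j
    induction j with
    | zero =>
      intro _
      have h1 := cyc_add_one hl hN hc (z - 1)
      rw [sub_add_cancel] at h1
      have h2 : (cyc l (z - 1)).tail.length = n - 1 := by rw [List.length_tail, hlen']
      simp only [Nat.cast_zero, add_zero, Nat.sub_zero, zero_add, List.range_one, List.map_cons,
        List.map_nil]
      conv_lhs => rw [h1]
      rw [List.drop_left' h2]
    | succ j ih =>
      intro hj
      have h1 := cyc_add_one hl hN hc (z + (j : ZMod N))
      have h2 : (cyc l (z + (j : ZMod N))).tail.length = n - 1 := by rw [List.length_tail, hlen']
      rw [List.range_succ, List.map_append, ← ih (by omega), Nat.cast_succ, ← add_assoc]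
      conv_lhs => rw [h1]
      rw [List.drop_append_of_le_length (by omega), ← List.drop_one, List.drop_drop]
      have h3 : 1 + (n - 1 - (j + 1)) = n - 1 - j := by omega
      rw [h3]
      simp [add_assoc]
  have := key (n - 1) le_rfl
  rwa [Nat.sub_self, List.drop_zero, Nat.sub_add_cancel hn] at this

end Cyclic

variable (k n : ℕ) (v : ZMod (k ^ n) → Fin k) (chosen : ℕ → Prop)

/-- The symbols of the extended sequence. -/
noncomputable def symbols : List (Fin (k + 1)) := (edges k n v chosen (k ^ n)).map label

/-- The extended sequence. -/
noncomputable def sequence (z : ZMod ((k + 1) ^ n)) : Fin (k + 1) :=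
  label (cyc (edges k n v chosen (k ^ n)) z)

variable {k n v chosen}

section

variable (hk : 1 ≤ k) (hn : 1 ≤ n) (hv : IsDeBruijn k n v) (hc : Selects k n v chosen)
include hk

theorem edges_getD_zero :
    (edges k n v chosen (k ^ n)).getD 0 [] = edge k n v (k ^ n) := by
  have h0 : edge k n v 0 = edge k n v (k ^ n) := by
    rw [← edge_mod k n v (k ^ n), Nat.mod_self]
  have : k ^ n = (k ^ n - 1) + 1 := (Nat.sub_add_cancel (Nat.pow_pos hk)).symm
  rw [← h0, edges]
  conv_lhs => rw [this]
  rw [List.range_succ_eq_map]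
  simp

include hn

theorem isChain_cycle : (edges k n v chosen (k ^ n) ++
    [(edges k n v chosen (k ^ n)).getD 0 []]).IsChain Follows := by
  rw [edges_getD_zero hk]
  exact isChain_edges k n v chosen hn _

include hv hc

theorem cyc_edges_add (z : ZMod ((k + 1) ^ n)) :
    cyc (edges k n v chosen (k ^ n)) (z + ((n - 1 : ℕ) : ZMod ((k + 1) ^ n))) =
      (List.range n).map fun t : ℕ => sequence k n v chosen (z + (t : ZMod ((k + 1) ^ n))) :=
  cyc_add (length_edges hk hn hv hc) (by positivity) (isChain_cycle hk hn) hn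
    (fun x hx => (mem_edges hk hn hv hc x).1 hx) z

theorem isDeBruijn_sequence : IsDeBruijn (k + 1) n (sequence k n v chosen) := by
  intro u
  have : NeZero ((k + 1) ^ n) := ⟨by positivity⟩
  have hlen := length_edges hk hn hv hc
  have hiff : ∀ z : ZMod ((k + 1) ^ n),
      (∀ t : Fin n, sequence k n v chosen (z + ((t : ℕ) : ZMod ((k + 1) ^ n))) = u t) ↔
      cyc (edges k n v chosen (k ^ n)) (z + ((n - 1 : ℕ) : ZMod ((k + 1) ^ n))) =
        List.ofFn u := by
    intro z
    rw [cyc_edges_add hk hn hv hc]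
    constructor
    · intro h
      refine List.ext_getElem (by simp) fun t h1 h2 => ?_
      simp only [List.length_map, List.length_range] at h1
      simpa using h ⟨t, h1⟩
    · intro h t
      have := List.getElem_of_eq h (i := t) (by simp)
      simpa using this
  obtain ⟨i, hi, hiu⟩ := List.getElem_of_mem
    ((mem_edges hk hn hv hc (List.ofFn u)).2 (by simp))
  -- The edge at a position ends there, so the corresponding word starts `n - 1` places earlier.
  refine ⟨(i : ZMod ((k + 1) ^ n)) - ((n - 1 : ℕ) : ZMod ((k + 1) ^ n)), ?_, ?_⟩
  · change ∀ t : Fin n, _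
    rw [hiff, sub_add_cancel, cyc_natCast (by omega), List.getD_eq_getElem _ _ hi, hiu]
  · intro z hz
    have hz' := (hiff z).1 hz
    rw [eq_sub_iff_add_eq]
    generalize z + ((n - 1 : ℕ) : ZMod ((k + 1) ^ n)) = y at hz'
    have hy := ZMod.val_lt y
    rw [cyc, List.getD_eq_getElem _ _ (by omega), ← hiu,
      (nodup_edges hv hc).getElem_inj_iff] at hz'
    rw [← hz']
    simp

theorem readFrom_sequence : readFrom (sequence k n v chosen) 0 = symbols k n v chosen := by
  have hlen := length_edges hk hn hv hc
  refine List.ext_getElem (by simp [readFrom_eq, symbols, hlen]) fun i h1 h2 => ?_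
  simp only [readFrom_eq, List.length_map, List.length_range] at h1
  have h3 : i < (edges k n v chosen (k ^ n)).length := by omega
  simp [readFrom_eq, symbols, sequence, cyc_natCast h1, List.getElem?_eq_getElem h3]

omit hk hn hv hc in
theorem sequence_natCast {i : ℕ} (hi : i < (k + 1) ^ n) :
    sequence k n v chosen (i : ZMod ((k + 1) ^ n)) = (symbols k n v chosen).getD i 0 := by
  rw [sequence, cyc_natCast hi, symbols]
  exact (List.getD_map ..).symm

omit hk hv hc in
theorem symbols_eq : symbols k n v chosen = (List.range (k ^ n)).flatMap fun i =>
    (v ((i + (n - 1) : ℕ) : ZMod (k ^ n))).castSucc :: (inserted k n v chosen i).map label := by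
  simp only [symbols, edges, List.map_flatMap, List.map_cons, label_edge k n v hn]

theorem isCircularSubseq_sequence : IsCircularSubseq v (sequence k n v chosen) := by
  -- The edge number `i` of `v` carries the label `v (i + n - 1)`.
  refine ⟨((n - 1 : ℕ) : ZMod (k ^ n)), 0, ?_⟩
  rw [readFrom_sequence hk hn hv hc, symbols_eq hn, readFrom_eq, List.map_map]
  induction (List.range (k ^ n)) with
  | nil => simp
  | cons i l ih =>
    simp only [List.map_cons, List.flatMap_cons, List.cons_append, Function.comp]
    rw [add_comm ((n - 1 : ℕ) : ZMod (k ^ n)), ← Nat.cast_add]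
    exact (ih.trans (List.sublist_append_right _ _)).cons_cons _

/-- A window of `n + 2 * k - 1` symbols consists of `2 * k` consecutive edges. If it is free of the
new symbol, these edges are consecutive in `v` and no petal follows any of the first `2 * k - 1`. -/
theorem newSymbolWithin_sequence
    (hsect : ∀ j < k ^ (n - 1), ∃ r < k, chosen (j * k + r)) :
    NewSymbolWithin (sequence k n v chosen) (n + 2 * k - 1) := by
  intro z
  by_contra! hcon
  have : NeZero ((k + 1) ^ n) := ⟨by positivity⟩
  have hlen := length_edges hk hn hv hc
  have hpow : k ^ (n - 1) * k = k ^ n := by rw [← pow_succ, Nat.sub_add_cancel hn]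
  set G : ZMod ((k + 1) ^ n) → List (Fin (k + 1)) := cyc (edges k n v chosen (k ^ n)) with hG
  set y := z + ((n - 1 : ℕ) : ZMod ((k + 1) ^ n)) with hy
  -- no edge of the window contains the new symbol
  have hfree : ∀ j < 2 * k, Fin.last k ∉ G (y + (j : ZMod ((k + 1) ^ n))) := by
    intro j hj
    rw [hy, add_right_comm, hG, cyc_edges_add hk hn hv hc]
    simp only [List.mem_map, List.mem_range, not_exists, not_and]
    intro t ht
    rw [add_assoc, ← Nat.cast_add]
    exact hcon _ (by omega)
  have hGinj : ∀ a b, G a = G b → a = b := by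
    intro a b hab
    have ha := ZMod.val_lt a
    have hb := ZMod.val_lt b
    simp only [hG, cyc] at hab
    rw [List.getD_eq_getElem _ _ (by omega), List.getD_eq_getElem _ _ (by omega),
      (nodup_edges hv hc).getElem_inj_iff] at hab
    exact ZMod.val_injective _ hab
  have hGlen : ∀ a, (G a).length = n := by
    intro a
    have ha := ZMod.val_lt a
    simp only [hG, cyc]
    rw [List.getD_eq_getElem _ _ (by omega)]
    exact (mem_edges hk hn hv hc _).1 (List.getElem_mem _)
  -- the edge that follows an edge without the new symbol
  have hnext : ∀ i < k ^ n, ∀ a, G a = edge k n v i →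
      (chosen i → Fin.last k ∈ G (a + 1)) ∧ (¬ chosen i → G (a + 1) = edge k n v (i + 1)) := by
    intro i hi a ha
    obtain ⟨l, hl⟩ := exists_edges_append k n v chosen i _ hi
    rw [edges_succ] at hl
    have happ := fun l₁ x l₂ => cyc_natCast_of_append (l₁ := l₁) (x := x) (l₂ := l₂) hlen
      (edges_getD_zero (v := v) (chosen := chosen) hk).symm (by positivity)
    have h1 := happ (edges k n v chosen i) (edge k n v i) _ (by
      rw [hl, List.append_assoc, List.cons_append])
    have h2 : a = ((edges k n v chosen i).length : ZMod ((k + 1) ^ n)) :=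
      hGinj _ _ (ha.trans h1.symm)
    constructor
    · intro hci
      have h3 := happ (edges k n v chosen i ++ [edge k n v i]) (head k n v i ++ [Fin.last k])
        ((words (head k n v i)).tail ++ edge k n v (i + 1) :: l) (by
          rw [hl]
          simp [inserted, hci, words, List.range_succ_eq_map])
      rw [h2, hG, ← Nat.cast_succ]
      simp only [List.length_append, List.length_singleton] at h3
      rw [h3]
      simp
    · intro hci
      have h3 := happ (edges k n v chosen i ++ [edge k n v i]) (edge k n v (i + 1)) l (by
          rw [hl]
          simp [inserted, hci])
      rw [h2, hG, ← Nat.cast_succ]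
      simpa only [List.length_append, List.length_singleton] using h3
  obtain ⟨i, hi, hi'⟩ := exists_edge_eq hk hv (hGlen y) (by simpa using hfree 0 (by omega))
  have hwalk : ∀ j < 2 * k, G (y + (j : ZMod ((k + 1) ^ n))) = edge k n v (i + j) := by
    intro j
    induction j with
    | zero => intro _; simpa using hi'.symm
    | succ j ih =>
      intro hj
      have h1 := ih (by omega)
      rw [← edge_mod] at h1
      have h2 := hnext _ (Nat.mod_lt _ (pow_pos hk n)) _ h1
      rw [Nat.cast_succ, ← add_assoc, h2.2, ← edge_mod, Nat.mod_add_mod, edge_mod]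
      · rfl
      · intro hci
        refine hfree (j + 1) hj ?_
        rw [Nat.cast_succ, ← add_assoc]
        exact h2.1 hci
  have hnot : ∀ j, j + 1 < 2 * k → ¬ chosen ((i + j) % k ^ n) := by
    intro j hj hci
    have h1 := hwalk j (by omega)
    rw [← edge_mod] at h1
    have h2 := (hnext _ (Nat.mod_lt _ (pow_pos hk n)) _ h1).1 hci
    refine hfree (j + 1) hj ?_
    rwa [Nat.cast_succ, ← add_assoc]
  -- The next section starts at most `k - 1` edges ahead, so its `k` edges have offsets at most `2 *
  -- k - 2`, and the petal after its chosen edge would begin inside the window.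
  obtain ⟨j₀, hj₀, q, hq⟩ : ∃ j₀ < k, ∃ q, i + j₀ = q * k := by
    refine ⟨(k - i % k) % k, Nat.mod_lt _ hk, ?_⟩
    have h1 := Nat.div_add_mod i k
    have h2 := Nat.mod_lt i hk
    by_cases h0 : i % k = 0
    · refine ⟨i / k, ?_⟩
      rw [h0, Nat.sub_zero, Nat.mod_self, mul_comm]
      omega
    · refine ⟨i / k + 1, ?_⟩
      rw [Nat.mod_eq_of_lt (by omega : k - i % k < k), add_mul, mul_comm (i / k)]
      omega
  have hqlt : q % k ^ (n - 1) < k ^ (n - 1) := Nat.mod_lt _ (pow_pos hk _)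
  obtain ⟨r, hr, hcr⟩ := hsect (q % k ^ (n - 1)) hqlt
  refine hnot (j₀ + r) (by omega) ?_
  have : (i + (j₀ + r)) % k ^ n = q % k ^ (n - 1) * k + r := by
    rw [← add_assoc, hq, ← hpow, Nat.add_mod, Nat.mul_mod_mul_right,
      Nat.mod_eq_of_lt (show r < k ^ (n - 1) * k from
        hr.trans_le (Nat.le_mul_of_pos_left _ (pow_pos hk _)))]
    refine Nat.mod_eq_of_lt ?_
    calc q % k ^ (n - 1) * k + r < q % k ^ (n - 1) * k + k := by omega
      _ = (q % k ^ (n - 1) + 1) * k := by ring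
      _ ≤ k ^ (n - 1) * k := Nat.mul_le_mul_right _ hqlt
  rwa [this]

end

end Extension

/-! ### Augmentation along the paths of a breadth-first search -/

namespace FlowNetwork

variable {V E : Type} (N : FlowNetwork V E)

open Classical in
/-- The flow that results from `f` by pushing one unit along `p`. -/
noncomputable def push (f : E → ℕ) (p : List (E × Bool)) : E → ℕ := fun e =>
  if (e, true) ∈ p then f e + 1 else if (e, false) ∈ p then f e - 1 else f e

@[simp] theorem push_nil (f : E → ℕ) : push f [] = f := by
  funext e; simp [push]

theorem push_of_not_mem {f : E → ℕ} {p : List (E × Bool)} {e : E} (h : e ∉ p.map Prod.fst) :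
    push f p e = f e := by
  have : ∀ b, (e, b) ∉ p := fun b hb => h (List.mem_map.2 ⟨_, hb, rfl⟩)
  simp [push, this]

open Classical in
theorem push_cons {f : E → ℕ} {p : List (E × Bool)} {a : E × Bool} (h : a.1 ∉ p.map Prod.fst) :
    push f (a :: p) = Function.update (push f p) a.1 (if a.2 then f a.1 + 1 else f a.1 - 1) := by
  obtain ⟨e, b⟩ := a
  funext e'
  have hn : ∀ b, (e, b) ∉ p := fun b hb => h (List.mem_map.2 ⟨_, hb, rfl⟩)
  by_cases he : e' = e
  · subst he
    cases b <;> simp [push, hn]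
  · simp [push, he]

theorem push_le_one {f : E → ℕ} (hcap : ∀ e, N.cap e = 1) {p : List (E × Bool)}
    (hf : ∀ e, f e ≤ 1) (hp : ∀ a ∈ p, 0 < N.residual f a) (e : E) : push f p e ≤ 1 := by
  unfold push
  have := hf e
  split_ifs with h1 h2
  · have := hp _ h1
    simp only [residual, if_true, hcap] at this
    omega
  · omega
  · omega

/-- Residual capacities on the path are `1`, hence so is the bottleneck. The empty path is excluded
because the infimum of the empty set is `0`. -/
theorem augment_eq_push {f : E → ℕ} (hcap : ∀ e, N.cap e = 1) (hf : ∀ e, f e ≤ 1)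
    {p : List (E × Bool)} (hp : ∀ a ∈ p, 0 < N.residual f a) (hne : p ≠ []) :
    N.augment f p = push f p := by
  have hres : ∀ a ∈ p, N.residual f a = 1 := by
    intro a ha
    have h1 := hp a ha
    have h2 := hf a.1
    unfold residual at h1 ⊢
    rw [hcap] at *
    split_ifs at h1 ⊢ <;> omega
  have hb : N.bottleneck f p = 1 := by
    obtain ⟨a, ha⟩ := List.exists_mem_of_ne_nil p hne
    have : {c | ∃ a ∈ p, c = N.residual f a} = {1} := by
      ext c
      constructor
      · rintro ⟨a, ha, rfl⟩
        exact hres a ha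
      · rintro rfl
        exact ⟨a, ha, (hres a ha).symm⟩
    rw [bottleneck, this, csInf_singleton]
  funext e
  simp only [augment, push, hb]

open Classical in
/-- The flow into a vertex minus the flow out of it. -/
noncomputable def excess [Fintype E] (f : E → ℕ) (x : V) : ℤ :=
  ∑ e, (f e : ℤ) * ((if N.head e = x then 1 else 0) - (if N.tail e = x then 1 else 0))

open Classical in
theorem excess_update [Fintype E] (f : E → ℕ) (e : E) (c : ℕ) (x : V) :
    N.excess (Function.update f e c) x = N.excess f x +
      ((c : ℤ) - f e) * ((if N.head e = x then 1 else 0) - (if N.tail e = x then 1 else 0)) := by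
  rw [← sub_eq_iff_eq_add', excess, excess, ← Finset.sum_sub_distrib,
    Finset.sum_eq_single e]
  · simp [sub_mul]
  · intro e' _ he'
    simp [Function.update_of_ne he']
  · simp

open Classical in
-- The contributions telescope along the walk. The edges have to be distinct, because `push` changes
-- an edge once, however often the walk uses it.
theorem excess_push [Fintype E] {f : E → ℕ} {p : List (E × Bool)} {x y : V}
    (hw : N.IsWalk x p y) (hnd : (p.map Prod.fst).Nodup) (hp : ∀ a ∈ p, 0 < N.residual f a)
    (z : V) : N.excess (push f p) z =
      N.excess f z + ((if y = z then 1 else 0) - (if x = z then 1 else 0)) := by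
  induction p generalizing x with
  | nil =>
    obtain rfl : x = y := hw
    simp
  | cons a p ih =>
    obtain ⟨rfl, hw⟩ := hw
    rw [List.map_cons, List.nodup_cons] at hnd
    have ih' := ih hw hnd.2 fun b hb => hp b (List.mem_cons_of_mem _ hb)
    rw [push_cons hnd.1, excess_update, ih', push_of_not_mem hnd.1]
    have ha := hp a List.mem_cons_self
    obtain ⟨e, b⟩ := a
    cases b
    · simp only [residual, Bool.false_eq_true, if_false] at ha
      simp only [arcHead, arcTail, Bool.false_eq_true, if_false, Nat.cast_sub ha]
      push_cast
      ring
    · simp only [arcHead, arcTail, if_true]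
      push_cast
      ring

/-- The numbers `lev` and the arcs `par` are the result of a breadth-first search from the source in
the residual network: `lev x` is the distance of `x` plus `1`, or `0` if `x` was not found, and
`par x` is the arc by which `x` was found. -/
structure IsLevels (f : E → ℕ) (lev : V → ℕ) (par : V → E × Bool) : Prop where
  source : lev N.source = 1
  par : ∀ x, x ≠ N.source → lev x ≠ 0 → N.arcHead (par x) = x ∧ lev (N.arcTail (par x)) ≠ 0 ∧
    lev (N.arcTail (par x)) + 1 = lev x ∧ 0 < N.residual f (par x)
  relax : ∀ a, 0 < N.residual f a → lev (N.arcTail a) ≠ 0 →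
    lev (N.arcHead a) ≠ 0 ∧ lev (N.arcHead a) ≤ lev (N.arcTail a) + 1

/-- The last `d` arcs of the path to `x`. -/
def backPath (par : V → E × Bool) : ℕ → V → List (E × Bool)
  | 0, _ => []
  | d + 1, x => backPath par d (N.arcTail (par x)) ++ [par x]

theorem IsWalk.append {x y z : V} {p q : List (E × Bool)} (hp : N.IsWalk x p y)
    (hq : N.IsWalk y q z) : N.IsWalk x (p ++ q) z := by
  induction p generalizing x with
  | nil =>
    obtain rfl : x = y := hp
    exact hq
  | cons a p ih => exact ⟨hp.1, ih hp.2⟩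

namespace IsLevels

variable {N} {f : E → ℕ} {lev : V → ℕ} {par : V → E × Bool} (h : N.IsLevels f lev par)
include h

/-- An arc raises the level by at most one, so no walk reaches a vertex faster than its level says.
Minimality of the path found, and the absence of paths to vertices not found, both follow. -/
theorem le_of_walk {x y : V} {q : List (E × Bool)} (hw : N.IsWalk x q y)
    (hq : ∀ a ∈ q, 0 < N.residual f a) (hx : lev x ≠ 0) : lev y ≠ 0 ∧ lev y ≤ lev x + q.length := by
  induction q generalizing x with
  | nil =>
    obtain rfl : x = y := hw
    exact ⟨hx, by simp⟩
  | cons a q ih =>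
    obtain ⟨rfl, hw⟩ := hw
    obtain ⟨h1, h2⟩ := h.relax a (hq a List.mem_cons_self) hx
    obtain ⟨h3, h4⟩ := ih hw (fun b hb => hq b (List.mem_cons_of_mem _ hb)) h1
    refine ⟨h3, ?_⟩
    rw [List.length_cons]
    omega

theorem ne_source {x : V} {d : ℕ} (hx : lev x = d + 2) : x ≠ N.source := by
  rintro rfl
  rw [h.source] at hx
  omega

theorem backPath_spec : ∀ (d : ℕ) (x : V), lev x = d + 1 →
    N.IsWalk N.source (N.backPath par d x) x ∧ (N.backPath par d x).length = d ∧
    ∀ a ∈ N.backPath par d x, 0 < N.residual f a ∧ lev (N.arcTail a) + 1 = lev (N.arcHead a) ∧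
      lev (N.arcHead a) ≤ d + 1 := by
  intro d
  induction d with
  | zero =>
    intro x hx
    have : x = N.source := by
      by_contra hne
      obtain ⟨-, h2, h3, -⟩ := h.par x hne (by omega)
      omega
    subst this
    exact ⟨rfl, rfl, by simp [backPath]⟩
  | succ d ih =>
    intro x hx
    obtain ⟨h1, h2, h3, h4⟩ := h.par x (h.ne_source hx) (by omega)
    obtain ⟨i1, i2, i3⟩ := ih (N.arcTail (par x)) (by omega)
    refine ⟨IsWalk.append N i1 ⟨rfl, h1⟩, by simp [backPath, i2], ?_⟩
    intro a ha
    rw [backPath, List.mem_append, List.mem_singleton] at ha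
    rcases ha with ha | rfl
    · obtain ⟨j1, j2, j3⟩ := i3 a ha
      exact ⟨j1, j2, by omega⟩
    · exact ⟨h4, by rw [h1, h3], by rw [h1, hx]⟩

/-- Levels rise by one along each arc of the path, so an edge cannot recur, neither in the same nor
in the opposite direction. -/
theorem par_fst_not_mem {d : ℕ} {x : V} (hx : lev x = d + 2) :
    (par x).1 ∉ (N.backPath par d (N.arcTail (par x))).map Prod.fst := by
  obtain ⟨h1, h2, h3, h4⟩ := h.par x (h.ne_source hx) (by omega)
  obtain ⟨i1, i2, i3⟩ := h.backPath_spec d (N.arcTail (par x)) (by omega)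
  intro hm
  obtain ⟨a, ha, hax⟩ := List.mem_map.1 hm
  obtain ⟨-, j2, j3⟩ := i3 a ha
  have h5 : lev (N.arcHead (par x)) = d + 2 := by rw [h1, hx]
  have h6 : lev (N.arcTail (par x)) = d + 1 := by omega
  revert j2 j3 h5 h6
  simp only [arcHead, arcTail, hax]
  split_ifs <;> intros <;> omega

theorem nodup_backPath : ∀ (d : ℕ) (x : V), lev x = d + 1 →
    ((N.backPath par d x).map Prod.fst).Nodup := by
  intro d
  induction d with
  | zero => intro x _; simp [backPath]
  | succ d ih =>
    intro x hx
    obtain ⟨h1, h2, h3, h4⟩ := h.par x (h.ne_source hx) (by omega)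
    rw [backPath, List.map_append, List.map_singleton]
    refine List.Nodup.append (ih _ (by omega)) (List.nodup_singleton _) ?_
    rw [List.disjoint_singleton]
    exact h.par_fst_not_mem hx

theorem isShortestAugmenting {d : ℕ} (hd : lev N.sink = d + 1) :
    N.IsShortestAugmenting f (N.backPath par d N.sink) := by
  obtain ⟨h1, h2, h3⟩ := h.backPath_spec d _ hd
  refine ⟨⟨h1, fun a ha => (h3 a ha).1⟩, fun q hq => ?_⟩
  have := (h.le_of_walk hq.1 hq.2 (by rw [h.source]; omega)).2
  rw [h.source] at this
  omega

theorem not_isAugmenting (h0 : lev N.sink = 0) (q : List (E × Bool)) : ¬ N.IsAugmenting f q :=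
  fun hq => (h.le_of_walk hq.1 hq.2 (by rw [h.source]; omega)).1 h0

end IsLevels

end FlowNetwork

/-! ### The numbering of the vertices and the edges of the network -/

/-- The number with the base-`b` digits `g 0, …, g (m - 1)`, the most significant first. -/
def horner (b : ℕ) (g : ℕ → ℕ) : ℕ → ℕ
  | 0 => 0
  | m + 1 => horner b g m * b + g m

theorem horner_lt {b : ℕ} {g : ℕ → ℕ} (h : ∀ t, g t < b) (m : ℕ) : horner b g m < b ^ m := by
  induction m with
  | zero => simp [horner]
  | succ m ih =>
    rw [horner, pow_succ]
    have := Nat.mul_le_mul_right b (Nat.succ_le_of_lt ih)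
    have := h m
    rw [Nat.succ_mul] at *
    omega

theorem wordNum_eq_horner {k m : ℕ} (g : ℕ → ℕ) (u : Fin m → Fin k) (h : ∀ t : Fin m, (u t : ℕ) = g t) :
    wordNum u = horner k g m := by
  induction m with
  | zero => simp [wordNum, horner]
  | succ m ih =>
    rw [wordNum, Fin.sum_univ_castSucc, horner, ← ih (fun t => u t.castSucc) fun t => h t.castSucc,
      h (Fin.last m), wordNum, Finset.sum_mul]
    simp [Fin.rev_castSucc, pow_succ, mul_assoc]

theorem Petal.val_map_range {k m : ℕ} (g : ℕ → ℕ) (c : ℕ → Fin (k + 1)) (h : ∀ t, (c t : ℕ) = g t) :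
    Petal.val ((List.range m).map c) = horner (k + 1) g m := by
  induction m with
  | zero => rfl
  | succ m ih => rw [List.range_succ, List.map_append, List.map_singleton, Petal.val_concat, ih,
      horner, h]

/-- `finFunctionFinEquiv` takes the least significant digit first, whence the reversal. -/
theorem wordNum_eq {k m : ℕ} (u : Fin m → Fin k) :
    wordNum u = (finFunctionFinEquiv (fun t => u t.rev) : ℕ) := by
  rw [finFunctionFinEquiv_apply, wordNum, ← Equiv.sum_comp Fin.revPerm]
  simp

theorem wordNum_lt {k m : ℕ} (u : Fin m → Fin k) : wordNum u < k ^ m := by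
  rw [wordNum_eq]
  exact Fin.is_lt _

theorem wordNum_injective {k m : ℕ} : Function.Injective (wordNum (k := k) (m := m)) := by
  intro u u' h
  rw [wordNum_eq, wordNum_eq] at h
  have := finFunctionFinEquiv.injective (Fin.ext h)
  funext t
  simpa using congrFun this t.rev

theorem exists_wordNum_eq {k m i : ℕ} (h : i < k ^ m) : ∃ u : Fin m → Fin k, wordNum u = i := by
  refine ⟨fun t => finFunctionFinEquiv.symm ⟨i, h⟩ t.rev, ?_⟩
  rw [wordNum_eq]
  simp

section

variable {k n : ℕ}

def netVertexEquiv (k n : ℕ) :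
    NetVertex k n ≃ (Unit ⊕ Unit) ⊕ (Fin (n - 1) → Fin k) ⊕ Fin (k ^ (n - 1)) where
  toFun
    | .source => .inl (.inl ())
    | .sink => .inl (.inr ())
    | .word u => .inr (.inl u)
    | .sect j => .inr (.inr j)
  invFun
    | .inl (.inl _) => .source
    | .inl (.inr _) => .sink
    | .inr (.inl u) => .word u
    | .inr (.inr j) => .sect j
  left_inv x := by cases x <;> rfl
  right_inv x := by rcases x with (_ | _) | _ | _ <;> rfl

def netEdgeEquiv (k n : ℕ) : NetEdge k n ≃
    (Fin (n - 1) → Fin k) ⊕ (Fin (k ^ (n - 1)) × Fin k) ⊕ Fin (k ^ (n - 1)) where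
  toFun
    | .fromSource u => .inl u
    | .occ j r => .inr (.inl (j, r))
    | .toSink j => .inr (.inr j)
  invFun
    | .inl u => .fromSource u
    | .inr (.inl p) => .occ p.1 p.2
    | .inr (.inr j) => .toSink j
  left_inv x := by cases x <;> rfl
  right_inv x := by rcases x with _ | _ | _ <;> rfl

instance : Fintype (NetVertex k n) := Fintype.ofEquiv _ (netVertexEquiv k n).symm
instance : Fintype (NetEdge k n) := Fintype.ofEquiv _ (netEdgeEquiv k n).symm

theorem card_netVertex : Nat.card (NetVertex k n) = 2 * k ^ (n - 1) + 2 := by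
  rw [Nat.card_congr (netVertexEquiv k n)]
  simp
  ring

theorem card_netEdge : Nat.card (NetEdge k n) = (k + 2) * k ^ (n - 1) := by
  rw [Nat.card_congr (netEdgeEquiv k n)]
  simp
  ring

theorem sum_netEdge {M : Type} [AddCommMonoid M] (g : NetEdge k n → M) :
    ∑ e, g e = (∑ u, g (.fromSource u)) + ((∑ p : Fin (k ^ (n - 1)) × Fin k, g (.occ p.1 p.2)) +
      ∑ j, g (.toSink j)) := by
  rw [← Equiv.sum_comp (netEdgeEquiv k n).symm, Fintype.sum_sum_type, Fintype.sum_sum_type]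
  rfl

theorem pow_pred_mul (hn : 1 ≤ n) : k ^ (n - 1) * k = k ^ n := by
  rw [← pow_succ, Nat.sub_add_cancel hn]

theorem occ_lt (hn : 1 ≤ n) (j : Fin (k ^ (n - 1))) (r : Fin k) : (j : ℕ) * k + r < k ^ n := by
  rw [← pow_pred_mul hn]
  calc (j : ℕ) * k + r < j * k + k := by omega
    _ = (j + 1) * k := by ring
    _ ≤ _ := Nat.mul_le_mul_right _ j.2

theorem exists_occ (hn : 1 ≤ n) {i : ℕ} (hi : i < k ^ n) :
    ∃ (j : Fin (k ^ (n - 1))) (r : Fin k), (j : ℕ) * k + r = i := by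
  rw [← pow_pred_mul hn] at hi
  have hk : 0 < k := by
    rcases Nat.eq_zero_or_pos k with rfl | h
    · simp at hi
    · exact h
  exact ⟨⟨i / k, Nat.div_lt_of_lt_mul (by rwa [mul_comm])⟩, ⟨i % k, Nat.mod_lt _ hk⟩,
    Nat.div_add_mod' i k⟩

theorem occ_injective {j j' r r' : ℕ} (hr : r < k) (hr' : r' < k)
    (h : j * k + r = j' * k + r') : j = j' ∧ r = r' := by
  have h1 : (j * k + r) / k = j := by
    rw [mul_comm, Nat.mul_add_div (by omega), Nat.div_eq_of_lt hr, add_zero]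
  have h2 : (j' * k + r') / k = j' := by
    rw [mul_comm, Nat.mul_add_div (by omega), Nat.div_eq_of_lt hr', add_zero]
  obtain rfl : j = j' := by rw [← h1, ← h2, h]
  exact ⟨rfl, by omega⟩

theorem NetVertex.num_lt (x : NetVertex k n) : x.num < 2 * k ^ (n - 1) + 2 := by
  cases x with
  | source => simp [NetVertex.num]
  | sink => simp [NetVertex.num]
  | word u =>
    have := wordNum_lt u
    simp only [NetVertex.num]
    omega
  | sect j =>
    have := j.2
    simp only [NetVertex.num]
    omega

theorem NetVertex.num_injective : Function.Injective (NetVertex.num (k := k) (n := n)) := by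
  intro x y h
  cases x <;> cases y <;> simp only [NetVertex.num] at h <;> try first | rfl | omega
  · rename_i u u'
    rw [wordNum_injective (by omega : wordNum u = wordNum u')]
  · rename_i u j
    have := wordNum_lt u
    omega
  · rename_i j u
    have := wordNum_lt u
    omega
  · rename_i j j'
    rw [Fin.ext (by omega : (j : ℕ) = j')]

theorem NetEdge.num_lt (hn : 1 ≤ n) (e : NetEdge k n) : e.num < (k + 2) * k ^ (n - 1) := by
  have h0 : (k + 2) * k ^ (n - 1) = k ^ (n - 1) + k ^ n + k ^ (n - 1) := by
    rw [← pow_pred_mul hn]; ring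
  rw [h0]
  cases e with
  | fromSource u =>
    have := wordNum_lt u
    simp only [NetEdge.num]
    omega
  | occ j r =>
    have := occ_lt hn j r
    simp only [NetEdge.num]
    omega
  | toSink j =>
    have := j.2
    simp only [NetEdge.num]
    omega

theorem NetEdge.num_injective (hn : 1 ≤ n) : Function.Injective (NetEdge.num (k := k) (n := n)) := by
  intro x y h
  cases x <;> cases y <;> simp only [NetEdge.num] at h
  · rw [wordNum_injective h]
  · rename_i u j r
    have := wordNum_lt u
    omega
  · rename_i u j
    have := wordNum_lt u
    omega
  · rename_i j r u
    have := wordNum_lt u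
    omega
  · rename_i j r j' r'
    obtain ⟨h1, h2⟩ := occ_injective r.2 r'.2 (by omega : (j : ℕ) * k + r = j' * k + r')
    rw [Fin.ext h1, Fin.ext h2]
  · rename_i j r j'
    have := occ_lt hn j r
    omega
  · rename_i j u
    have := wordNum_lt u
    omega
  · rename_i j' j r
    have := occ_lt hn j r
    omega
  · rename_i j j'
    rw [Fin.ext (by omega : (j : ℕ) = j')]

theorem NetEdge.exists_num_eq (hn : 1 ≤ n) {i : ℕ} (hi : i < (k + 2) * k ^ (n - 1)) :
    ∃ e : NetEdge k n, e.num = i := by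
  have h0 : (k + 2) * k ^ (n - 1) = k ^ (n - 1) + k ^ n + k ^ (n - 1) := by
    rw [← pow_pred_mul hn]; ring
  rw [h0] at hi
  by_cases h1 : i < k ^ (n - 1)
  · obtain ⟨u, hu⟩ := exists_wordNum_eq h1
    exact ⟨.fromSource u, hu⟩
  · by_cases h2 : i < k ^ (n - 1) + k ^ n
    · obtain ⟨j, r, hjr⟩ := exists_occ (k := k) hn (show i - k ^ (n - 1) < k ^ n by omega)
      exact ⟨.occ j r, by simp only [NetEdge.num, hjr]; omega⟩
    · exact ⟨.toSink ⟨i - (k ^ (n - 1) + k ^ n), by omega⟩, by simp only [NetEdge.num]; omega⟩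

end

/-! ### A maximum flow saturates the network -/

section Saturation

open FlowNetwork

variable {k n : ℕ} {v : ZMod (k ^ n) → Fin k} {f : NetEdge k n → ℕ}

theorem excess_source (f : NetEdge k n → ℕ) :
    (distNetwork k n v).excess f .source = - ∑ u, (f (.fromSource u) : ℤ) := by
  simp [excess, sum_netEdge, distNetwork]

theorem excess_word (f : NetEdge k n → ℕ) (u : Fin (n - 1) → Fin k) :
    (distNetwork k n v).excess f (.word u) = (f (.fromSource u) : ℤ) -
      ∑ p : Fin (k ^ (n - 1)) × Fin k,
        if headVertex k n v (p.1 * k + p.2) = u then (f (.occ p.1 p.2) : ℤ) else 0 := by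
  simp [excess, sum_netEdge, distNetwork, sub_eq_add_neg]

theorem excess_sect (f : NetEdge k n → ℕ) (j : Fin (k ^ (n - 1))) :
    (distNetwork k n v).excess f (.sect j) =
      (∑ r, (f (.occ j r) : ℤ)) - f (.toSink j) := by
  simp [excess, sum_netEdge, distNetwork, Fintype.sum_prod_type, sub_eq_add_neg]

/-- A flow with unit capacities on the distribution network. -/
structure IsUnitFlow (v : ZMod (k ^ n) → Fin k) (f : NetEdge k n → ℕ) : Prop where
  le_one : ∀ e, f e ≤ 1
  excess : ∀ x, x ≠ .source → x ≠ .sink → (distNetwork k n v).excess f x = 0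

/-- The vertices that can be reached from the source in the residual network. -/
inductive Reachable {V E : Type} (N : FlowNetwork V E) (f : E → ℕ) : V → Prop
  | source : Reachable N f N.source
  | step (a : E × Bool) : Reachable N f (N.arcTail a) → 0 < N.residual f a →
      Reachable N f (N.arcHead a)

theorem Reachable.exists_walk {V E : Type} {N : FlowNetwork V E} {f : E → ℕ} {x : V}
    (h : Reachable N f x) : ∃ p, N.IsWalk N.source p x ∧ ∀ a ∈ p, 0 < N.residual f a := by
  induction h with
  | source => exact ⟨[], rfl, by simp⟩
  | step a _ ha ih =>
    obtain ⟨p, hp, hp'⟩ := ih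
    refine ⟨p ++ [a], IsWalk.append N hp ⟨rfl, rfl⟩, ?_⟩
    intro b hb
    rw [List.mem_append, List.mem_singleton] at hb
    rcases hb with hb | rfl
    · exact hp' b hb
    · exact ha

/-- The edge with head `u` and first symbol `a` is the word `a u`, which occurs in `v`. Thus every
word has `k` outgoing edges in the distribution graph. -/
theorem exists_occ_headVertex (hn : 1 ≤ n) (hk : 1 ≤ k) (hv : IsDeBruijn k n v)
    (u : Fin (n - 1) → Fin k) (a : Fin k) : ∃ p : Fin (k ^ (n - 1)) × Fin k,
      headVertex k n v (p.1 * k + p.2) = u ∧ v (((p.1 * k + p.2 : ℕ) : ZMod (k ^ n))) = a := by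
  obtain ⟨z, hz, -⟩ := hv fun t => if h : (t : ℕ) = 0 then a else u ⟨t - 1, by omega⟩
  have : NeZero (k ^ n) := ⟨(Nat.pow_pos hk).ne'⟩
  obtain ⟨j, r, hjr⟩ := exists_occ hn (ZMod.val_lt z)
  refine ⟨(j, r), ?_, ?_⟩
  · funext t
    have := hz ⟨t + 1, by omega⟩
    simp only [Nat.add_eq_zero_iff, one_ne_zero, and_false, dite_false,
      Nat.add_sub_cancel] at this
    rw [← this]
    simp only [headVertex]
    rw [hjr]
    congr 1
    push_cast
    rw [ZMod.natCast_zmod_val]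
    ring
  · have := hz ⟨0, hn⟩
    simp only [hjr, ZMod.natCast_zmod_val]
    simpa using this

variable (hf : IsUnitFlow v f)
include hf

theorem exists_occ_of_fromSource {u : Fin (n - 1) → Fin k} (h : f (.fromSource u) = 1) :
    ∃ p : Fin (k ^ (n - 1)) × Fin k, headVertex k n v (p.1 * k + p.2) = u ∧
      f (.occ p.1 p.2) = 1 := by
  have h1 := hf.excess (.word u) (by simp) (by simp)
  rw [excess_word, h, sub_eq_zero] at h1
  by_contra! hcon
  rw [Finset.sum_eq_zero] at h1
  · simp at h1
  · intro p _
    split_ifs with hp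
    · have h2 := hcon p hp
      have h3 := hf.le_one (.occ p.1 p.2)
      have : f (.occ p.1 p.2) = 0 := by omega
      simp [this]
    · rfl

theorem fromSource_of_occ {p : Fin (k ^ (n - 1)) × Fin k} (h : f (.occ p.1 p.2) = 1) :
    f (.fromSource (headVertex k n v (p.1 * k + p.2))) = 1 := by
  have h1 := hf.excess (.word (headVertex k n v (p.1 * k + p.2))) (by simp) (by simp)
  rw [excess_word, sub_eq_zero] at h1
  have h2 := Finset.single_le_sum (s := Finset.univ)
    (f := fun q : Fin (k ^ (n - 1)) × Fin k => if headVertex k n v (q.1 * k + q.2) =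
      headVertex k n v (p.1 * k + p.2) then (f (.occ q.1 q.2) : ℤ) else 0)
    (fun q _ => by split_ifs <;> simp) (Finset.mem_univ p)
  have h3 := hf.le_one (.fromSource (headVertex k n v (p.1 * k + p.2)))
  simp only [if_true, h] at h2
  omega

/-- By conservation, at most one unit leaves a word, since at most one enters it. -/
theorem occ_unique {p q : Fin (k ^ (n - 1)) × Fin k} (hp : f (.occ p.1 p.2) = 1)
    (hq : f (.occ q.1 q.2) = 1)
    (h : headVertex k n v (p.1 * k + p.2) = headVertex k n v (q.1 * k + q.2)) : p = q := by
  by_contra hne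
  have h1 := hf.excess (.word (headVertex k n v (p.1 * k + p.2))) (by simp) (by simp)
  rw [excess_word, sub_eq_zero] at h1
  have h2 := Finset.sum_le_sum_of_subset_of_nonneg (Finset.subset_univ {p, q})
    (f := fun q : Fin (k ^ (n - 1)) × Fin k => if headVertex k n v (q.1 * k + q.2) =
      headVertex k n v (p.1 * k + p.2) then (f (.occ q.1 q.2) : ℤ) else 0)
    (fun q _ _ => by split_ifs <;> simp)
  have h3 := hf.le_one (.fromSource (headVertex k n v (p.1 * k + p.2)))
  rw [Finset.sum_pair hne] at h2
  simp only [if_true, h.symm, hp, hq] at h2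
  omega

theorem sect_unique {p q : Fin (k ^ (n - 1)) × Fin k} (hp : f (.occ p.1 p.2) = 1)
    (hq : f (.occ q.1 q.2) = 1) (h : p.1 = q.1) : p = q := by
  obtain ⟨j, r⟩ := p
  obtain ⟨j', r'⟩ := q
  obtain rfl : j = j' := h
  by_contra hne
  have hr : r ≠ r' := fun h => hne (by rw [h])
  have h1 := hf.excess (.sect j) (by simp) (by simp)
  rw [excess_sect, sub_eq_zero] at h1
  have h2 := Finset.sum_le_sum_of_subset_of_nonneg (Finset.subset_univ {r, r'})
    (f := fun r => (f (.occ j r) : ℤ)) (fun q _ _ => by simp)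
  have h3 := hf.le_one (.toSink j)
  rw [Finset.sum_pair hr] at h2
  simp only [hp, hq] at h2
  omega

theorem exists_occ_of_toSink {j : Fin (k ^ (n - 1))} (h : f (.toSink j) = 1) :
    ∃ r, f (.occ j r) = 1 := by
  have h1 := hf.excess (.sect j) (by simp) (by simp)
  rw [excess_sect, h, sub_eq_zero] at h1
  by_contra! hcon
  rw [Finset.sum_eq_zero] at h1
  · simp at h1
  · intro r _
    have h2 := hcon r
    have h3 := hf.le_one (.occ j r)
    have : f (.occ j r) = 0 := by omega
    simp [this]

/-- Hall's argument at a minimum cut. If no flow enters `u₀`, then `u₀` is reachable. Let `W` and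
`T` be the reachable words and sections: all neighbours of `W` lie in `T`, so regularity gives `|W|
≤ |T|`. But the sections in `T` are saturated, and their flow comes from distinct words of `W` other
than `u₀`, so `|T| < |W|`. -/
theorem fromSource_eq_one (hn : 1 ≤ n) (hk : 1 ≤ k) (hv : IsDeBruijn k n v)
    (hmax : ∀ p, ¬ (distNetwork k n v).IsAugmenting f p) (u₀ : Fin (n - 1) → Fin k) :
    f (.fromSource u₀) = 1 := by
  classical
  by_contra hu₀
  have hu₀ : f (.fromSource u₀) = 0 := by
    have := hf.le_one (.fromSource u₀)
    omega
  set R := Reachable (distNetwork k n v) f with hR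
  have hsink : ¬ R .sink := fun h => by
    obtain ⟨p, hp⟩ := h.exists_walk
    exact hmax p hp
  have hstep : ∀ a, R ((distNetwork k n v).arcTail a) → 0 < (distNetwork k n v).residual f a →
      R ((distNetwork k n v).arcHead a) := fun a => Reachable.step a
  have hR₀ : R (.word u₀) :=
    hstep (.fromSource u₀, true) Reachable.source (by simp [FlowNetwork.residual, distNetwork, hu₀])
  set W : Finset (Fin (n - 1) → Fin k) := Finset.univ.filter fun u => R (.word u) with hW
  set T : Finset (Fin (k ^ (n - 1))) := Finset.univ.filter fun j => R (.sect j) with hT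
  -- the neighbours of reachable words are reachable
  have hnb : ∀ p : Fin (k ^ (n - 1)) × Fin k, R (.word (headVertex k n v (p.1 * k + p.2))) →
      R (.sect p.1) := by
    intro p hp
    by_cases h0 : f (.occ p.1 p.2) = 0
    · exact hstep (.occ p.1 p.2, true) hp (by simp [FlowNetwork.residual, distNetwork, h0])
    · have h1 : f (.occ p.1 p.2) = 1 := by
        have := hf.le_one (.occ p.1 p.2)
        omega
      have hp' := hp
      rw [hR] at hp'
      -- If the edge to the section carries flow, then so does the edge from the source to the word.
      -- The word was therefore reached against an edge with flow; only one leaves it, so it was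
      -- reached from this very section.
      generalize hx : NetVertex.word (headVertex k n v (p.1 * k + p.2)) = x at hp'
      cases hp' with
      | source => simp [distNetwork] at hx
      | step a ha ha' =>
        obtain ⟨e, b⟩ := a
        cases e with
        | fromSource u =>
          cases b
          · simp [arcHead, distNetwork] at hx
          · simp only [arcHead, distNetwork, if_true, NetVertex.word.injEq] at hx
            have := fromSource_of_occ hf h1
            rw [hx] at this
            simp [FlowNetwork.residual, distNetwork, this] at ha'
        | occ j r =>
          cases b
          · simp only [arcHead, distNetwork, Bool.false_eq_true, if_false,
              NetVertex.word.injEq] at hx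
            simp only [FlowNetwork.residual, Bool.false_eq_true, if_false] at ha'
            have h2 : f (.occ j r) = 1 := by
              have := hf.le_one (.occ j r)
              omega
            have : p = (j, r) := occ_unique hf h1 (q := (j, r)) h2 hx
            subst this
            exact ha
          · simp [arcHead, distNetwork] at hx
        | toSink j =>
          cases b <;> simp [arcHead, distNetwork] at hx
  -- the flow leads from the reachable sections back to words with flow
  have hback : ∀ j ∈ T, ∃ r, f (.occ j r) = 1 := by
    intro j hj
    refine exists_occ_of_toSink hf ?_
    by_contra hne
    have h0 : f (.toSink j) = 0 := by
      have := hf.le_one (.toSink j)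
      omega
    exact hsink (hstep (.toSink j, true) (Finset.mem_filter.1 hj).2
      (by simp [FlowNetwork.residual, distNetwork, h0]))
  have : Nonempty (Fin k) := ⟨⟨0, hk⟩⟩
  choose! r hr using hback
  have hcard1 : T.card < W.card := by
    have : T.image (fun j => headVertex k n v (j * k + r j)) ⊂ W := by
      rw [Finset.ssubset_iff_of_subset]
      · refine ⟨u₀, by simp [hW, hR₀], ?_⟩
        rw [Finset.mem_image]
        rintro ⟨j, hj, hju⟩
        have := fromSource_of_occ hf (p := (j, r j)) (hr j hj)
        rw [hju] at this
        omega
      · intro u hu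
        obtain ⟨j, hj, rfl⟩ := Finset.mem_image.1 hu
        simp only [hW, Finset.mem_filter, Finset.mem_univ, true_and]
        exact hstep (.occ j (r j), false) (Finset.mem_filter.1 hj).2
            (by simp [FlowNetwork.residual, hr j hj])
    refine lt_of_eq_of_lt ?_ (Finset.card_lt_card this)
    rw [Finset.card_image_of_injOn]
    intro j hj j' hj' h
    exact congrArg Prod.fst
      (occ_unique hf (p := (j, r j)) (q := (j', r j')) (hr j hj) (hr j' hj') h)
  -- the network is regular
  choose pos hpos hpos' using exists_occ_headVertex hn hk hv
  -- Each word of `W` has `k` outgoing edges, all of which end in `T`, where each section has `k`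
  -- places.
  have hcard2 : (W ×ˢ (Finset.univ : Finset (Fin k))).card ≤
      (T ×ˢ (Finset.univ : Finset (Fin k))).card := by
    refine Finset.card_le_card_of_injOn (fun q => pos q.1 q.2) ?_ ?_
    · intro q hq
      simp only [Finset.coe_product, Set.mem_prod, Finset.mem_coe, hW, hT, Finset.mem_filter,
        Finset.mem_univ, true_and, and_true] at hq ⊢
      refine hnb _ ?_
      rw [hpos]
      exact hq
    · intro q _ q' _ h
      simp only at h
      have h1 := hpos q.1 q.2
      have h2 := hpos' q.1 q.2
      rw [h, hpos] at h1
      rw [h, hpos'] at h2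
      exact Prod.ext h1.symm h2.symm
  rw [Finset.card_product, Finset.card_product, Finset.card_univ, Fintype.card_fin] at hcard2
  exact absurd (Nat.le_of_mul_le_mul_right hcard2 hk) (not_le.2 hcard1)

/-- The maximum flow chooses every word and every section. -/
theorem selects_of_max (hn : 1 ≤ n) (hk : 1 ≤ k) (hv : IsDeBruijn k n v)
    (hmax : ∀ p, ¬ (distNetwork k n v).IsAugmenting f p) {chosen : ℕ → Prop}
    (hc : ∀ (j : Fin (k ^ (n - 1))) (r : Fin k), chosen (j * k + r) ↔ f (.occ j r) = 1) :
    Extension.Selects k n v chosen ∧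
      ∀ j < k ^ (n - 1), ∃ r < k, chosen (j * k + r) := by
  have hall := fun u => exists_occ_of_fromSource hf (fromSource_eq_one hf hn hk hv hmax u)
  refine ⟨⟨fun u => ?_, ?_⟩, ?_⟩
  · obtain ⟨p, hp, hp'⟩ := hall u
    exact ⟨p.1 * k + p.2, occ_lt hn _ _, (hc _ _).2 hp', hp⟩
  · intro i hi i' hi' hci hci' h
    obtain ⟨j, r, rfl⟩ := exists_occ hn hi
    obtain ⟨j', r', rfl⟩ := exists_occ hn hi'
    have := occ_unique hf (p := (j, r)) (q := (j', r')) ((hc _ _).1 hci) ((hc _ _).1 hci') h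
    rw [Prod.mk.injEq] at this
    rw [this.1, this.2]
  · choose p hp hp' using hall
    -- A section passes on at most one unit, so distinct words use distinct sections; there are
    -- equally many of both, hence every section is used.
    have hinj : Function.Injective fun u => (p u).1 := by
      intro u u' h
      have := sect_unique hf (hp' u) (hp' u') h
      rw [← hp u, ← hp u', this]
    have hbij := (Fintype.bijective_iff_injective_and_card _).2 ⟨hinj, by simp⟩
    intro j hj
    obtain ⟨u, hu⟩ := hbij.2 ⟨j, hj⟩
    refine ⟨(p u).2, (p u).2.2, ?_⟩
    have h1 := (hc (p u).1 (p u).2).2 (hp' u)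
    simp only at hu
    rwa [hu] at h1

end Saturation

/-! ### The construction of the network in memory -/

namespace Expr

instance : Add Expr := ⟨.op .add⟩
instance : Sub Expr := ⟨.op .sub⟩
instance : Mul Expr := ⟨.op .mul⟩
instance : Div Expr := ⟨.op .div⟩
instance : Mod Expr := ⟨.op .mod⟩

variable (s : MState) (a b : Expr)

@[simp] theorem eval_add : (a + b).eval s = a.eval s + b.eval s := rfl
@[simp] theorem eval_sub : (a - b).eval s = a.eval s - b.eval s := rfl
@[simp] theorem eval_mul : (a * b).eval s = a.eval s * b.eval s := rfl
@[simp] theorem eval_div : (a / b).eval s = a.eval s / b.eval s := rfl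
@[simp] theorem eval_mod : (a % b).eval s = a.eval s % b.eval s := rfl
@[simp] theorem eval_lt : (Expr.op .lt a b).eval s = if a.eval s < b.eval s then 1 else 0 := rfl
@[simp] theorem eval_eq : (Expr.op .eq a b).eval s = if a.eval s = b.eval s then 1 else 0 := rfl
@[simp] theorem eval_lit (c : ℕ) : (Expr.lit c).eval s = c := rfl
@[simp] theorem eval_var (x : ℕ) : (Expr.var x).eval s = s.var x := rfl
@[simp] theorem eval_get (x : ℕ) : (Expr.get x a).eval s = s.arr x (a.eval s) := rfl

end Expr

namespace Machine

open Expr Prog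

/-- Register `9` becomes the number of the head of the edge number `i` of the Eulerian cycle, where
register `7` holds `i` and register `b` holds the base. -/
def headNum (b : ℕ) : Prog :=
  .seq (.assign 9 (.lit 0)) (.for 8 (.var 1 - .lit 1)
    (.assign 9 (.var 9 * .var b + .get 0 ((.var 7 + .lit 1 + .var 8) % .var 6))))

/-- Horner's scheme with `n - 1` digits; every intermediate value is below the corresponding power
of the base, and so below `m`. -/
theorem runs_headNum {m : ℕ} (hm : 2 ≤ m) {b : ℕ} (hb8 : b ≠ 8) (hb9 : b ≠ 9) {s : MState}
    (hlt : ∀ t, s.arr 0 t < s.var b) (hbm : s.var b ^ (s.var 1 - 1) ≤ m) :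
    Runs m (headNum b) s (30 * s.var 1 + 10) fun s' =>
      s'.var 9 = horner (s.var b) (fun t => s.arr 0 ((s.var 7 + 1 + t) % s.var 6)) (s.var 1 - 1) := by
  intro hs
  revert hs
  refine fun hs => Runs.mono (Runs.seq (Runs.simple hm rfl (fun _ => Nat.zero_le _))
    (T' := 30 * s.var 1 + 8) (Q' := fun s' => s'.var 9 =
      horner (s.var b) (fun t => s.arr 0 ((s.var 7 + 1 + t) % s.var 6)) (s.var 1 - 1)) ?_)
    ?_ (fun _ _ _ h => h) hs
  · rintro s₁ hs₁ - rfl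
    refine Runs.for hm (s.var 1 - 1) _ (fun _ => 13) (by decide) rfl
      ((Nat.sub_le _ _).trans (hs.1 1))
      (fun j s' => s'.var 9 = horner (s.var b)
        (fun t => s.arr 0 ((s.var 7 + 1 + t) % s.var 6)) j) ?_ ?_ ?_ ?_ ?_
    · simp [MState.set_var, Prog.run, horner]
    · intro j _ s' hF _
      have h1 : s'.var 1 = s.var 1 := (hF.1 1 rfl).trans rfl
      simp [h1]
    · intro j hj s' hs' hF hI hij
      have hb : s'.var b = s.var b := by
        rw [hF.1 b (by simp [Prog.for, Prog.writesVar, hb8.symm, hb9.symm])]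
        simp [Prog.run, hb9]
      have h6 : s'.var 6 = s.var 6 := hF.1 6 rfl
      have h7 : s'.var 7 = s.var 7 := hF.1 7 rfl
      have h0 : s'.arr 0 = s.arr 0 := hF.2 0 rfl
      have hval : (Expr.var 9 * Expr.var b +
          Expr.get 0 ((Expr.var 7 + Expr.lit 1 + Expr.var 8) % Expr.var 6)).eval s' =
          horner (s.var b) (fun t => s.arr 0 ((s.var 7 + 1 + t) % s.var 6)) (j + 1) := by
        simp [hb, h6, h7, h0, hI, hij, horner]
      refine Runs.mono (Runs.simple hm rfl fun _ => ?_) (by exact le_of_eq rfl) ?_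
      · simp only [Prog.Safe]
        rw [hval]
        refine (horner_lt (fun t => hlt _) _).le.trans (le_trans ?_ hbm)
        exact Nat.pow_le_pow_right (Nat.zero_lt_of_lt (hlt 0)) hj
      · rintro _ _ _ rfl
        simp only [Prog.run, hval]
        simp [MState.set_var]
    · intro s' _ _ h
      exact h
    · rw [Finset.sum_const, Finset.card_range, smul_eq_mul]
      simp only [show (Expr.var 1 - Expr.lit 1).cost = 3 from rfl]
      omega
  · have : (Prog.assign 9 (.lit 0)).time = 2 := rfl
    omega

/-- The program that stores the network in memory. -/
def prep : Prog :=
  .seq (.assign 5 (.lit 1)) <|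
  .seq (.for 8 (.var 1 - .lit 1) (.assign 5 (.var 5 * .var 0))) <|
  .seq (.seq (.assign 6 (.var 5 * .var 0)) <|
    .seq (.assign 2 (.lit 2 * .var 5 + .lit 2)) <|
    .seq (.assign 3 ((.var 0 + .lit 2) * .var 5)) (.assign 4 (.lit 1))) <|
  .seq (.for 7 (.var 5) <|
    .seq (.store 1 (.var 7) (.lit 0)) <|
    .seq (.store 2 (.var 7) (.lit 2 + .var 7)) (.store 3 (.var 7) (.lit 1))) <|
  .seq (.for 7 (.var 6) <|
    .seq (headNum 0) <|
    .seq (.store 1 (.var 5 + .var 7) (.lit 2 + .var 9)) <|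
    .seq (.store 2 (.var 5 + .var 7) (.lit 2 + .var 5 + .var 7 / .var 0))
      (.store 3 (.var 5 + .var 7) (.lit 1)))
  (.for 7 (.var 5) <|
    .seq (.store 1 (.var 5 + .var 6 + .var 7) (.lit 2 + .var 5 + .var 7)) <|
    .seq (.store 2 (.var 5 + .var 6 + .var 7) (.lit 1))
      (.store 3 (.var 5 + .var 6 + .var 7) (.lit 1)))

section Prep

variable {k n : ℕ} (v : ZMod (k ^ n) → Fin k)

/-- The number of the tail of the edge number `i` of the network. -/
def tailNum (i : ℕ) : ℕ :=
  if i < k ^ (n - 1) then 0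
  else if i < k ^ (n - 1) + k ^ n then
    2 + horner k (fun t => (inputState k n v).arr 0 ((i - k ^ (n - 1) + 1 + t) % k ^ n)) (n - 1)
  else 2 + k ^ (n - 1) + (i - (k ^ (n - 1) + k ^ n))

/-- The number of the head of the edge number `i` of the network. -/
def endNum (i : ℕ) : ℕ :=
  if i < k ^ (n - 1) then 2 + i
  else if i < k ^ (n - 1) + k ^ n then 2 + k ^ (n - 1) + (i - k ^ (n - 1)) / k
  else 1

theorem input_lt (hk : 1 ≤ k) (t : ℕ) : (inputState k n v).arr 0 t < k := by
  simp only [inputState]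
  split_ifs
  · exact Fin.is_lt _
  · exact hk

theorem input_mod (hk : 1 ≤ k) (t : ℕ) :
    (inputState k n v).arr 0 (t % k ^ n) = v (t : ZMod (k ^ n)) := by
  simp [inputState, Nat.mod_lt _ (Nat.pow_pos hk : 0 < k ^ n)]

theorem horner_input (hk : 1 ≤ k) (i : ℕ) :
    horner k (fun t => (inputState k n v).arr 0 ((i + 1 + t) % k ^ n)) (n - 1) =
      wordNum (headVertex k n v i) := by
  refine (wordNum_eq_horner _ _ fun t => ?_).symm
  rw [input_mod v hk]
  rfl

/-- The first `p` edges are stored in memory. -/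
def Filled (p : ℕ) (s : MState) : Prop :=
  ∀ i < p, s.arr 1 i = tailNum v i ∧ s.arr 2 i = endNum (k := k) (n := n) i ∧ s.arr 3 i = 1

theorem Filled.step {p : ℕ} {s s' : MState} (h : Filled v p s)
    (h1 : s'.arr 1 = Function.update (s.arr 1) p (tailNum v p))
    (h2 : s'.arr 2 = Function.update (s.arr 2) p (endNum (k := k) (n := n) p))
    (h3 : s'.arr 3 = Function.update (s.arr 3) p 1) : Filled v (p + 1) s' := by
  intro i hi
  rw [h1, h2, h3]
  rcases eq_or_ne i p with rfl | hne
  · simp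
  · simpa [Function.update_of_ne hne] using h i (by omega)

/-- The parameters and the sequence are in memory. -/
structure HasParams (s : MState) : Prop where
  v0 : s.var 0 = k
  v1 : s.var 1 = n
  v2 : s.var 2 = 2 * k ^ (n - 1) + 2
  v3 : s.var 3 = (k + 2) * k ^ (n - 1)
  v5 : s.var 5 = k ^ (n - 1)
  v6 : s.var 6 = k ^ n
  a0 : s.arr 0 = (inputState k n v).arr 0

theorem HasParams.of_frame {s s' : MState} {P : Prog} (h : HasParams v s) (hF : Frame P s s')
    (h0 : P.writesVar 0 = false) (h1 : P.writesVar 1 = false) (h2 : P.writesVar 2 = false)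
    (h3 : P.writesVar 3 = false) (h5 : P.writesVar 5 = false) (h6 : P.writesVar 6 = false)
    (ha : P.writesArr 0 = false) : HasParams v s' :=
  ⟨(hF.1 0 h0).trans h.v0, (hF.1 1 h1).trans h.v1, (hF.1 2 h2).trans h.v2,
    (hF.1 3 h3).trans h.v3, (hF.1 5 h5).trans h.v5, (hF.1 6 h6).trans h.v6,
    (hF.2 0 ha).trans h.a0⟩

theorem Filled.holdsNetwork (hk : 1 ≤ k) (hn : 1 ≤ n) {s : MState} (hp : HasParams v s)
    (h : Filled v ((k + 2) * k ^ (n - 1)) s) : HoldsNetwork (distNetwork k n v) s := by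
  refine ⟨by rw [card_netVertex, hp.v2], by rw [card_netEdge, hp.v3], fun e => ?_⟩
  obtain ⟨h1, h2, h3⟩ := h e.num (e.num_lt hn)
  rw [h1, h2, h3]
  cases e with
  | fromSource u =>
    have := wordNum_lt u
    simp [NetEdge.num, tailNum, endNum, distNetwork, NetVertex.num, this]
  | occ j r =>
    have h4 := occ_lt hn j r
    have h5 : ((j : ℕ) * k + r) / k = j := by
      rw [mul_comm, Nat.mul_add_div (by omega), Nat.div_eq_of_lt r.2, add_zero]
    simp [NetEdge.num, tailNum, endNum, distNetwork, NetVertex.num, h4, horner_input v hk, h5]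
  | toSink j =>
    simp [NetEdge.num, tailNum, endNum, distNetwork, NetVertex.num, add_assoc]
    omega

/-- The cost is dominated by the numbers of `k ^ n` words, each computed in `O(n)` operations. -/
theorem runs_prep (hk : 1 ≤ k) (hn : 1 ≤ n) {m : ℕ} (hm : 16 * (k + 1) ^ n ≤ m) :
    Runs m prep (inputState k n v) (300 * (n * k ^ n)) fun s =>
      HasParams v s ∧ s.var 4 = 1 ∧ Filled v ((k + 2) * k ^ (n - 1)) s := by
  have hK : k ^ n ≤ (k + 1) ^ n := Nat.pow_le_pow_left (by omega) n
  have hM : k ^ (n - 1) ≤ k ^ n := Nat.pow_le_pow_right hk (by omega)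
  have hM0 : 0 < k ^ (n - 1) := Nat.pow_pos hk
  have hMN := pow_pred_mul (k := k) hn
  have hn' : n < (k + 1) ^ n := Nat.lt_pow_self (by omega)
  have hkN : k ≤ k ^ n := Nat.le_self_pow (by omega) k
  have hE : (k + 2) * k ^ (n - 1) = k ^ (n - 1) + k ^ n + k ^ (n - 1) := by rw [← hMN]; ring
  have hm2 : 2 ≤ m := by omega
  have hloop1 : ∀ s : MState, s.var 0 = k → s.var 1 = n → s.var 5 = 1 →
      Runs m (.for 8 (.var 1 - .lit 1) (.assign 5 (.var 5 * .var 0))) s (14 * n + 8) fun s' =>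
        s'.var 5 = k ^ (n - 1) := by
    intro s h0 h1 h5
    refine Runs.for hm2 (n - 1) _ (fun _ => 4) (by decide) rfl (by omega)
      (fun j s' => s'.var 5 = k ^ j) ?_ ?_ ?_ ?_ ?_
    · simp [MState.set_var, h5]
    · intro j _ s' hF _
      have h1' : s'.var 1 = s.var 1 := hF.1 1 rfl
      simp [h1', h1]
    · intro j hj s' hs' hF hI hij
      have h0' : s'.var 0 = s.var 0 := hF.1 0 rfl
      have hval : (Expr.var 5 * Expr.var 0).eval s' = k ^ (j + 1) := by
        simp [h0', h0, hI, pow_succ]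
      refine Runs.mono (Runs.simple hm2 rfl fun _ => ?_) (by exact le_of_eq rfl) ?_
      · simp only [Prog.Safe]
        rw [hval]
        have : k ^ (j + 1) ≤ k ^ (n - 1) := Nat.pow_le_pow_right hk hj
        omega
      · rintro _ _ _ rfl
        simp only [Prog.run, hval]
        simp [MState.set_var]
    · intro s' _ _ h
      exact h
    · rw [Finset.sum_const, Finset.card_range, smul_eq_mul,
        show (Expr.var 1 - Expr.lit 1).cost = 3 from rfl]
      omega
  have hfill1 : ∀ s : MState, HasParams v s → Runs m (.for 7 (.var 5) <|
      .seq (.store 1 (.var 7) (.lit 0)) <|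
      .seq (.store 2 (.var 7) (.lit 2 + .var 7)) (.store 3 (.var 7) (.lit 1))) s
      (20 * k ^ (n - 1) + 10) (Filled v (k ^ (n - 1))) := by
    intro s hp
    refine Runs.for hm2 (k ^ (n - 1)) _ (fun _ => 11) (by decide) rfl (by omega)
      (fun j s' => Filled v j s') (by intro i hi; omega) ?_ ?_ (fun s' _ _ h => h) ?_
    · intro j _ s' hF _
      exact (hp.of_frame v hF rfl rfl rfl rfl rfl rfl rfl).v5
    · intro j hj s' hs' hF hI hij
      refine Runs.mono (Runs.simple hm2 rfl fun _ => ?_) (by decide) ?_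
      · simp [Prog.Safe, Prog.run, hij]
        omega
      · rintro _ _ _ rfl
        refine hI.step v ?_ ?_ ?_ <;> simp [Prog.run, MState.set, hij, tailNum, endNum, hj]
    · rw [Finset.sum_const, Finset.card_range, smul_eq_mul, show (Expr.var 5).cost = 1 from rfl]
      omega
  have hfill2 : ∀ s : MState, HasParams v s → Filled v (k ^ (n - 1)) s → Runs m
      (.for 7 (.var 6) <|
      .seq (headNum 0) <|
      .seq (.store 1 (.var 5 + .var 7) (.lit 2 + .var 9)) <|
      .seq (.store 2 (.var 5 + .var 7) (.lit 2 + .var 5 + .var 7 / .var 0))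
        (.store 3 (.var 5 + .var 7) (.lit 1))) s
      (100 * (n * k ^ n) + 10) (Filled v (k ^ (n - 1) + k ^ n)) := by
    intro s hp hf
    refine Runs.for hm2 (k ^ n) _ (fun _ => 30 * n + 10 + 26) (by decide) rfl (by omega)
      (fun j s' => Filled v (k ^ (n - 1) + j) s') hf ?_ ?_ (fun s' _ _ h => h) ?_
    · intro j _ s' hF _
      exact (hp.of_frame v hF rfl rfl rfl rfl rfl rfl rfl).v6
    · intro j hj s' hs' hF hI hij
      have hp' := hp.of_frame v hF rfl rfl rfl rfl rfl rfl rfl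
      have hhead := runs_headNum hm2 (b := 0) (by decide) (by decide) (s := s')
        (by rw [hp'.a0, hp'.v0]; exact input_lt v hk) (by rw [hp'.v0, hp'.v1]; omega)
      rw [hp'.v1] at hhead
      refine Runs.mono (Runs.seq hhead (T' := 26)
        (Q' := fun s'' => Filled v (k ^ (n - 1) + (j + 1)) (s''.set 7 (j + 1))) ?_) (by omega)
        (fun _ _ _ h => h)
      intro s₁ hs₁ hF₁ h9
      have hp₁ := hp'.of_frame v hF₁ rfl rfl rfl rfl rfl rfl rfl
      have h7 : s₁.var 7 = j := (hF₁.1 7 rfl).trans hij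
      have hf₁ : Filled v (k ^ (n - 1) + j) s₁ := by
        intro i hi
        rw [hF₁.2 1 rfl, hF₁.2 2 rfl, hF₁.2 3 rfl]
        exact hI i hi
      rw [hp'.a0, hp'.v0, hp'.v6, hij] at h9
      have h9' := h9
      rw [horner_input v hk] at h9'
      have hw := wordNum_lt (headVertex k n v j)
      have hjk := Nat.div_le_self j k
      refine Runs.mono (Runs.simple hm2 rfl fun _ => ?_) (by decide) ?_
      · simp [Prog.Safe, Prog.run, h7, hp₁.v5, hp₁.v0, h9']
        omega
      · rintro _ _ _ rfl
        rw [← add_assoc]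
        refine hf₁.step v ?_ ?_ ?_ <;>
        simp [Prog.run, MState.set, h7, tailNum, endNum, hj, hp₁.v5, hp₁.v0, h9]
    · rw [Finset.sum_const, Finset.card_range, smul_eq_mul, show (Expr.var 6).cost = 1 from rfl]
      have : k ^ n ≤ n * k ^ n := Nat.le_mul_of_pos_left _ hn
      have : k ^ n * (30 * n + 10 + 26 + (1 + 7)) = 30 * (n * k ^ n) + 44 * k ^ n := by ring
      omega
  have hfill3 : ∀ s : MState, HasParams v s → Filled v (k ^ (n - 1) + k ^ n) s → Runs m
      (.for 7 (.var 5) <|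
      .seq (.store 1 (.var 5 + .var 6 + .var 7) (.lit 2 + .var 5 + .var 7)) <|
      .seq (.store 2 (.var 5 + .var 6 + .var 7) (.lit 1))
        (.store 3 (.var 5 + .var 6 + .var 7) (.lit 1))) s
      (40 * k ^ (n - 1) + 10) (Filled v ((k + 2) * k ^ (n - 1))) := by
    intro s hp hf
    refine Runs.for hm2 (k ^ (n - 1)) _ (fun _ => 25) (by decide) rfl (by omega)
      (fun j s' => Filled v (k ^ (n - 1) + k ^ n + j) s') hf ?_ ?_
      (fun s' _ _ h => by rwa [hE]) ?_
    · intro j _ s' hF _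
      exact (hp.of_frame v hF rfl rfl rfl rfl rfl rfl rfl).v5
    · intro j hj s' hs' hF hI hij
      have hp' := hp.of_frame v hF rfl rfl rfl rfl rfl rfl rfl
      refine Runs.mono (Runs.simple hm2 rfl fun _ => ?_) (by decide) ?_
      · simp [Prog.Safe, Prog.run, hij, hp'.v5]
        omega
      · rintro _ _ _ rfl
        rw [← add_assoc]
        have h1 : ¬ k ^ (n - 1) + k ^ n + j < k ^ (n - 1) := by omega
        have h2 : k ^ (n - 1) + k ^ n + j - (k ^ (n - 1) + k ^ n) = j := by omega
        refine hI.step v ?_ ?_ ?_ <;>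
        simp [Prog.run, MState.set, hij, tailNum, endNum, hp'.v5, hp'.v6, h1, h2]
    · rw [Finset.sum_const, Finset.card_range, smul_eq_mul, show (Expr.var 5).cost = 1 from rfl]
      omega
  have hset : ∀ s : MState, s.var 0 = k → s.var 1 = n → s.var 5 = k ^ (n - 1) →
      s.arr 0 = (inputState k n v).arr 0 →
      Runs m (.seq (.assign 6 (.var 5 * .var 0)) <|
        .seq (.assign 2 (.lit 2 * .var 5 + .lit 2)) <|
        .seq (.assign 3 ((.var 0 + .lit 2) * .var 5)) (.assign 4 (.lit 1))) s 18 fun s' =>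
          HasParams v s' ∧ s'.var 4 = 1 := by
    intro s h0 h1 h5 ha
    refine Runs.mono (Runs.simple hm2 rfl fun _ => ?_) (by decide) ?_
    · simp [Prog.Safe, Prog.run, h0, h5, hMN]
      omega
    · rintro _ _ _ rfl
      exact ⟨⟨by simp [Prog.run, h0], by simp [Prog.run, h1], by simp [Prog.run, h5],
        by simp [Prog.run, h0, h5], by simp [Prog.run, h5], by simp [Prog.run, h0, h5, hMN],
        by simp [Prog.run, ha]⟩, by simp [Prog.run]⟩
  have hone : k ^ n ≤ n * k ^ n := Nat.le_mul_of_pos_left _ hn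
  have hnN : n ≤ n * k ^ n := Nat.le_mul_of_pos_right _ (Nat.pow_pos hk)
  refine Runs.mono (Runs.seq (Runs.simple hm2 rfl fun _ => ?_) (T' := 298 * (n * k ^ n))
    (Q' := fun s => HasParams v s ∧ s.var 4 = 1 ∧ Filled v ((k + 2) * k ^ (n - 1)) s) ?_) ?_
    (fun _ _ _ h => h)
  · simp [Prog.Safe]
    omega
  · rintro s₁ - hF₁ hs₁
    have e0 : s₁.var 0 = k := (hF₁.1 0 rfl).trans rfl
    have e1 : s₁.var 1 = n := (hF₁.1 1 rfl).trans rfl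
    have e5 : s₁.var 5 = 1 := by rw [hs₁]; simp [Prog.run]
    refine Runs.mono (Runs.seq (hloop1 s₁ e0 e1 e5) (T' := 270 * (n * k ^ n)) ?_) (by omega)
      (fun _ _ _ h => h)
    intro s₂ _ hF₂ h5
    refine Runs.mono (Runs.seq (hset s₂ ((hF₂.1 0 rfl).trans e0) ((hF₂.1 1 rfl).trans e1) h5
      ((hF₂.2 0 rfl).trans (hF₁.2 0 rfl))) (T' := 20 * k ^ (n - 1) + 10 +
        (100 * (n * k ^ n) + 10 + (40 * k ^ (n - 1) + 10))) ?_) ?_ (fun _ _ _ h => h)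
    · rintro s₃ _ - ⟨hp₃, h4⟩
      refine Runs.seq (hfill1 s₃ hp₃) ?_
      intro s₄ _ hF₄ hfl
      have hp₄ := hp₃.of_frame v hF₄ rfl rfl rfl rfl rfl rfl rfl
      refine Runs.seq (hfill2 s₄ hp₄ hfl) ?_
      intro s₅ _ hF₅ hfl'
      have hp₅ := hp₄.of_frame v hF₅ rfl rfl rfl rfl rfl rfl rfl
      refine Runs.mono (hfill3 s₅ hp₅ hfl') le_rfl ?_
      intro s₆ _ hF₆ hfl''
      exact ⟨hp₅.of_frame v hF₆ rfl rfl rfl rfl rfl rfl rfl,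
        (hF₆.1 4 rfl).trans ((hF₅.1 4 rfl).trans ((hF₄.1 4 rfl).trans h4)), hfl''⟩
    · omega
  · have : (Prog.assign 5 (.lit 1)).time = 2 := rfl
    omega

end Prep

end Machine

/-! ### Breadth-first search, one arc after the other -/

namespace FlowNetwork

variable {V E : Type} (N : FlowNetwork V E)

/-- The state of a breadth-first search that has scanned all arcs whose tails have a level below `d`,
and those arcs from level `d` that belong to `A`. -/
structure IsPartial (f : E → ℕ) (d : ℕ) (A : Set (E × Bool)) (lev : V → ℕ) (par : V → E × Bool) :
    Prop where
  source : lev N.source = 1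
  par : ∀ x, x ≠ N.source → lev x ≠ 0 → N.arcHead (par x) = x ∧ lev (N.arcTail (par x)) ≠ 0 ∧
    lev (N.arcTail (par x)) + 1 = lev x ∧ 0 < N.residual f (par x)
  le : ∀ x, lev x ≤ d + 1
  relax : ∀ a, 0 < N.residual f a → lev (N.arcTail a) ≠ 0 →
    (lev (N.arcTail a) < d ∨ (lev (N.arcTail a) = d ∧ a ∈ A)) →
    lev (N.arcHead a) ≠ 0 ∧ lev (N.arcHead a) ≤ lev (N.arcTail a) + 1

open Classical in
theorem isPartial_init (f : E → ℕ) (par : V → E × Bool) :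
    N.IsPartial f 1 ∅ (fun x => if x = N.source then 1 else 0) par where
  source := by simp
  par x hx h := by simp [hx] at h
  le x := by split_ifs <;> omega
  relax a _ h h' := by
    simp only [Set.mem_empty_iff_false, and_false, or_false] at h'
    omega

namespace IsPartial

variable {N} {f : E → ℕ} {d : ℕ} {A : Set (E × Bool)} {lev : V → ℕ} {par : V → E × Bool}
  (h : N.IsPartial f d A lev par)
include h

/-- An arc that leads to no new vertex imposes nothing new: if it starts in level `d` and is
residual, its head has been found, with level at most `d + 1`. -/
theorem insert_of_not {a : E × Bool} (ha : ¬ (lev (N.arcTail a) = d ∧ 0 < N.residual f a ∧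
    lev (N.arcHead a) = 0)) : N.IsPartial f d (insert a A) lev par where
  source := h.source
  par := h.par
  le := h.le
  relax b hb hb' hb'' := by
    rcases hb'' with hb'' | ⟨hb'', hbA⟩
    · exact h.relax b hb hb' (.inl hb'')
    · rcases hbA with rfl | hbA
      · refine ⟨fun h0 => ha ⟨hb'', hb, h0⟩, ?_⟩
        have := h.le (N.arcHead b)
        omega
      · exact h.relax b hb hb' (.inr ⟨hb'', hbA⟩)

open Classical in
-- The new vertex gets level `d + 1`, so the arcs that leave it are not yet among those that count
-- as scanned.
theorem insert_of {a : E × Bool} (hd : d ≠ 0) (h1 : lev (N.arcTail a) = d)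
    (h2 : 0 < N.residual f a) (h3 : lev (N.arcHead a) = 0) :
    N.IsPartial f d (insert a A) (Function.update lev (N.arcHead a) (d + 1))
      (Function.update par (N.arcHead a) a) := by
  have hne : ∀ x, lev x ≠ 0 → x ≠ N.arcHead a := fun x hx hxa => hx (hxa ▸ h3)
  have hold : ∀ x, lev x ≠ 0 → Function.update lev (N.arcHead a) (d + 1) x = lev x :=
    fun x hx => Function.update_of_ne (hne x hx) _ _
  have hta := hold _ (h1 ▸ hd)
  refine ⟨?_, ?_, ?_, ?_⟩
  · rw [hold _ (by rw [h.source]; omega), h.source]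
  · intro x hx hlx
    by_cases hxa : x = N.arcHead a
    · subst hxa
      rw [Function.update_self, Function.update_self, hta]
      exact ⟨rfl, h1 ▸ hd, by rw [h1], h2⟩
    · rw [Function.update_of_ne hxa] at hlx
      rw [Function.update_of_ne hxa, Function.update_of_ne hxa]
      obtain ⟨i1, i2, i3, i4⟩ := h.par x hx hlx
      rw [hold _ i2]
      exact ⟨i1, i2, i3, i4⟩
  · intro x
    by_cases hxa : x = N.arcHead a
    · subst hxa
      rw [Function.update_self]
    · rw [Function.update_of_ne hxa]
      exact h.le x
  · intro b hb hb' hb''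
    have hbt : N.arcTail b ≠ N.arcHead a := by
      intro hbt
      rw [hbt, Function.update_self] at hb''
      omega
    rw [Function.update_of_ne hbt] at hb' hb'' ⊢
    by_cases hba : b = a
    · subst hba
      rw [Function.update_self]
      omega
    · obtain ⟨i1, i2⟩ := h.relax b hb hb' (by
        rcases hb'' with hb'' | ⟨hb'', hbA⟩
        · exact .inl hb''
        · exact .inr ⟨hb'', Set.mem_of_mem_insert_of_ne hbA hba⟩)
      rw [hold _ i1]
      exact ⟨i1, i2⟩

theorem next (hA : ∀ a, a ∈ A) : N.IsPartial f (d + 1) ∅ lev par where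
  source := h.source
  par := h.par
  le x := (h.le x).trans (by omega)
  relax a ha ha' ha'' := by
    refine h.relax a ha ha' ?_
    simp only [Set.mem_empty_iff_false, and_false, or_false] at ha''
    rcases Nat.lt_or_ge (lev (N.arcTail a)) d with hlt | hge
    · exact .inl hlt
    · exact .inr ⟨by omega, hA a⟩

theorem exists_lev_eq {x : V} {j : ℕ} (hj : 1 ≤ j) (hx : j ≤ lev x) : ∃ y, lev y = j := by
  have key : ∀ i x, lev x = j + i → ∃ y, lev y = j := by
    intro i
    induction i with
    | zero => exact fun x hx => ⟨x, hx⟩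
    | succ i ih =>
      intro x hx
      have hne : x ≠ N.source := by
        rintro rfl
        rw [h.source] at hx
        omega
      obtain ⟨-, -, h3, -⟩ := h.par x hne (by omega)
      exact ih (N.arcTail (par x)) (by omega)
  exact key (lev x - j) x (by omega)

/-- Going back along `par` lowers the level by one each time, so all levels from `1` to `lev x`
occur. Consequently the search is complete once `d` exceeds the number of vertices. -/
theorem lev_le_card [Fintype V] (x : V) : lev x ≤ Fintype.card V := by
  have hsub : Finset.Icc 1 (lev x) ⊆ Finset.univ.image lev := by
    intro j hj
    obtain ⟨h1, h2⟩ := Finset.mem_Icc.1 hj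
    obtain ⟨y, hy⟩ := h.exists_lev_eq h1 h2
    exact Finset.mem_image.2 ⟨y, Finset.mem_univ y, hy⟩
  have h1 := Finset.card_le_card hsub
  have h2 : (Finset.univ.image lev).card ≤ Fintype.card V := Finset.card_image_le
  rw [Nat.card_Icc] at h1
  omega

theorem isLevels [Fintype V] (hd : Fintype.card V < d) : N.IsLevels f lev par where
  source := h.source
  par := h.par
  relax a ha ha' := h.relax a ha ha' (.inl ((h.lev_le_card _).trans_lt hd))

end IsPartial

end FlowNetwork

/-! ### One round of the Edmonds–Karp method -/

namespace Machine

open Expr Prog FlowNetwork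

/-- Scan the arc whose number is in register `11`, for the level in register `16` plus `1`. -/
def scanArc : Prog :=
  .seq (.assign 12 (.var 11 / .lit 2)) <|
  .seq (.ite (.var 11 % .lit 2)
    (.seq (.assign 13 (.get 1 (.var 12))) <| .seq (.assign 14 (.get 2 (.var 12)))
      (.assign 15 (.get 3 (.var 12) - .get 4 (.var 12))))
    (.seq (.assign 13 (.get 2 (.var 12))) <| .seq (.assign 14 (.get 1 (.var 12)))
      (.assign 15 (.get 4 (.var 12))))) <|
  .ite (.op .eq (.get 6 (.var 13)) (.var 16 + .lit 1))
    (.ite (.op .lt (.lit 0) (.var 15))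
      (.ite (.op .eq (.get 6 (.var 14)) (.lit 0))
        (.seq (.store 6 (.var 14) (.var 16 + .lit 2)) (.store 7 (.var 14) (.var 11)))
        .skip)
      .skip)
    .skip

/-- The breadth-first search from the source. -/
def search : Prog :=
  .seq (.for 8 (.var 2) (.store 6 (.var 8) (.lit 0))) <|
  .seq (.store 6 (.lit 0) (.lit 1)) <|
  .for 16 (.var 2) (.for 11 (.lit 2 * .var 3) scanArc)

/-- Push one unit along the arc by which the vertex in register `15` was found, and go to the tail
of this arc. -/
def pushArc : Prog :=
  .seq (.assign 11 (.get 7 (.var 15))) <|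
  .seq (.assign 12 (.var 11 / .lit 2)) <|
  .ite (.var 11 % .lit 2)
    (.seq (.store 4 (.var 12) (.get 4 (.var 12) + .lit 1)) (.assign 15 (.get 1 (.var 12))))
    (.seq (.store 4 (.var 12) (.get 4 (.var 12) - .lit 1)) (.assign 15 (.get 2 (.var 12))))

/-- One round of the Edmonds–Karp method. -/
def round : Prog :=
  .seq search <|
  .ite (.get 6 (.lit 1)) (.seq (.assign 15 (.lit 1)) (.loop (.var 15) pushArc))
    (.assign 4 (.lit 0))

section Round

variable {k n : ℕ} {v : ZMod (k ^ n) → Fin k}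

/-- The number of an arc of the residual network. -/
def arcNum (a : NetEdge k n × Bool) : ℕ := 2 * a.1.num + if a.2 then 1 else 0

theorem arcNum_div (a : NetEdge k n × Bool) : arcNum a / 2 = a.1.num := by
  unfold arcNum
  split_ifs <;> omega

theorem arcNum_mod (a : NetEdge k n × Bool) : arcNum a % 2 = if a.2 then 1 else 0 := by
  unfold arcNum
  split_ifs <;> omega

theorem arcNum_injective (hn : 1 ≤ n) : Function.Injective (arcNum (k := k) (n := n)) := by
  rintro ⟨e, b⟩ ⟨e', b'⟩ h
  have h1 := arcNum_div (e, b)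
  rw [h, arcNum_div] at h1
  have h2 := arcNum_mod (e, b)
  rw [h, arcNum_mod] at h2
  obtain rfl := NetEdge.num_injective hn h1
  cases b <;> cases b' <;> simp at h2 ⊢

theorem exists_arcNum_eq (hn : 1 ≤ n) {i : ℕ} (hi : i < 2 * ((k + 2) * k ^ (n - 1))) :
    ∃ a : NetEdge k n × Bool, arcNum a = i := by
  obtain ⟨e, he⟩ := NetEdge.exists_num_eq (k := k) hn (i := i / 2) (by omega)
  rcases Nat.mod_two_eq_zero_or_one i with h | h
  · exact ⟨(e, false), by simp [arcNum, he]; omega⟩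
  · exact ⟨(e, true), by simp [arcNum, he]; omega⟩

theorem arcNum_lt (hn : 1 ≤ n) (a : NetEdge k n × Bool) :
    arcNum a < 2 * ((k + 2) * k ^ (n - 1)) := by
  have := a.1.num_lt hn
  unfold arcNum
  split_ifs <;> omega

/-- The levels and the arcs of a breadth-first search are in memory. -/
def HoldsSearch (lev : NetVertex k n → ℕ) (par : NetVertex k n → NetEdge k n × Bool)
    (s : MState) : Prop :=
  (∀ x, s.arr 6 x.num = lev x) ∧ ∀ x, x ≠ .source → lev x ≠ 0 → s.arr 7 x.num = arcNum (par x)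

theorem _root_.HoldsNetwork.of_frame {N : FlowNetwork (NetVertex k n) (NetEdge k n)} {s s' : MState}
    {P : Prog} (h : HoldsNetwork N s) (hF : Frame P s s') (h2 : P.writesVar 2 = false)
    (h3 : P.writesVar 3 = false) (a1 : P.writesArr 1 = false) (a2 : P.writesArr 2 = false)
    (a3 : P.writesArr 3 = false) : HoldsNetwork N s' := by
  refine ⟨(hF.1 2 h2).trans h.1, (hF.1 3 h3).trans h.2.1, fun e => ?_⟩
  rw [hF.2 1 a1, hF.2 2 a2, hF.2 3 a3]
  exact h.2.2 e

theorem _root_.HoldsFlow.of_frame {f : NetEdge k n → ℕ} {s s' : MState} {P : Prog} (h : HoldsFlow f s)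
    (hF : Frame P s s') (a4 : P.writesArr 4 = false) : HoldsFlow f s' := by
  intro e
  rw [hF.2 4 a4]
  exact h e

open Classical in
theorem runs_scanArc {m : ℕ} (hm : 2 ≤ m) {s : MState} {f : NetEdge k n → ℕ}
    (hN : HoldsNetwork (distNetwork k n v) s) (hf : HoldsFlow f s)
    {lev : NetVertex k n → ℕ} {par : NetVertex k n → NetEdge k n × Bool}
    (hs : HoldsSearch lev par s) {A : Set (NetEdge k n × Bool)}
    (hp : (distNetwork k n v).IsPartial f (s.var 16 + 1) A lev par) {a : NetEdge k n × Bool}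
    (ha : s.var 11 = arcNum a) (hd : s.var 16 + 2 ≤ m) :
    Runs m scanArc s 60 fun s' => ∃ lev' par', HoldsSearch lev' par' s' ∧
      (distNetwork k n v).IsPartial f (s.var 16 + 1) (insert a A) lev' par' := by
  set N := distNetwork k n v with hNdef
  obtain ⟨h1, h2, h3⟩ := hN.2.2 a.1
  have h4 := hf a.1
  have hdiv : s.var 11 / 2 = a.1.num := by rw [ha, arcNum_div]
  have hmod : s.var 11 % 2 = if a.2 then 1 else 0 := by rw [ha, arcNum_mod]
  -- the state before the tests
  set P : Prog := .seq (.assign 12 (.var 11 / .lit 2)) (.ite (.var 11 % .lit 2)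
    (.seq (.assign 13 (.get 1 (.var 12))) <| .seq (.assign 14 (.get 2 (.var 12)))
      (.assign 15 (.get 3 (.var 12) - .get 4 (.var 12))))
    (.seq (.assign 13 (.get 2 (.var 12))) <| .seq (.assign 14 (.get 1 (.var 12)))
      (.assign 15 (.get 4 (.var 12))))) with hP
  have hpre : (P.run s).var 13 = (N.arcTail a).num ∧ (P.run s).var 14 = (N.arcHead a).num ∧
      (P.run s).var 15 = N.residual f a ∧ (P.run s).var 16 = s.var 16 ∧
      (P.run s).var 11 = s.var 11 ∧ (P.run s).arr = s.arr := by
    obtain ⟨e, b⟩ := a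
    cases b <;>
    simp [hP, Prog.run, hdiv, hmod, arcTail, arcHead, FlowNetwork.residual, h1, h2, h3, h4]
  obtain ⟨p13, p14, p15, p16, p11, parr⟩ := hpre
  have hrun : scanArc.run s = (Prog.ite (.op .eq (.get 6 (.var 13)) (.var 16 + .lit 1))
      (.ite (.op .lt (.lit 0) (.var 15)) (.ite (.op .eq (.get 6 (.var 14)) (.lit 0))
        (.seq (.store 6 (.var 14) (.var 16 + .lit 2)) (.store 7 (.var 14) (.var 11)))
        .skip) .skip) .skip).run (P.run s) := rfl
  refine Runs.mono (Runs.simple hm rfl fun hle => ?_) (by decide) ?_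
  · have v11 := hle.1 11
    have hd2 : s.var 11 / 2 ≤ m := (Nat.div_le_self _ _).trans v11
    have g := hle.2
    have g' : s.arr 3 (s.var 11 / 2) - s.arr 4 (s.var 11 / 2) ≤ m :=
      (Nat.sub_le _ _).trans (hle.2 _ _)
    simp only [scanArc, Prog.Safe, Prog.run]
    simp [g, g', hd2]
    split_ifs <;> simp [hd, v11]
  · rintro _ _ _ rfl
    rw [hrun]
    simp only [Prog.run, eval_eq, eval_lt, eval_get, eval_var, eval_add, eval_lit, p13, p14, p15,
      p16, p11, parr, hs.1]
    by_cases hc : lev (N.arcTail a) = s.var 16 + 1 ∧ 0 < N.residual f a ∧ lev (N.arcHead a) = 0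
    · refine ⟨_, _, ?_, hp.insert_of (by omega) hc.1 hc.2.1 hc.2.2⟩
      simp only [hc.1, hc.2.1, hc.2.2, if_true, ne_eq, one_ne_zero, not_false_eq_true]
      constructor
      · intro x
        by_cases hx : x = N.arcHead a
        · subst hx; simp
        · have : x.num ≠ (N.arcHead a).num := fun h => hx (NetVertex.num_injective h)
          simp [Function.update_of_ne hx, Function.update_of_ne this, hs.1]
      · intro x hxs hlx
        by_cases hx : x = N.arcHead a
        · subst hx; simp [ha]
        · have : x.num ≠ (N.arcHead a).num := fun h => hx (NetVertex.num_injective h)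
          rw [Function.update_of_ne hx] at hlx
          simp [Function.update_of_ne hx, Function.update_of_ne this, hs.2 x hxs hlx]
    · refine ⟨lev, par, ?_, hp.insert_of_not hc⟩
      have : ∀ s₁ : MState, (if (if lev (N.arcTail a) = s.var 16 + 1 then 1 else 0) ≠ 0 then
          if (if 0 < N.residual f a then 1 else 0) ≠ 0 then
            if (if lev (N.arcHead a) = 0 then 1 else 0) ≠ 0 then s₁ else P.run s
          else P.run s else P.run s) = P.run s := by
        intro s₁
        split_ifs <;> simp_all
      rw [this]
      unfold HoldsSearch
      rw [parr]
      exact hs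

end Round

end Machine

/-! ### Correctness and cost of the search and of a full round. -/

namespace Machine

open Expr Prog FlowNetwork

section Round

variable {k n : ℕ} {v : ZMod (k ^ n) → Fin k}

open Classical in
-- There is no queue: for each of `|V|` levels all `2 * |E|` arcs are scanned. This costs `O(|V|
-- |E|)`, which is enough for the final bound.
theorem runs_search (hk : 1 ≤ k) (hn : 1 ≤ n) {m : ℕ} (hm : 16 * (k + 1) ^ n ≤ m) {s : MState}
    {f : NetEdge k n → ℕ} (hN : HoldsNetwork (distNetwork k n v) s) (hf : HoldsFlow f s) :
    Runs m search s (200 * (Nat.card (NetVertex k n) * Nat.card (NetEdge k n))) fun s' =>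
      ∃ lev par, HoldsSearch lev par s' ∧ (distNetwork k n v).IsLevels f lev par := by
  set N := distNetwork k n v with hNdef
  have hK : k ^ n ≤ (k + 1) ^ n := Nat.pow_le_pow_left (by omega) n
  have hM : k ^ (n - 1) ≤ k ^ n := Nat.pow_le_pow_right hk (by omega)
  have hM0 : 0 < k ^ (n - 1) := Nat.pow_pos hk
  have hMN := pow_pred_mul (k := k) hn
  have hV := card_netVertex (k := k) (n := n)
  have hE := card_netEdge (k := k) (n := n)
  have hE' : (k + 2) * k ^ (n - 1) = k ^ (n - 1) + k ^ n + k ^ (n - 1) := by rw [← hMN]; ring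
  set nV := Nat.card (NetVertex k n)
  set nE := Nat.card (NetEdge k n)
  have hm2 : 2 ≤ m := by omega
  have hcard : Fintype.card (NetVertex k n) = nV := Nat.card_eq_fintype_card.symm
  have hclear : Runs m (.for 8 (.var 2) (.store 6 (.var 8) (.lit 0))) s (11 * nV + 6) fun s' =>
      ∀ i < nV, s'.arr 6 i = 0 := by
    refine Runs.for hm2 nV _ (fun _ => 3) (by decide) rfl (by omega)
      (fun j s' => ∀ i < j, s'.arr 6 i = 0) (by intro i hi; omega) ?_ ?_ (fun s' _ _ h => h) ?_
    · intro j _ s' hF _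
      exact (hF.1 2 rfl).trans hN.1
    · intro j hj s' hs' hF hI hij
      refine Runs.mono (Runs.simple hm2 rfl fun _ => Nat.zero_le _) (by decide) ?_
      rintro _ _ _ rfl i hi
      simp only [Prog.run, MState.set_arr, eval_var, hij, Function.update_self, eval_lit]
      rcases eq_or_ne i j with rfl | hne
      · simp
      · rw [Function.update_of_ne hne]
        exact hI i (by omega)
    · rw [Finset.sum_const, Finset.card_range, smul_eq_mul, show (Expr.var 2).cost = 1 from rfl]
      omega
  have hphase : ∀ s : MState, HoldsNetwork N s → HoldsFlow f s → s.var 16 + 2 ≤ m →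
      (∃ lev par, HoldsSearch lev par s ∧ N.IsPartial f (s.var 16 + 1) ∅ lev par) →
      Runs m (.for 11 (.lit 2 * .var 3) scanArc) s (140 * nE + 8) fun s' =>
        ∃ lev par, HoldsSearch lev par s' ∧ N.IsPartial f (s.var 16 + 1 + 1) ∅ lev par := by
    intro s hN hf hd h0
    refine Runs.for hm2 (2 * nE) _ (fun _ => 60) (by decide) rfl (by omega)
      (fun j s' => ∃ lev par, HoldsSearch lev par s' ∧
        N.IsPartial f (s.var 16 + 1) {a | arcNum a < j} lev par) ?_ ?_ ?_ ?_ ?_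
    · simpa [HoldsSearch] using h0
    · intro j _ s' hF _
      have h3 : s'.var 3 = s.var 3 := hF.1 3 rfl
      simp [h3, hN.2.1, nE]
    · rintro j hj s' hs' hF ⟨lev, par, hsr, hpt⟩ hij
      obtain ⟨a, ha⟩ := exists_arcNum_eq (k := k) hn (i := j) (by omega)
      have h16 : s'.var 16 = s.var 16 := hF.1 16 rfl
      have hins : insert a {a | arcNum a < j} =
          {a : NetEdge k n × Bool | arcNum a < j + 1} := by
        ext b
        simp only [Set.mem_insert_iff, Set.mem_ofPred_eq, Nat.lt_succ_iff_lt_or_eq, ← ha,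
          (arcNum_injective hn).eq_iff]
        exact or_comm
      refine Runs.mono (runs_scanArc hm2 (hN.of_frame hF rfl rfl rfl rfl rfl)
        (hf.of_frame hF rfl) hsr (h16 ▸ hpt) (a := a) (by rw [hij, ha]) (h16 ▸ hd)) le_rfl ?_
      rintro s'' _ _ ⟨lev', par', h1, h2⟩
      exact ⟨lev', par', h1, by rw [← hins, ← h16]; exact h2⟩
    · rintro s' _ _ ⟨lev, par, h1, h2⟩
      exact ⟨lev, par, h1, h2.next fun a => by rw [Set.mem_ofPred_eq, hE]; exact arcNum_lt hn a⟩
    · rw [Finset.sum_const, Finset.card_range, smul_eq_mul,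
        show (Expr.lit 2 * Expr.var 3).cost = 3 from rfl]
      omega
  refine Runs.mono (Runs.seq hclear (T' := 3 + (nV * (140 * nE + 16) + 6)) (Q' := fun s' =>
    ∃ lev par, HoldsSearch lev par s' ∧ N.IsLevels f lev par) ?_) ?_ (fun _ _ _ h => h)
  · intro s₁ _ hF₁ hz
    refine Runs.seq (Runs.mono (Runs.simple hm2 rfl fun _ => ?_) (by decide : _ ≤ 3)
      (fun _ _ _ h => h)) ?_
    · simp [Prog.Safe]; omega
    · intro s₂ _ hF₂ hs₂
      have hN₂ : HoldsNetwork N s₂ := (hN.of_frame hF₁ rfl rfl rfl rfl rfl).of_frame hF₂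
        rfl rfl rfl rfl rfl
      have hf₂ : HoldsFlow f s₂ := (hf.of_frame hF₁ rfl).of_frame hF₂ rfl
      refine Runs.for hm2 nV _ (fun _ => 140 * nE + 8) (by decide) rfl (by omega)
        (fun j s' => ∃ lev par, HoldsSearch lev par s' ∧ N.IsPartial f (j + 1) ∅ lev par)
        ?_ ?_ ?_ ?_ ?_
      · refine ⟨_, fun _ => (.fromSource fun _ => ⟨0, hk⟩, true), ⟨?_, ?_⟩, N.isPartial_init f _⟩
        · intro x
          rw [MState.set_arr, hs₂]
          simp only [Prog.run, eval_lit, Function.update_self]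
          by_cases hx : x = .source
          · subst hx
            simp [NetVertex.num, hNdef, distNetwork]
          · have h0 : x.num ≠ 0 := fun h => hx (NetVertex.num_injective h)
            rw [Function.update_of_ne h0, hz _ (hV ▸ x.num_lt)]
            simp [hNdef, distNetwork, hx]
        · intro x hx hlx
          simp [hNdef, distNetwork, hx] at hlx
      · intro j _ s' hF _
        exact (hF.1 2 rfl).trans hN₂.1
      · intro j hj s' hs' hF hI hij
        have := hphase s' (hN₂.of_frame hF rfl rfl rfl rfl rfl) (hf₂.of_frame hF rfl)
          (by rw [hij]; omega) (by rw [hij]; exact hI)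
        rw [hij] at this
        exact this
      · rintro s' _ _ ⟨lev, par, h1, h2⟩
        exact ⟨lev, par, h1, h2.isLevels (by omega)⟩
      · rw [Finset.sum_const, Finset.card_range, smul_eq_mul, show (Expr.var 2).cost = 1 from rfl]
  · have h1 : nV ≤ nV * nE := Nat.le_mul_of_pos_right _ (by omega)
    have h2 : nV * (140 * nE + 16) = 140 * (nV * nE) + 16 * nV := by ring
    omega

/-- As the edge has not been touched yet, memory still holds its old flow, and changing that by one
extends the push by one arc. The path is thus treated from its end. -/
theorem runs_pushArc {m : ℕ} (hm : 2 ≤ m) {s : MState} {f : NetEdge k n → ℕ} (hn : 1 ≤ n)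
    (hN : HoldsNetwork (distNetwork k n v) s) {lev : NetVertex k n → ℕ}
    {par : NetVertex k n → NetEdge k n × Bool} (hs : HoldsSearch lev par s)
    (hl : (distNetwork k n v).IsLevels f lev par) {x : NetVertex k n} {d : ℕ} (hd : lev x = d + 2)
    (hx : s.var 15 = x.num) {p : List (NetEdge k n × Bool)} (hp : HoldsFlow (push f p) s)
    (hnp : (par x).1 ∉ p.map Prod.fst) (hf : ∀ e, f e ≤ 1) :
    Runs m pushArc s 40 fun s' => s'.var 15 = ((distNetwork k n v).arcTail (par x)).num ∧
      HoldsFlow (push f (par x :: p)) s' := by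
  classical
  have hxs : x ≠ .source := hl.ne_source hd
  have h7 := hs.2 x hxs (by omega)
  have hdiv := arcNum_div (par x)
  have hmod := arcNum_mod (par x)
  obtain ⟨h1, h2, -⟩ := hN.2.2 (par x).1
  have h4 := hp (par x).1
  rw [push_of_not_mem hnp] at h4
  have hf1 := hf (par x).1
  have hupd : ∀ c, HoldsFlow (Function.update (push f p) (par x).1 c)
      ⟨s.var, Function.update s.arr 4 (Function.update (s.arr 4) (par x).1.num c)⟩ := by
    intro c e
    by_cases he : e = (par x).1
    · subst he; simp
    · have : e.num ≠ (par x).1.num := fun h => he (NetEdge.num_injective hn h)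
      simp [Function.update_of_ne he, Function.update_of_ne this, hp e]
  refine Runs.mono (Runs.simple hm rfl fun hle => ?_) (by decide) ?_
  · have g := hle.2
    have g1 : arcNum (par x) ≤ m := by rw [← h7]; exact g _ _
    have g2 : (par x).1.num ≤ m := by rw [← hdiv]; exact (Nat.div_le_self _ _).trans g1
    simp only [pushArc, Prog.Safe, Prog.run]
    simp [hx, h7, hdiv, hmod, h4, g1, g2, g]
    omega
  · rintro _ _ _ rfl
    rw [push_cons hnp]
    have hrun : pushArc.run s = if (par x).2 then
        ⟨Function.update (Function.update (Function.update s.var 11 (arcNum (par x))) 12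
          (par x).1.num) 15 (s.arr 1 (par x).1.num),
          Function.update s.arr 4 (Function.update (s.arr 4) (par x).1.num (f (par x).1 + 1))⟩
        else ⟨Function.update (Function.update (Function.update s.var 11 (arcNum (par x))) 12
          (par x).1.num) 15 (s.arr 2 (par x).1.num),
          Function.update s.arr 4 (Function.update (s.arr 4) (par x).1.num (f (par x).1 - 1))⟩ := by
      simp [pushArc, Prog.run, hx, h7, hdiv, hmod, h4]
    rw [hrun]
    by_cases hb : (par x).2
    · rw [if_pos hb, if_pos hb]
      exact ⟨by simp [arcTail, hb, h1], hupd _⟩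
    · rw [if_neg hb, if_neg hb]
      exact ⟨by simp [arcTail, hb, h2], hupd _⟩

theorem runs_round (hk : 1 ≤ k) (hn : 1 ≤ n) {m : ℕ} (hm : 16 * (k + 1) ^ n ≤ m) {s : MState}
    {f : NetEdge k n → ℕ} (hN : HoldsNetwork (distNetwork k n v) s) (hf : HoldsFlow f s)
    (hf1 : ∀ e, f e ≤ 1) :
    Runs m round s (300 * (Nat.card (NetVertex k n) * Nat.card (NetEdge k n))) fun s' =>
      (∃ p, (distNetwork k n v).IsShortestAugmenting f p ∧ (p.map Prod.fst).Nodup ∧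
        HoldsFlow (push f p) s' ∧ s'.var 4 = s.var 4) ∨
      ((∀ p, ¬ (distNetwork k n v).IsAugmenting f p) ∧ HoldsFlow f s' ∧ s'.var 4 = 0) := by
  have hsearch := runs_search hk hn hm hN hf
  set N := distNetwork k n v with hNdef
  have hM0 : 0 < k ^ (n - 1) := Nat.pow_pos hk
  have hV := card_netVertex (k := k) (n := n)
  have hE := card_netEdge (k := k) (n := n)
  have hE1 : 0 < Nat.card (NetEdge k n) := by rw [hE]; positivity
  have hKp : 0 < (k + 1) ^ n := by positivity
  set nV := Nat.card (NetVertex k n)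
  set nE := Nat.card (NetEdge k n)
  have hm2 : 2 ≤ m := by omega
  have hprod : nV ≤ nV * nE := Nat.le_mul_of_pos_right _ hE1
  refine Runs.mono (Runs.seq hsearch (T' := 3 + (2 + (42 * nV + 2) + 2))
    (Q' := fun s' => (∃ p, N.IsShortestAugmenting f p ∧ (p.map Prod.fst).Nodup ∧
        HoldsFlow (push f p) s' ∧ s'.var 4 = s.var 4) ∨
      ((∀ p, ¬ N.IsAugmenting f p) ∧ HoldsFlow f s' ∧ s'.var 4 = 0)) ?_)
    (by omega) (fun _ _ _ h => h)
  rintro s₁ _ hF₁ ⟨lev, par, hs, hl⟩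
  have hN₁ : HoldsNetwork N s₁ := hN.of_frame hF₁ rfl rfl rfl rfl rfl
  have hf₁ : HoldsFlow f s₁ := hf.of_frame hF₁ rfl
  have h4₁ : s₁.var 4 = s.var 4 := hF₁.1 4 rfl
  have hsink : s₁.arr 6 1 = lev N.sink := hs.1 .sink
  refine Runs.ite hm2 (by decide) ?_ ?_
  · intro hne
    simp only [eval_get, eval_lit, hsink] at hne
    obtain ⟨d, hd⟩ := Nat.exists_eq_succ_of_ne_zero hne
    have hdV : d + 1 ≤ nV := by
      -- A complete search is also a partial one, for any `d` above all levels, so the bound by the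
      -- number of vertices applies to it.
      have hle : lev N.sink ≤ Fintype.card (NetVertex k n) :=
        IsPartial.lev_le_card (N := N) (f := f) (d := lev N.sink + Finset.univ.sup lev)
          (A := Set.univ) (par := par) ⟨hl.source, hl.par, fun x => by
            have := Finset.le_sup (f := lev) (Finset.mem_univ x)
            omega, fun a h1 h2 _ => hl.relax a h1 h2⟩ _
      rw [← Nat.card_eq_fintype_card, hd] at hle
      exact hle
    refine Runs.mono (Runs.seq (Runs.simple hm2 rfl fun _ => ?_) (T' := 42 * d + 2)
      (Q' := fun s' => HoldsFlow (push f (N.backPath par d N.sink)) s' ∧ s'.var 4 = s.var 4) ?_)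
      ?_ ?_
    · simp [Prog.Safe]; omega
    · rintro s₂ _ hF₂ hs₂
      have hN₂ : HoldsNetwork N s₂ := hN₁.of_frame hF₂ rfl rfl rfl rfl rfl
      have hsr₂ : HoldsSearch lev par s₂ := by
        unfold HoldsSearch
        rw [hF₂.2 6 rfl, hF₂.2 7 rfl]
        exact hs
      refine Runs.mono (Runs.loop hm2 (by decide) d (fun _ => 40)
        (Q := fun s' => HoldsFlow (push f (N.backPath par d N.sink)) s')
        -- After `j` rounds the last `j` arcs `p` of the path have been pushed, and `x` is the
        -- vertex where they start.
        (fun j s' => ∃ x p, lev x = d - j + 1 ∧ s'.var 15 = x.num ∧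
          N.backPath par d N.sink = N.backPath par (d - j) x ++ p ∧ HoldsFlow (push f p) s')
        ?_ ?_ ?_) ?_ ?_
      · refine ⟨N.sink, [], hd, ?_, by simp, ?_⟩
        · rw [hs₂]
          rfl
        · rw [push_nil]
          exact hf₁.of_frame hF₂ rfl
      · rintro j hj s' hs' hF ⟨x, p, hx, h15, hpath, hp⟩
        obtain ⟨i, hi⟩ := Nat.exists_eq_succ_of_ne_zero (by omega : d - j ≠ 0)
        have hi' : d - (j + 1) = i := by omega
        rw [hi] at hx hpath
        have hsr : HoldsSearch lev par s' := by
          unfold HoldsSearch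
          rw [hF.2 6 rfl, hF.2 7 rfl]
          exact hsr₂
        have hnd := hl.nodup_backPath d N.sink hd
        rw [hpath, List.map_append, List.nodup_append] at hnd
        have hnp : (par x).1 ∉ p.map Prod.fst := fun hmem =>
          hnd.2.2 (par x).1 (by simp [backPath]) _ hmem rfl
        refine ⟨?_, ?_⟩
        -- The source has number `0`, so the vertex register itself serves as the loop test.
        · rw [eval_var, h15]
          intro h0
          exact hl.ne_source hx (NetVertex.num_injective (h0.trans rfl))
        · refine Runs.mono (runs_pushArc hm2 hn (hN₂.of_frame hF rfl rfl rfl rfl rfl) hsr hl hx h15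
            hp hnp hf1) le_rfl ?_
          rintro s'' _ _ ⟨h1, h2⟩
          refine ⟨N.arcTail (par x), par x :: p, ?_, h1, ?_, h2⟩
          · have := (hl.par x (hl.ne_source hx) (by omega)).2.2.1
            omega
          · rw [hpath, hi']
            simp [backPath]
      · rintro s' _ _ ⟨x, p, hx, h15, hpath, hp⟩
        rw [Nat.sub_self] at hx hpath
        have hxs : x = .source := by
          by_contra hne
          have := (hl.par x hne (by omega)).2
          omega
        refine ⟨by rw [eval_var, h15, hxs]; rfl, ?_⟩
        rw [hpath]
        exact hp
      · rw [Finset.sum_const, Finset.card_range, smul_eq_mul, show (Expr.var 15).cost = 1 from rfl]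
        omega
      · intro s' _ hF h
        exact ⟨h, (hF.1 4 rfl).trans ((hF₂.1 4 rfl).trans h4₁)⟩
    · exact Nat.add_le_add_left (by omega : 42 * d + 2 ≤ 42 * nV + 2) 2
    · rintro s' _ _ ⟨h1, h2⟩
      exact .inl ⟨_, hl.isShortestAugmenting hd, hl.nodup_backPath d _ hd, h1, h2⟩
  · intro h0
    simp only [eval_get, eval_lit, hsink] at h0
    refine Runs.mono (Runs.simple hm2 rfl fun _ => Nat.zero_le _) (by decide) ?_
    rintro _ _ hF rfl
    exact .inr ⟨hl.not_isAugmenting h0, hf₁.of_frame hF rfl, by simp [Prog.run]⟩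

end Round

end Machine

/-! ### The Edmonds–Karp method -/

namespace Machine

open Expr Prog FlowNetwork

theorem _root_.EKExec.exec {B k n : ℕ} {N : FlowNetwork (NetVertex k n) (NetEdge k n)} {P : Prog}
    {s s' : MState} {f f' : NetEdge k n → ℕ} {t : ℕ} (h : EKExec B N P s f s' f' t) :
    Exec B (ekLoop P) s s' t := by
  induction h with
  | done _ he h _ => exact .loopDone he h
  | next _ he h hP _ _ ih => exact .loopNext he h hP ih

theorem _root_.EKExec.mono {B B' k n : ℕ} (hB : B ≤ B')
    {N : FlowNetwork (NetVertex k n) (NetEdge k n)} {P : Prog}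
    {s s' : MState} {f f' : NetEdge k n → ℕ} {t : ℕ} (h : EKExec B N P s f s' f' t) :
    EKExec B' N P s f s' f' t := by
  induction h with
  | done hs he h hf => exact .done hs (he.mono hB) h hf
  | next hs he h hP hf _ ih => exact .next hs (he.mono hB) h (hP.mono hB) hf ih

/-- Here `d` is the amount by which the value of the flow falls short of `k ^ (n - 1)`. Every
augmentation lowers it by one, so there are at most `d` of them, and one more round to discover that
no path is left. -/
theorem exists_ekExec {k n : ℕ} {v : ZMod (k ^ n) → Fin k} (hk : 1 ≤ k) (hn : 1 ≤ n) {m : ℕ}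
    (hm : 16 * (k + 1) ^ n ≤ m) : ∀ (d : ℕ) (s : MState) (f : NetEdge k n → ℕ), s.Le m →
      HasParams v s → HoldsNetwork (distNetwork k n v) s → HoldsFlow f s → IsUnitFlow v f →
      s.var 4 ≠ 0 → ∑ u, f (.fromSource u) + d = k ^ (n - 1) →
      ∃ s' f' t, EKExec (m ^ 20) (distNetwork k n v) round s f s' f' t ∧
        t ≤ (d + 1) * (300 * (Nat.card (NetVertex k n) * Nat.card (NetEdge k n)) + 2) + 2 ∧
        s'.Le m ∧ HasParams v s' ∧ HoldsFlow f' s' ∧ IsUnitFlow v f' ∧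
        ∀ p, ¬ (distNetwork k n v).IsAugmenting f' p := by
  classical
  intro d
  have hKp : 0 < (k + 1) ^ n := by positivity
  have fit : ∀ s : MState, s.Le m → (Expr.var 4).Fits (m ^ 20) s := fun s hs =>
    Expr.fits (by omega) hs _ (Nat.pow_le_pow_right (by omega) (by decide))
  have hcost : (Expr.var 4).cost = 1 := rfl
  have hcap : ∀ e, (distNetwork k n v).cap e = 1 := fun _ => rfl
  induction d with
  | zero =>
    intro s f hs hp hN hf hu h4 hd
    obtain ⟨s₁, t₁, hE, ht, hle, ⟨p, hsh, hnd, -, -⟩ | ⟨hmax, hf', h4'⟩⟩ :=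
      runs_round hk hn hm hN hf hu.le_one hs
    · exfalso
      -- The source edges already carry all they can, and an augmentation would raise their total by
      -- one.
      have h1 := excess_push (distNetwork k n v) hsh.1.1 hnd hsh.1.2 .source
      rw [excess_source, excess_source] at h1
      have h2 : ∑ u : Fin (n - 1) → Fin k, push f p (.fromSource u) ≤
          ∑ _u : Fin (n - 1) → Fin k, 1 :=
        Finset.sum_le_sum fun u _ => push_le_one _ hcap hu.le_one hsh.1.2 _
      simp only [Finset.sum_const, Finset.card_univ, Fintype.card_fun, Fintype.card_fin,
        smul_eq_mul, mul_one] at h2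
      have h3 : ((∑ u, push f p (.fromSource u) : ℕ) : ℤ) = (∑ u, f (.fromSource u) : ℕ) + 1 := by
        push_cast
        simp [distNetwork] at h1
        linarith
      omega
    · refine ⟨s₁, f, _, .next hf (fit s hs) h4 hE (.inr ⟨hmax, rfl⟩)
        (.done hf' (fit s₁ hle) h4' hmax), ?_, hle,
        hp.of_frame v hE.frame rfl rfl rfl rfl rfl rfl rfl, hf', hu, hmax⟩
      omega
  | succ d ih =>
    intro s f hs hp hN hf hu h4 hd
    obtain ⟨s₁, t₁, hE, ht, hle, ⟨p, hsh, hnd, hf', h4'⟩ | ⟨hmax, hf', h4'⟩⟩ :=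
      runs_round hk hn hm hN hf hu.le_one hs
    · have hexc := excess_push (distNetwork k n v) hsh.1.1 hnd hsh.1.2
      have h3 : ((∑ u, push f p (.fromSource u) : ℕ) : ℤ) = (∑ u, f (.fromSource u) : ℕ) + 1 := by
        have h1 := hexc .source
        rw [excess_source, excess_source] at h1
        push_cast
        simp [distNetwork] at h1
        linarith
      have hu' : IsUnitFlow v (push f p) :=
        ⟨push_le_one _ hcap hu.le_one hsh.1.2, fun x hx hx' => by
          rw [hexc, hu.excess x hx hx']
          simp [distNetwork, hx.symm, hx'.symm]⟩
      have hne : p ≠ [] := by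
        rintro rfl
        have h := hsh.1.1
        simp [IsWalk, distNetwork] at h
      obtain ⟨s₂, f₂, t₂, hEK, ht₂, hle₂, hp₂, hf₂, hu₂, hmax⟩ := ih s₁ (push f p) hle
        (hp.of_frame v hE.frame rfl rfl rfl rfl rfl rfl rfl)
        (hN.of_frame hE.frame rfl rfl rfl rfl rfl) hf' hu' (h4' ▸ h4) (by omega)
      refine ⟨s₂, f₂, _, .next hf (fit s hs) h4 hE
        (.inl ⟨p, hsh, (augment_eq_push _ hcap hu.le_one hsh.1.2 hne).symm⟩) hEK, ?_, hle₂, hp₂,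
        hf₂, hu₂, hmax⟩
      rw [add_mul (d + 1) 1]
      omega
    · refine ⟨s₁, f, _, .next hf (fit s hs) h4 hE (.inr ⟨hmax, rfl⟩)
        (.done hf' (fit s₁ hle) h4' hmax), ?_, hle,
        hp.of_frame v hE.frame rfl rfl rfl rfl rfl rfl rfl, hf', hu, hmax⟩
      rw [add_mul (d + 1) 1]
      omega

/-! ### The insertion of the petals -/

/-- Register `24` becomes `1` if the word whose number is in register `22` is `IsTop`, and `0`
otherwise. -/
def testTop : Prog :=
  .seq (.seq (.assign 26 (.var 0 * .var 18 + .var 22)) <|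
    .seq (.assign 23 (.var 26)) (.assign 24 (.lit 1))) <|
  .for 8 (.var 1) <|
    .seq (.assign 23 (.var 23 % .var 18 * .var 17 + .var 23 / .var 18))
      (.ite (.op .lt (.var 26) (.var 23)) (.assign 24 (.lit 0)) .skip)

/-- Append the symbol in register `21` to the result. -/
def emit : Prog := .seq (.store 5 (.var 19) (.var 21)) (.assign 19 (.var 19 + .lit 1))

/-- Go from an edge of a petal, whose number is in register `20`, to the next edge. -/
def petalStep : Prog :=
  .seq (.seq (.assign 21 (.var 20 / .var 18)) (.assign 22 (.var 20 % .var 18))) <|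
  .seq testTop <|
  .seq (.ite (.var 24)
    (.ite (.op .eq (.var 21) (.lit 0)) (.assign 21 (.var 0))
      (.ite (.op .eq (.var 21) (.var 0)) (.assign 21 (.lit 0)) .skip)) .skip) <|
  .seq (.assign 20 (.var 22 * .var 17 + .var 21)) emit

/-- Append the petal of the head of the edge whose number is in register `7`. -/
def petal : Prog :=
  .seq (headNum 17) <|
  .seq (.seq (.assign 25 (.var 0 * .var 18 + .var 9)) <|
    .seq (.assign 20 (.var 9 * .var 17 + .var 0)) <|
    .seq (.assign 21 (.var 0)) emit) <|
  .loop (.lit 1 - .op .eq (.var 20) (.var 25)) petalStep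

/-- The program that stores the extended sequence in memory. -/
def finish : Prog :=
  .seq (.seq (.assign 17 (.var 0 + .lit 1)) <| .seq (.assign 18 (.lit 1)) (.assign 19 (.lit 0))) <|
  .seq (.for 8 (.var 1 - .lit 1) (.assign 18 (.var 18 * .var 17))) <|
  .for 7 (.var 6) <|
    .seq (.seq (.assign 21 (.get 0 ((.var 7 + (.var 1 - .lit 1)) % .var 6))) emit) <|
    .ite (.get 4 (.var 5 + .var 7)) petal .skip

section Finish

open Petal

variable {k n : ℕ}

/-- The leading digit is the quotient and the rest the remainder, so words are rotated by arithmetic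
on their numbers. -/
theorem _root_.Petal.val_rotate_one (x : List (Fin (k + 1))) {l : ℕ} (hl : x.length = l + 1) :
    val (x.rotate 1) = val x % (k + 1) ^ l * (k + 1) + val x / (k + 1) ^ l := by
  cases x with
  | nil => simp at hl
  | cons a y =>
    obtain rfl : y.length = l := by simpa using hl
    have h1 := val_lt y
    rw [List.rotate_cons_succ, List.rotate_zero, val_concat, val_cons, Nat.mul_comm (a : ℕ),
      Nat.mul_add_mod, Nat.mod_eq_of_lt h1, Nat.mul_add_div (by positivity),
      Nat.div_eq_of_lt h1, add_zero]

/-- The registers that hold the parameters of the enlarged alphabet. -/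
structure HasBase (k n : ℕ) (s : MState) : Prop where
  v0 : s.var 0 = k
  v1 : s.var 1 = n
  v17 : s.var 17 = k + 1
  v18 : s.var 18 = (k + 1) ^ (n - 1)

theorem HasBase.of_frame {s s' : MState} {P : Prog} (h : HasBase k n s) (hF : Frame P s s')
    (h0 : P.writesVar 0 = false) (h1 : P.writesVar 1 = false) (h2 : P.writesVar 17 = false)
    (h3 : P.writesVar 18 = false) : HasBase k n s' :=
  ⟨(hF.1 0 h0).trans h.v0, (hF.1 1 h1).trans h.v1, (hF.1 17 h2).trans h.v17,
    (hF.1 18 h3).trans h.v18⟩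

variable (hk : 1 ≤ k) (hn : 1 ≤ n) {m : ℕ} (hm : 16 * (k + 1) ^ n ≤ m)
include hk hn hm

open Classical in
theorem runs_testTop {s : MState} (hb : HasBase k n s) {y : List (Fin (k + 1))}
    (hy : y.length = n - 1) (h22 : s.var 22 = val y) :
    Runs m testTop s (40 * n + 20) fun s' => s'.var 24 = if Petal.IsTop y then 1 else 0 := by
  have hn' : n < (k + 1) ^ n := Nat.lt_pow_self (by omega)
  have hm2 : 2 ≤ m := by omega
  set x := Fin.last k :: y with hx
  have hxl : x.length = n := by rw [hx, List.length_cons]; omega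
  have hval : ∀ r, val (x.rotate r) < (k + 1) ^ n := by
    intro r
    have := val_lt (x.rotate r)
    rwa [List.length_rotate, hxl] at this
  have hxv : k * (k + 1) ^ (n - 1) + val y = val x := by
    rw [hx, val_cons, hy, Fin.val_last]
  have hx0 := hval 0
  rw [List.rotate_zero] at hx0
  refine Runs.mono (Runs.seq (Runs.simple hm2 rfl fun _ => ?_) (T' := 40 * n + 6)
    (Q' := fun s' => s'.var 24 = if Petal.IsTop y then 1 else 0) ?_) ?_ (fun _ _ _ h => h)
  · simp [Prog.Safe, Prog.run, hb.v0, hb.v18, h22, hxv]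
    omega
  · rintro s₁ _ hF₁ hs₁
    have hb₁ := hb.of_frame hF₁ rfl rfl rfl rfl
    have e26 : s₁.var 26 = val x := by
      rw [hs₁]; simp [Prog.run, hb.v0, hb.v18, h22, hxv]
    have e23 : s₁.var 23 = val x := by
      rw [hs₁]; simp [Prog.run, hb.v0, hb.v18, h22, hxv]
    have e24 : s₁.var 24 = 1 := by rw [hs₁]; simp [Prog.run]
    refine Runs.for hm2 n _ (fun _ => 20) (by decide) rfl (by omega)
      (fun j s' => s'.var 23 = val (x.rotate j) ∧
        s'.var 24 = if ∀ r ≤ j, val (x.rotate r) ≤ val x then 1 else 0) ?_ ?_ ?_ ?_ ?_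
    · simp [MState.set_var, e23, e24]
    · intro j _ s' hF _
      exact (hb₁.of_frame hF rfl rfl rfl rfl).v1
    · rintro j hj s' hs' hF ⟨h23, h24⟩ hij
      have hb' := hb₁.of_frame hF rfl rfl rfl rfl
      have h26 : s'.var 26 = val x := (hF.1 26 rfl).trans e26
      have hstep : val (x.rotate j) % (k + 1) ^ (n - 1) * (k + 1) +
          val (x.rotate j) / (k + 1) ^ (n - 1) = val (x.rotate (j + 1)) := by
        rw [← val_rotate_one (x.rotate j) (by rw [List.length_rotate, hxl]; omega),
          List.rotate_rotate]
      have hlt := hval (j + 1)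
      refine Runs.mono (Runs.simple hm2 rfl fun _ => ?_) (by decide) ?_
      · simp [Prog.Safe, Prog.run, hb'.v17, hb'.v18, h23, hstep]
        omega
      · rintro _ _ _ rfl
        simp only [Prog.run, eval_add, eval_mul, eval_mod, eval_div, eval_var, hb'.v17, hb'.v18,
          h23, hstep]
        by_cases hc : val x < val (x.rotate (j + 1))
        · have : ¬ ∀ r ≤ j + 1, val (x.rotate r) ≤ val x := fun h =>
            absurd (h (j + 1) le_rfl) (not_le.2 hc)
          rw [if_neg this]
          simp [MState.set_var, h26, hc]
        · have : (∀ r ≤ j + 1, val (x.rotate r) ≤ val x) ↔ ∀ r ≤ j, val (x.rotate r) ≤ val x := by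
            constructor
            · exact fun h r hr => h r (by omega)
            · intro h r hr
              rcases Nat.lt_or_ge r (j + 1) with h' | h'
              · exact h r (by omega)
              · obtain rfl : r = j + 1 := by omega
                exact not_lt.1 hc
          simp only [this]
          simp [MState.set_var, h26, hc, h24]
    · rintro s' _ _ ⟨-, h24⟩
      rw [h24]
      -- Rotations repeat with period `n`, so finitely many comparisons decide maximality.
      have : (∀ r ≤ n, val (x.rotate r) ≤ val x) ↔ Petal.IsTop y := by
        constructor
        · intro h r
          rw [← hx, ← List.rotate_mod, hxl]
          exact h _ (Nat.mod_lt _ hn).le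
        · exact fun h r _ => h r
      simp only [this]
    · rw [Finset.sum_const, Finset.card_range, smul_eq_mul, show (Expr.var 1).cost = 1 from rfl]
      omega
  · have : (Prog.seq (.assign 26 (.var 0 * .var 18 + .var 22)) <|
      .seq (.assign 23 (.var 26)) (.assign 24 (.lit 1))).time ≤ 14 := by decide
    omega

omit hk hn hm in
/-- The list `l` is the part of the result that has been written. -/
def Written (l : List (Fin (k + 1))) (s : MState) : Prop :=
  s.var 19 = l.length ∧ ∀ i < l.length, s.arr 5 i = l.getD i 0

omit hk hn hm in
theorem Written.of_frame {l : List (Fin (k + 1))} {s s' : MState} {P : Prog} (h : Written l s)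
    (hF : Frame P s s') (h19 : P.writesVar 19 = false) (h5 : P.writesArr 5 = false) :
    Written l s' := by
  unfold Written
  rw [hF.1 19 h19, hF.2 5 h5]
  exact h

omit hk hn hm in
theorem Written.emit {l : List (Fin (k + 1))} {s : MState} (h : Written l s) {a : Fin (k + 1)}
    (ha : s.var 21 = a) : Written (l ++ [a]) (emit.run s) := by
  refine ⟨by simp [Machine.emit, Prog.run, h.1], fun i hi => ?_⟩
  simp only [List.length_append, List.length_singleton] at hi
  simp only [Machine.emit, Prog.run, eval_var, h.1, ha, Function.update_self]
  rcases Nat.lt_or_ge i l.length with hlt | hge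
  · rw [Function.update_of_ne (by omega), h.2 i hlt, List.getD_append _ _ _ _ hlt]
  · obtain rfl : i = l.length := by omega
    simp

/-- The program never tests whether `y` contains the new symbol: before the last edge of a petal it
always does, since otherwise the edge would be final. So `IsTop` alone decides about the exchange.
-/
theorem runs_petalStep {s : MState} (hb : HasBase k n s) {x : List (Fin (k + 1))}
    (hx : x.length = n) (hmem : Fin.last k ∈ x) (hfin : ¬ Final x) (h20 : s.var 20 = val x)
    {l : List (Fin (k + 1))} (hw : Written l s) (hl : l.length < (k + 1) ^ n) :
    Runs m petalStep s (40 * n + 80) fun s' => s'.var 20 = val (Petal.succ x) ∧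
      Written (l ++ [label (Petal.succ x)]) s' := by
  classical
  have hn' : n < (k + 1) ^ n := Nat.lt_pow_self (by omega)
  have hm2 : 2 ≤ m := by omega
  have hkn : k + 1 ≤ (k + 1) ^ n := Nat.le_self_pow (by omega) _
  obtain ⟨a, y, rfl⟩ : ∃ a y, x = a :: y := by
    cases x with
    | nil => simp at hmem
    | cons a y => exact ⟨a, y, rfl⟩
  have hy : y.length = n - 1 := by
    rw [List.length_cons] at hx
    omega
  have hmy : Fin.last k ∈ y := by
    by_contra h
    have ha : Fin.last k = a := by simpa [h] using hmem
    exact hfin ⟨y, h, by rw [ha]⟩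
  have hyv := val_lt y
  rw [hy] at hyv
  have hyn : (k + 1) ^ (n - 1) ≤ (k + 1) ^ n := Nat.pow_le_pow_right (by omega) (by omega)
  rw [val_cons, hy] at h20
  have hdiv : (a * (k + 1) ^ (n - 1) + val y) / (k + 1) ^ (n - 1) = a := by
    rw [Nat.mul_comm, Nat.mul_add_div (by positivity), Nat.div_eq_of_lt hyv, add_zero]
  have hmod : (a * (k + 1) ^ (n - 1) + val y) % (k + 1) ^ (n - 1) = val y := by
    rw [Nat.mul_comm, Nat.mul_add_mod, Nat.mod_eq_of_lt hyv]
  have hsucc : Petal.succ (a :: y) = y ++ [next y a] := rfl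
  have hsv : val y * (k + 1) + next y a < (k + 1) ^ n := by
    have := val_lt (y ++ [next y a])
    rwa [val_concat, List.length_append, List.length_singleton, hy, Nat.sub_add_cancel hn] at this
  have hnext : ((next y a : Fin (k + 1)) : ℕ) = if Petal.IsTop y then
      (if (a : ℕ) = 0 then k else if (a : ℕ) = k then 0 else a) else a := by
    simp only [next, hmy, true_and]
    split_ifs with h1 h2 h3
    · have : a = 0 := Fin.ext h2
      subst this
      simp
    · have : a = Fin.last k := Fin.ext h3
      subst this
      simp
    · rw [Equiv.swap_apply_of_ne_of_ne]
      · intro h; exact h2 (by simp [h])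
      · intro h; exact h3 (by simp [h])
    · rfl
  have ha := a.2
  refine Runs.mono (Runs.seq (Runs.simple hm2 rfl fun _ => ?_) (T' := 40 * n + 72)
    (Q' := fun s' => s'.var 20 = val (Petal.succ (a :: y)) ∧
      Written (l ++ [label (Petal.succ (a :: y))]) s') ?_) ?_ (fun _ _ _ h => h)
  · simp [Prog.Safe, Prog.run, hb.v18, h20, hdiv, hmod]
    omega
  · rintro s₁ _ hF₁ hs₁
    have hb₁ := hb.of_frame hF₁ rfl rfl rfl rfl
    have e21 : s₁.var 21 = a := by rw [hs₁]; simp [Prog.run, hb.v18, h20, hdiv]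
    have e22 : s₁.var 22 = val y := by rw [hs₁]; simp [Prog.run, hb.v18, h20, hmod]
    refine Runs.mono (Runs.seq (runs_testTop hk hn hm hb₁ hy e22) (T' := 52) ?_) (by omega)
      (fun _ _ _ h => h)
    intro s₂ _ hF₂ h24
    have hb₂ := hb₁.of_frame hF₂ rfl rfl rfl rfl
    have e21' : s₂.var 21 = a := (hF₂.1 21 rfl).trans e21
    have e22' : s₂.var 22 = val y := (hF₂.1 22 rfl).trans e22
    have hw₂ : Written l s₂ := (hw.of_frame hF₁ rfl rfl).of_frame hF₂ rfl rfl
    refine Runs.mono (Runs.seq (Runs.mono (Runs.simple hm2 rfl fun _ => ?_)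
      (by decide : _ ≤ 30) (fun _ _ _ h => h)) (T' := 22) ?_) (by omega) (fun _ _ _ h => h)
    · simp [Prog.Safe, hb₂.v0]
      omega
    · rintro s₃ _ hF₃ hs₃
      have hb₃ := hb₂.of_frame hF₃ rfl rfl rfl rfl
      have hw₃ := hw₂.of_frame hF₃ rfl rfl
      have e22'' : s₃.var 22 = val y := (hF₃.1 22 rfl).trans e22'
      have e21'' : s₃.var 21 = next y a := by
        rw [hs₃, hnext]
        simp only [Prog.run, eval_var, eval_eq, eval_lit, h24, e21', hb₂.v0]
        split_ifs <;> simp_all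
      refine Runs.mono (Runs.simple hm2 rfl fun _ => ?_) (by decide) ?_
      · simp [Prog.Safe, Prog.run, Machine.emit, hb₃.v17, e22'', e21'', hw₃.1]
        omega
      · rintro _ _ _ rfl
        rw [hsucc, label_concat, val_concat]
        constructor
        · simp [Prog.run, Machine.emit, hb₃.v17, e22'', e21'']
        · refine Written.emit (s := Prog.run (.assign 20 (.var 22 * .var 17 + .var 21)) s₃) ?_ ?_
          · exact ⟨by simp [Prog.run, hw₃.1], hw₃.2⟩
          · simp [Prog.run, e21'']
  · have : (Prog.seq (.assign 21 (.var 20 / .var 18)) (.assign 22 (.var 20 % .var 18))).time ≤ 8 := by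
      decide
    omega

end Finish

end Machine

/-! ### Writing out one petal and the whole sequence. -/

namespace Machine

open Expr Prog FlowNetwork Petal Extension

theorem run_seq (P Q : Prog) (s : MState) : (Prog.seq P Q).run s = Q.run (P.run s) := rfl

section Finish

variable {k n : ℕ} {v : ZMod (k ^ n) → Fin k} (hk : 1 ≤ k) (hn : 1 ≤ n) {m : ℕ}
  (hm : 16 * (k + 1) ^ n ≤ m)
include hk hn hm

/-- The loop stops at the number of `s u`. Numbers determine words of equal length, and `s u` does
not occur earlier in the petal, so exactly `len u` steps are made, each in `O(n)` operations. -/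
theorem runs_petal {s : MState} (hb : HasBase k n s) (h6 : s.var 6 = k ^ n)
    (h0 : s.arr 0 = (inputState k n v).arr 0) {i : ℕ} (h7 : s.var 7 = i)
    {l : List (Fin (k + 1))} (hw : Written l s)
    (hl : l.length + (labels (head k n v i)).length ≤ (k + 1) ^ n) :
    Runs m petal s (130 * (n * (labels (head k n v i)).length))
      (Written (l ++ labels (head k n v i))) := by
  have hn' : n < (k + 1) ^ n := Nat.lt_pow_self (by omega)
  have hm2 : 2 ≤ m := by omega
  have hkn : k + 1 ≤ (k + 1) ^ n := Nat.le_self_pow (by omega) _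
  set u := head k n v i with hu
  have hul : u.length = n - 1 := length_head k n v i
  have hmem : Fin.last k ∉ u := last_not_mem_head k n v i
  have hll : (labels u).length = len u + 1 := by simp [labels, words]
  have hlabels : labels u = (List.range (len u + 1)).map fun j => label (word u j) := by
    simp [labels, words]
  have hwl : ∀ j, (word u j).length = n := fun j => by rw [length_word]; omega
  have hyn : (k + 1) ^ (n - 1) ≤ (k + 1) ^ n := Nat.pow_le_pow_right (by omega) (by omega)
  have hval : horner (k + 1) (fun t => (inputState k n v).arr 0 ((i + 1 + t) % k ^ n)) (n - 1) =
      val u := by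
    rw [hu, head_eq]
    refine (val_map_range _ _ fun t => ?_).symm
    rw [input_mod v hk]
    rfl
  have hhead := runs_headNum hm2 (b := 17) (by decide) (by decide) (s := s)
    (fun t => by rw [h0, hb.v17]; exact (input_lt v hk t).trans (Nat.lt_succ_self k))
    (by rw [hb.v17, hb.v1]; omega)
  rw [h0, hb.v17, hb.v1, h6, h7, hval] at hhead
  refine Runs.mono (Runs.seq hhead (T' := 24 + (len u * (40 * n + 86) + 6))
    (Q' := Written (l ++ labels u)) ?_) ?_ (fun _ _ _ h => h)
  · intro s₁ _ hF₁ h9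
    have hb₁ := hb.of_frame hF₁ rfl rfl rfl rfl
    have hw₁ := hw.of_frame hF₁ rfl rfl
    have htop : k * (k + 1) ^ (n - 1) + val u = val (Fin.last k :: u) := by
      rw [val_cons, hul, Fin.val_last]
    have hfirst : val u * (k + 1) + k = val (u ++ [Fin.last k]) := by
      rw [val_concat, Fin.val_last]
    have hlt1 := val_lt (Fin.last k :: u)
    have hlt2 := val_lt (u ++ [Fin.last k])
    rw [List.length_cons, hul, Nat.sub_add_cancel hn] at hlt1
    rw [List.length_append, List.length_singleton, hul, Nat.sub_add_cancel hn] at hlt2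
    refine Runs.seq (Runs.mono (Runs.simple hm2 rfl fun _ => ?_) (by decide : _ ≤ 24)
      (fun _ _ _ h => h)) ?_
    · simp [Prog.Safe, Prog.run, Machine.emit, hb₁.v0, hb₁.v17, hb₁.v18, h9, htop, hfirst, hw₁.1]
      omega
    · intro s₂ _ hF₂ hs₂
      have hb₂ := hb₁.of_frame hF₂ rfl rfl rfl rfl
      have e25 : s₂.var 25 = val (Fin.last k :: u) := by
        rw [hs₂]
        simp [Prog.run, Machine.emit, hb₁.v0, hb₁.v18, h9, htop]
      have e20 : s₂.var 20 = val (u ++ [Fin.last k]) := by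
        rw [hs₂]
        simp [Prog.run, Machine.emit, hb₁.v0, hb₁.v17, h9, hfirst]
      have hw₂ : Written (l ++ [Fin.last k]) s₂ := by
        rw [hs₂, run_seq, run_seq, run_seq]
        refine Written.emit ?_ ?_
        · exact ⟨by simp [Prog.run, hw₁.1], hw₁.2⟩
        · simp [Prog.run, hb₁.v0]
      refine Runs.mono (Runs.loop hm2 (by decide) (len u) (fun _ => 40 * n + 80)
        (Q := Written (l ++ labels u)) (fun j s' => s'.var 20 = val (word u j) ∧
          Written (l ++ (List.range (j + 1)).map fun j => label (word u j)) s') ?_ ?_ ?_) ?_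
        (fun _ _ _ h => h)
      · refine ⟨e20, ?_⟩
        simpa using hw₂
      · rintro j hj s' hs' hF ⟨h20, hw'⟩
        have hb' := hb₂.of_frame hF rfl rfl rfl rfl
        have h25 : s'.var 25 = val (Fin.last k :: u) := (hF.1 25 rfl).trans e25
        have hfin := not_final_word hmem hj
        refine ⟨?_, ?_⟩
        · have : val (word u j) ≠ val (Fin.last k :: u) := fun h =>
            hfin ⟨u, hmem, val_inj (by rw [length_word, List.length_cons]) h⟩
          simp [h20, h25, this]
        · refine Runs.mono (runs_petalStep hk hn hm hb' (hwl j) (last_mem_word u j) hfin h20 hw'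
            ?_) le_rfl ?_
          · simp only [List.length_append, List.length_map, List.length_range]
            omega
          · rintro s'' _ _ ⟨h1, h2⟩
            rw [← word_succ] at h1 h2
            refine ⟨h1, ?_⟩
            rw [List.range_succ, List.map_append, ← List.append_assoc]
            exact h2
      · rintro s' _ hF ⟨h20, hw'⟩
        have h25 : s'.var 25 = val (Fin.last k :: u) := (hF.1 25 rfl).trans e25
        rw [word_len hmem] at h20
        refine ⟨by simp [h20, h25], ?_⟩
        rw [hlabels]
        exact hw'
      · rw [Finset.sum_const, Finset.card_range, smul_eq_mul,
          show (Expr.lit 1 - .op .eq (.var 20) (.var 25)).cost = 5 from rfl]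
  · rw [hll]
    have h1 : len u ≤ n * len u := Nat.le_mul_of_pos_left _ hn
    have h2 : len u * (40 * n + 86) = 40 * (n * len u) + 86 * len u := by ring
    have h3 : 130 * (n * (len u + 1)) = 130 * (n * len u) + 130 * n := by ring
    omega

omit hk hn hm in
theorem length_edges_succ (chosen : ℕ → Prop) (i : ℕ) :
    (edges k n v chosen (i + 1)).length =
      (edges k n v chosen i).length + (1 + (inserted k n v chosen i).length) := by
  rw [edges_succ, List.length_append, List.length_cons]
  omega

omit hk hn hm in
theorem length_edges_mono (chosen : ℕ → Prop) {i j : ℕ} (h : i ≤ j) :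
    (edges k n v chosen i).length ≤ (edges k n v chosen j).length := by
  induction j, h using Nat.le_induction with
  | base => exact le_rfl
  | succ j _ ih =>
    rw [length_edges_succ]
    omega

/-- Each symbol written costs `O(n)` operations, and the blocks of all edges together have `(k + 1)
^ n` symbols. -/
theorem runs_finish {chosen : ℕ → Prop} {s : MState} (hp : HasParams v s)
    (hlen : (edges k n v chosen (k ^ n)).length = (k + 1) ^ n)
    (hch : ∀ i < k ^ n, s.arr 4 (k ^ (n - 1) + i) ≠ 0 ↔ chosen i) :
    Runs m finish s (300 * (n * (k + 1) ^ n)) (Written (symbols k n v chosen)) := by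
  have hn' : n < (k + 1) ^ n := Nat.lt_pow_self (by omega)
  have hm2 : 2 ≤ m := by omega
  have hkn : k + 1 ≤ (k + 1) ^ n := Nat.le_self_pow (by omega) _
  have hK : k ^ n ≤ (k + 1) ^ n := Nat.pow_le_pow_left (by omega) n
  have hnK : n ≤ n * (k + 1) ^ n := Nat.le_mul_of_pos_right _ (by positivity)
  have hKn : (k + 1) ^ n ≤ n * (k + 1) ^ n := Nat.le_mul_of_pos_left _ hn
  refine Runs.mono (Runs.seq (Runs.mono (Runs.simple hm2 rfl fun _ => ?_) (by decide : _ ≤ 10)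
    (fun _ _ _ h => h)) (T' := (14 * n + 8) + (200 * (n * (k + 1) ^ n) + 6))
    (Q' := Written (symbols k n v chosen)) ?_) (by omega) (fun _ _ _ h => h)
  · simp [Prog.Safe, Prog.run, hp.v0]
    omega
  · intro s₁ _ hF₁ hs₁
    have hp₁ := hp.of_frame v hF₁ rfl rfl rfl rfl rfl rfl rfl
    have e17 : s₁.var 17 = k + 1 := by rw [hs₁]; simp [Prog.run, hp.v0]
    have e18 : s₁.var 18 = 1 := by rw [hs₁]; simp [Prog.run]
    have e19 : s₁.var 19 = 0 := by rw [hs₁]; simp [Prog.run]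
    refine Runs.seq (Q := fun s' => s'.var 18 = (k + 1) ^ (n - 1)) ?_ ?_
    · refine Runs.for hm2 (n - 1) _ (fun _ => 4) (by decide) rfl (by omega)
        (fun j s' => s'.var 18 = (k + 1) ^ j) ?_ ?_ ?_ (fun s' _ _ h => h) ?_
      · simp [MState.set_var, e18]
      · intro j _ s' hF _
        have h1' := (hp₁.of_frame v hF rfl rfl rfl rfl rfl rfl rfl).v1
        simp [h1']
      · intro j hj s' hs' hF hI hij
        have h17 : s'.var 17 = k + 1 := (hF.1 17 rfl).trans e17
        have hval : (Expr.var 18 * Expr.var 17).eval s' = (k + 1) ^ (j + 1) := by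
          simp [h17, hI, pow_succ]
        refine Runs.mono (Runs.simple hm2 rfl fun _ => ?_) (by exact le_of_eq rfl) ?_
        · simp only [Prog.Safe]
          rw [hval]
          have : (k + 1) ^ (j + 1) ≤ (k + 1) ^ n := Nat.pow_le_pow_right (by omega) (by omega)
          omega
        · rintro _ _ _ rfl
          simp only [Prog.run, hval]
          simp [MState.set_var]
      · rw [Finset.sum_const, Finset.card_range, smul_eq_mul,
          show (Expr.var 1 - Expr.lit 1).cost = 3 from rfl]
        omega
    · intro s₂ _ hF₂ h18
      have hp₂ := hp₁.of_frame v hF₂ rfl rfl rfl rfl rfl rfl rfl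
      have hb₂ : HasBase k n s₂ := ⟨hp₂.v0, hp₂.v1, (hF₂.1 17 rfl).trans e17, h18⟩
      have h4₂ : s₂.arr 4 = s.arr 4 := (hF₂.2 4 rfl).trans (hF₁.2 4 rfl)
      refine Runs.for hm2 (k ^ n) _
        (fun i => 192 * (n * (1 + (inserted k n v chosen i).length))) (by decide) rfl (by omega)
        (fun i s' => Written ((edges k n v chosen i).map label) s') ?_ ?_ ?_
        (fun s' _ _ h => h) ?_
      · refine ⟨?_, by simp [edges]⟩
        simp only [MState.set_var]
        exact (hF₂.1 19 rfl).trans e19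
      · intro j _ s' hF _
        exact (hp₂.of_frame v hF rfl rfl rfl rfl rfl rfl rfl).v6
      · intro i hi s' hs' hF hI hij
        have hp' := hp₂.of_frame v hF rfl rfl rfl rfl rfl rfl rfl
        have hb' := hb₂.of_frame hF rfl rfl rfl rfl
        have h4' : s'.arr 4 = s.arr 4 := (hF.2 4 rfl).trans h4₂
        have hbound : (edges k n v chosen i).length + (1 + (inserted k n v chosen i).length) ≤
            (k + 1) ^ n := by
          rw [← length_edges_succ, ← hlen]
          exact length_edges_mono chosen hi
        have hsym : (inputState k n v).arr 0 ((i + (n - 1)) % k ^ n) =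
            (label (edge k n v i) : ℕ) := by
          rw [input_mod v hk, label_edge k n v hn]
          rfl
        have hlt := (label (edge k n v i)).2
        refine Runs.mono (Runs.seq (Runs.mono (Runs.simple hm2 rfl fun _ => ?_)
          (by decide : _ ≤ 20) (fun _ _ _ h => h))
          (T' := 5 + (130 * (n * (inserted k n v chosen i).length) + 1))
          (Q' := fun s'' => Written ((edges k n v chosen (i + 1)).map label) s'') ?_) ?_
          (fun _ _ _ h => h)
        · simp [Prog.Safe, Prog.run, Machine.emit, hp'.v1, hp'.v6, hp'.a0, hij, hsym, hI.1]
          omega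
        · intro s₃ _ hF₃ hs₃
          have hp₃ := hp'.of_frame v hF₃ rfl rfl rfl rfl rfl rfl rfl
          have hb₃ := hb'.of_frame hF₃ rfl rfl rfl rfl
          have h7₃ : s₃.var 7 = i := (hF₃.1 7 rfl).trans hij
          have h4₃ : s₃.arr 4 = s.arr 4 := (hF₃.2 4 rfl).trans h4'
          have hw₃ : Written ((edges k n v chosen i).map label ++ [label (edge k n v i)]) s₃ := by
            rw [hs₃, run_seq]
            refine Written.emit ?_ ?_
            · exact ⟨by simp [Prog.run, hI.1], hI.2⟩
            · simp [Prog.run, hp'.v1, hp'.v6, hp'.a0, hij, hsym]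
          have heval : (Expr.get 4 (.var 5 + .var 7)).eval s₃ = s.arr 4 (k ^ (n - 1) + i) := by
            simp [h4₃, hp₃.v5, h7₃]
          refine Runs.ite (T := 130 * (n * (inserted k n v chosen i).length)) hm2 (by decide) ?_ ?_
          · rw [heval, hch i hi]
            intro hc
            have hins : inserted k n v chosen i = words (head k n v i) := by simp [inserted, hc]
            have hlw : (labels (head k n v i)).length = (inserted k n v chosen i).length := by
              rw [hins, labels, List.length_map]
            have := runs_petal hk hn hm hb₃ hp₃.v6 hp₃.a0 h7₃ hw₃ (by
              rw [hlw]
              simp only [List.length_append, List.length_map, List.length_singleton]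
              omega)
            rw [hlw] at this
            refine Runs.mono this le_rfl fun s'' _ _ h => ?_
            rw [edges_succ, hins]
            simpa [labels] using h
          · rw [heval]
            intro h0
            have hc : ¬ chosen i := fun hc => (hch i hi).2 hc h0
            refine Runs.mono (Runs.simple hm2 rfl fun _ => trivial) (le_of_eq rfl) ?_
            rintro _ _ _ rfl
            rw [edges_succ]
            simpa [inserted, hc, Prog.run] using hw₃
        · have : n * (1 + (inserted k n v chosen i).length) =
            n + n * (inserted k n v chosen i).length := by ring
          omega
      · rw [show (Expr.var 6).cost = 1 from rfl]
        refine Nat.add_le_add_right ?_ 6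
        have hsum : ∀ j, ∑ i ∈ Finset.range j, (1 + (inserted k n v chosen i).length) =
            (edges k n v chosen j).length := by
          intro j
          induction j with
          | zero => simp [edges]
          | succ j ih => rw [Finset.sum_range_succ, ih, length_edges_succ]
        rw [← hlen, ← hsum, ← mul_assoc, Finset.mul_sum]
        refine Finset.sum_le_sum fun i _ => ?_
        have h1 : 1 * (1 + (inserted k n v chosen i).length) ≤
          n * (1 + (inserted k n v chosen i).length) := Nat.mul_le_mul_right _ hn
        rw [mul_assoc]
        omega

end Finish

end Machine

/-! ### The whole algorithm -/

/-- Increasing the exponent by one multiplies the left side by at most `2 * (k + 1)` and the right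
side by `k ^ 3`, which is larger because `2 ≤ k`. -/
theorem mul_succ_pow_le {k : ℕ} (hk : 2 ≤ k) : ∀ n : ℕ,
    (n + 1) * (k + 1) ^ (n + 1) ≤ 2 * (k ^ n) ^ 3 * k := by
  intro n
  induction n with
  | zero => simp; omega
  | succ n ih =>
    have h1 : (n + 1 + 1) * (k + 1) ^ (n + 1 + 1) ≤
        2 * (k + 1) * ((n + 1) * (k + 1) ^ (n + 1)) := by
      have : (n + 1 + 1) * (k + 1) ^ (n + 1 + 1) = (n + 1 + 1) * ((k + 1) * (k + 1) ^ (n + 1)) := by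
        ring
      rw [this]
      have h : n + 1 + 1 ≤ 2 * (n + 1) := by omega
      calc _ ≤ 2 * (n + 1) * ((k + 1) * (k + 1) ^ (n + 1)) := Nat.mul_le_mul_right _ h
        _ = _ := by ring
    have h2 : 2 * (k + 1) ≤ k ^ 3 := by
      nlinarith [Nat.mul_le_mul hk hk, Nat.mul_le_mul_right k (Nat.mul_le_mul hk hk)]
    calc _ ≤ _ := h1
      _ ≤ k ^ 3 * (2 * (k ^ n) ^ 3 * k) := Nat.mul_le_mul h2 ih
      _ = _ := by ring

open Machine in
theorem proposition1 :
    ∃ (prep round finish : Prog) (C : ℕ), ∀ k n : ℕ, 2 ≤ k → 1 ≤ n →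
      Nat.card (NetVertex k n) = 2 * k ^ (n - 1) + 2 ∧
      Nat.card (NetEdge k n) = (k + 2) * k ^ (n - 1) ∧
      ∀ v : ZMod (k ^ n) → Fin k, IsDeBruijn k n v →
        ∃ (s₁ s₂ s₃ : MState) (t₁ t₂ t₃ : ℕ) (f : NetEdge k n → ℕ)
          (w : ZMod ((k + 1) ^ n) → Fin (k + 1)),
          -- the flow network of the distribution graph is built
          (Exec (k ^ (C * n)) prep (inputState k n v) s₁ t₁ ∧
            HoldsNetwork (distNetwork k n v) s₁) ∧
          -- Edmonds-Karp is run on it, from the zero flow on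
          (EKExec (k ^ (C * n)) (distNetwork k n v) round s₁ (fun _ => 0) s₂ f t₂ ∧
            t₂ ≤ C * (Nat.card (NetVertex k n) ^ 2 * Nat.card (NetEdge k n))) ∧
          -- the petals are inserted at the chosen vertices
          (Exec (k ^ (C * n)) finish s₂ s₃ t₃ ∧ HoldsResult w s₃ ∧
            IsPetalExtension k n v f w) ∧
          -- the rest does not cost more, up to a constant
          t₁ + t₃ ≤ C * (Nat.card (NetVertex k n) ^ 2 * Nat.card (NetEdge k n)) ∧
          -- the result is an extension as required
          (IsDeBruijn (k + 1) n w ∧ IsCircularSubseq v w ∧ NewSymbolWithin w (n + 2 * k - 1)) ∧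
          -- the whole construction is one program within the time bound
          Exec (k ^ (C * n)) (.seq prep (.seq (ekLoop round) finish)) (inputState k n v) s₃
              (t₁ + (t₂ + t₃)) ∧
          t₁ + (t₂ + t₃) ≤ C * k ^ (3 * n - 2) := by
  refine ⟨Machine.prep, Machine.round, Machine.finish, 20000, fun k n hk2 hn =>
    ⟨card_netVertex, card_netEdge, fun v hv => ?_⟩⟩
  have hk : 1 ≤ k := by omega
  -- the sizes of the numbers
  have hm : 16 * (k + 1) ^ n ≤ k ^ (6 * n) := by
    have h1 : 16 ≤ k ^ (4 * n) := by
      calc 16 = 2 ^ (4 * 1) := by norm_num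
        _ ≤ k ^ (4 * 1) := Nat.pow_le_pow_left hk2 _
        _ ≤ k ^ (4 * n) := Nat.pow_le_pow_right hk (by omega)
    have h2 : (k + 1) ^ n ≤ k ^ (2 * n) := by
      rw [pow_mul]
      exact Nat.pow_le_pow_left (by nlinarith) n
    calc _ ≤ k ^ (4 * n) * k ^ (2 * n) := Nat.mul_le_mul h1 h2
      _ = _ := by rw [← pow_add]; ring_nf
  have hB : (k ^ (6 * n)) ^ 20 ≤ k ^ (20000 * n) := by
    rw [← pow_mul]
    exact Nat.pow_le_pow_right hk (by omega)
  generalize k ^ (6 * n) = m at hm hB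
  have hkn : k + 1 ≤ (k + 1) ^ n := Nat.le_self_pow (by omega) _
  have hn' : n < (k + 1) ^ n := Nat.lt_pow_self (by omega)
  have hs₀ : (inputState k n v).Le m := by
    refine ⟨fun x => ?_, fun a i => ?_⟩
    · simp only [inputState]
      split_ifs <;> omega
    · simp only [inputState]
      split_ifs with h
      · have := (v (i : ZMod (k ^ n))).2
        omega
      · omega
  -- the three parts of the program
  obtain ⟨s₁, t₁, hE₁, ht₁, hle₁, hp₁, h4₁, hfill⟩ := runs_prep v hk hn hm hs₀
  have hN₁ := hfill.holdsNetwork v hk hn hp₁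
  have hf₁ : HoldsFlow (fun _ : NetEdge k n => 0) s₁ := by
    intro e
    rw [hE₁.frame.2 4 rfl]
    rfl
  have hu₁ : IsUnitFlow v (fun _ => 0) :=
    ⟨fun _ => Nat.zero_le _, fun x _ _ => by simp [FlowNetwork.excess]⟩
  obtain ⟨s₂, f, t₂, hEK, ht₂, hle₂, hp₂, hf₂, hu₂, hmax⟩ := exists_ekExec hk hn hm (k ^ (n - 1))
    s₁ _ hle₁ hp₁ hN₁ hf₁ hu₁ (by omega) (by simp)
  -- The flow is indexed by pairs, the edges of the cycle by numbers; `j * k + r` with `r < k`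
  -- identifies the two.
  set chosen : ℕ → Prop := fun i =>
    ∃ (j : Fin (k ^ (n - 1))) (r : Fin k), (j : ℕ) * k + r = i ∧ f (.occ j r) = 1 with hchosen
  have hc : ∀ (j : Fin (k ^ (n - 1))) (r : Fin k), chosen (j * k + r) ↔ f (.occ j r) = 1 := by
    intro j r
    constructor
    · rintro ⟨j', r', h, h1⟩
      obtain ⟨hj, hr⟩ := occ_injective r'.2 r.2 h
      rwa [Fin.ext hj, Fin.ext hr] at h1
    · exact fun h => ⟨j, r, rfl, h⟩
  obtain ⟨hsel, hsect⟩ := selects_of_max hu₂ hn hk hv hmax hc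
  have hch : ∀ i < k ^ n, s₂.arr 4 (k ^ (n - 1) + i) ≠ 0 ↔ chosen i := by
    intro i hi
    obtain ⟨j, r, rfl⟩ := exists_occ hn hi
    have h1 := hf₂ (.occ j r)
    have h2 := hu₂.le_one (.occ j r)
    rw [hc, ← h1]
    rw [← h1] at h2
    simp only [NetEdge.num] at h2 ⊢
    omega
  obtain ⟨s₃, t₃, hE₃, ht₃, -, hw⟩ :=
    runs_finish hk hn hm hp₂ (Extension.length_edges hk hn hv hsel) hch hle₂
  -- the running time
  set M := k ^ (n - 1) with hM
  set K := (k + 1) ^ n with hK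
  have hM0 : 1 ≤ M := Nat.pow_pos hk
  have hcost : n * K ≤ 2 * (M ^ 3 * k) := by
    have := mul_succ_pow_le hk2 (n - 1)
    rw [Nat.sub_add_cancel hn] at this
    exact this.trans_eq (mul_assoc _ _ _)
  have hcost' : n * k ^ n ≤ n * K := Nat.mul_le_mul_left _ (Nat.pow_le_pow_left (by omega) n)
  have hpow : k ^ (3 * n - 2) = M ^ 3 * k := by
    rw [hM, ← pow_mul, ← pow_succ]
    congr 1
    omega
  rw [card_netVertex, card_netEdge, ← hM] at ht₂ ⊢
  set V := 2 * M + 2 with hV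
  set E := (k + 2) * M with hE
  have hVE : V ^ 2 * E = V * (V * E) := by ring
  have hVE1 : M ^ 3 * k ≤ V ^ 2 * E := by
    calc M ^ 3 * k = M ^ 2 * (k * M) := by ring
      _ ≤ V ^ 2 * E := Nat.mul_le_mul (Nat.pow_le_pow_left (by omega) 2)
        (Nat.mul_le_mul_right _ (by omega))
  have hVE2 : V ^ 2 * E ≤ 32 * (M ^ 3 * k) := by
    calc V ^ 2 * E ≤ (4 * M) ^ 2 * (2 * k * M) := Nat.mul_le_mul
          (Nat.pow_le_pow_left (by omega) 2) (Nat.mul_le_mul_right _ (by omega))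
      _ = 32 * (M ^ 3 * k) := by ring
  -- There are at most `M + 1` rounds, and `V = 2 * (M + 1)`, so the tests of the loop are absorbed
  -- as well.
  have ht₂' : t₂ ≤ 304 * (V ^ 2 * E) := by
    have h1 : (M + 1) * (V * E) ≤ V * (V * E) := Nat.mul_le_mul_right _ (by omega)
    have h2 : V ≤ V * (V * E) := Nat.le_mul_of_pos_right _ (by positivity)
    have h3 : (M + 1) * (300 * (V * E) + 2) = 300 * ((M + 1) * (V * E)) + 2 * (M + 1) := by ring
    omega
  have hres : HoldsResult (Extension.sequence k n v chosen) s₃ := by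
    intro i hi
    have hlen : (Extension.symbols k n v chosen).length = (k + 1) ^ n := by
      rw [Extension.symbols, List.length_map, Extension.length_edges hk hn hv hsel]
    rw [hw.2 i (by omega), Extension.sequence_natCast hi]
  have hpetal : IsPetalExtension k n v f (Extension.sequence k n v chosen) := by
    refine ⟨fun i => (Extension.inserted k n v chosen i).map Petal.label, 0, fun j r => ⟨?_, ?_⟩, ?_⟩
    · intro h
      simp only [Extension.inserted, if_pos ((hc j r).2 h)]
      exact Petal.isPetal_labels hn _
    · intro h
      simp only [Extension.inserted, if_neg (mt (hc j r).1 h), List.map_nil]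
    · rw [Extension.readFrom_sequence hk hn hv hsel, Extension.symbols_eq hn]
  refine ⟨s₁, s₂, s₃, t₁, t₂, t₃, f, Extension.sequence k n v chosen, ⟨hE₁.mono hB, hN₁⟩,
    ⟨hEK.mono hB, by omega⟩, ⟨hE₃.mono hB, hres, hpetal⟩, by omega,
    ⟨Extension.isDeBruijn_sequence hk hn hv hsel, Extension.isCircularSubseq_sequence hk hn hv hsel,
      Extension.newSymbolWithin_sequence hk hn hv hsel hsect⟩,
    .seq (hE₁.mono hB) (.seq (hEK.mono hB).exec (hE₃.mono hB)), ?_⟩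
  -- In units of `M ^ 3 * k`, Edmonds–Karp takes at most `304 * 32` and the other two parts at most
  -- `2 * 300 * 2`, together less than `20000`.
  rw [hpow]
  omega
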